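/- **Setting.** Fix a slicing parameter $M>1$, a mass $m\neq 0$ and a maximal interaction order $p$. A *graph* $\mathcal G$ of the rank-$4$ tensorial field theory on $\mathrm U(1)$ with gauge invariance is a finite set of white and black nodes such that every node is the end of exactly one colored line of each color $c\in\{1,2,3,4\}$ and of at most one line of color $0$, all of these joining a white node to a black one. The lines of color $0$ are the *lines* of $\mathcal G$, and $L(\mathcal G)$ is their number; nodes without a line carry an *external leg*. The components of the colored lines are the *vertices* (bubbles); every bubble has at most $p$ nodes. $\mathcal G$ is *connected* if its nodes are connected through lines of all colors, and *non-vacuum* if it has an external leg. The faces of color $c$ are the chains and circuits alternating between lines and colored lines of color $c$. A *subgraph* is a set $\mathcal H$ of lines. Its internal faces are the closed faces passing only through lines of $\mathcal H$, its external faces the maximal open pieces of faces through lines of $\mathcal H$; it is connected if the line / internal-face incidence matrix of $\mathcal H$ does not split into blocks. Contracting a line means deleting its two end nodes and the colored lines joining them, and reconnecting the remaining colored half-lines color by color. A *melopole* is a non-empty connected subgraph attached to a single vertex whose lines can be ordered $l_1,\dots,l_k$ so that, after contraction of $l_1,\dots,l_{i-1}$, the ends of $l_i$ are joined by exactly three colored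 lines. A *meloforest* is a (possibly empty) set of melopoles any two of which either are nested, or have no common line and no internal face of their union passing through both. **Amplitudes.** Let $K_\alpha(\theta)=\sqrt{\pi/\alpha}\,\sum_{n\in\mathbb Z}e^{-(\theta-2\pi n)^2/4\alpha}$ be the heat kernel of $\mathrm U(1)$ (normalized for the Haar probability measure $d\theta/2\pi$). Put an angle $\theta_x$ on each colored line $x$ and, on each line $e$, a holonomy $h_e$ and a Schwinger parameter $\alpha_e$. With cutoff $\rho\in\mathbb N$, and paired with a function $\varphi$ of the $4$ angles at each external leg, the amplitude is $$\mathcal A_{\mathcal G,\rho}(\varphi)=\Big[\prod_{e}\int_{M^{-2\rho}}^{\infty}d\alpha_e\,e^{-m^2\alpha_e}\int dh_e\Big]\Big[\prod_x\int d\theta_x\Big]\ \prod_e\prod_{c=1}^4K_{\alpha_e}\big(\theta_{w(e,c)}+h_e-\theta_{b(e,c)}\big)\ \varphi(\theta),$$ where $w(e,c)$, $b(e,c)$ are the colored lines of color $c$ at the white and the black end of $e$ and all angular integrals are with respect to Haar probability measure. For a subgraph $\mathcal H$, $\tau_{\mathcal H}$ acts on the integrand by replacing, in all factors not belonging to $\mathcal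 H$ (including $\varphi$), the target variable of every external face of $\mathcal H$ by its source variable. The renormalized amplitude is $$\mathcal A^R_{\mathcal G,\rho}(\varphi)=\sum_{\mathcal F\text{ meloforest}}\ \Big(\prod_{\mathcal H\in\mathcal F}(-\tau_{\mathcal H})\Big)\mathcal A_{\mathcal G,\rho}(\varphi).$$ **Proposition.** For all $M>1$, $m\ne0$ and $p$ there is a constant $K>0$ such that, for every connected non-vacuum graph $\mathcal G$ with bubbles of order at most $p$, every cutoff $\rho\in\mathbb N$, and every smooth $2\pi$-periodic $\varphi$ all of whose mixed partial derivatives of order at most one in each variable (including $\varphi$ itself) are bounded by $C$ in absolute value, the integrals defining $\mathcal A^R_{\mathcal G,\rho}(\varphi)$ converge absolutely and $$|\mathcal A^R_{\mathcal G,\rho}(\varphi)|\le C\,K^{L(\mathcal G)}.$$ In particular ($\varphi=1$) the renormalized amplitude with its external faces integrated out satisfies $|\mathcal A^R_{\mathcal G,\rho}|\le K^{L(\mathcal G)}$, uniformly in $\rho$. -/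

import Mathlib

open MeasureTheory

/-- A Feynman graph of the rank-four tensorial field theory, given by its colored extension: white
nodes (fields), black nodes (conjugate fields), for every color `c : Fin 4` and every white node
`w` one colored line of color `c` from `w` to the black node `coloredLine c w`, and the
propagators ("lines", of color `0`), each joining a white node to a black node, with at most one
line per node. The vertices of the graph are its bubbles, i.e. the connected components of the
colored lines. Nodes that carry no line carry an external leg. -/
structure FeynmanGraph where
  White : Type
  Black : Type
  Line : Type
  [fintypeWhite : Fintype White]
  [fintypeBlack : Fintype Black]
  [fintypeLine : Fintype Line]
  [decEqWhite : DecidableEq White]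
  [decEqBlack : DecidableEq Black]
  [decEqLine : DecidableEq Line]
  coloredLine : Fin 4 → White ≃ Black
  whiteEnd : Line ↪ White
  blackEnd : Line ↪ Black

attribute [instance] FeynmanGraph.fintypeWhite FeynmanGraph.fintypeBlack FeynmanGraph.fintypeLine
  FeynmanGraph.decEqWhite FeynmanGraph.decEqBlack FeynmanGraph.decEqLine

namespace FeynmanGraph

variable (G : FeynmanGraph)

/-- The nodes, joined by the colored lines only; its connected components are the bubbles. -/
def bubbleGraph : SimpleGraph (G.White ⊕ G.Black) :=
  SimpleGraph.fromRel fun x y => ∃ c w, x = Sum.inl w ∧ y = Sum.inr (G.coloredLine c w)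

/-- The nodes, joined by the colored lines and by the lines of color `0`. -/
def coloredExtension : SimpleGraph (G.White ⊕ G.Black) :=
  G.bubbleGraph ⊔
    SimpleGraph.fromRel fun x y =>
      ∃ e, x = Sum.inl (G.whiteEnd e) ∧ y = Sum.inr (G.blackEnd e)

/-- Connectedness as a Feynman graph (bubbles joined by lines). -/
def IsConnected : Prop := G.coloredExtension.Connected

/-- Every interaction bubble has at most `p` nodes: the interaction has order at most `p`. -/
def OrderAtMost (p : ℕ) : Prop :=
  ∀ x, {y | G.bubbleGraph.Reachable x y}.ncard ≤ p

/-- External legs: the white and the black nodes that carry no line. -/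
abbrev ExtLeg : Type :=
  {w : G.White // ∀ e, G.whiteEnd e ≠ w} ⊕ {b : G.Black // ∀ e, G.blackEnd e ≠ b}

/-- A vacuum graph has no external leg. -/
def IsVacuum : Prop := IsEmpty G.ExtLeg

/-! ### Faces, subgraphs, contractions, melopoles -/

/-- `FaceStep c e e'`: following the face of color `c` through `e` from the white to the black end
of `e`, and then along the colored line of color `c`, the next line met is `e'`. -/
def FaceStep (c : Fin 4) (e e' : G.Line) : Prop :=
  G.coloredLine c (G.whiteEnd e') = G.blackEnd e

/-- A subgraph is a set `H` of lines. Two lines share an internal face of `H` if they lie on a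
common closed face (of some color `c`) all of whose lines are in `H`. -/
def ShareInternalFace (H : Finset G.Line) (e e' : G.Line) : Prop :=
  ∃ c, Relation.TransGen (fun a b => a ∈ H ∧ b ∈ H ∧ G.FaceStep c a b) e e' ∧
    Relation.TransGen (fun a b => a ∈ H ∧ b ∈ H ∧ G.FaceStep c a b) e' e

/-- Connectedness of a subgraph in the tensorial sense: the incidence matrix between the lines of
`H` and the internal faces of `H` does not split into blocks. -/
def FaceConnected (H : Finset G.Line) : Prop :=
  ∀ e ∈ H, ∀ e' ∈ H, Relation.ReflTransGen (G.ShareInternalFace H) e e'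

/-- All lines of `H` are hooked, at both ends, to one and the same bubble. -/
def SingleVertex (H : Finset G.Line) : Prop :=
  ∀ e ∈ H, ∀ e' ∈ H,
    G.bubbleGraph.Reachable (Sum.inl (G.whiteEnd e)) (Sum.inl (G.whiteEnd e')) ∧
    G.bubbleGraph.Reachable (Sum.inl (G.whiteEnd e)) (Sum.inr (G.blackEnd e'))

/-- Contraction of the line `e` in the colored graph `π`. In each color, the two colored lines that
arrive at the end nodes of `e` from outside are glued into one line between their other ends. The
end nodes of `e` should then be deleted; instead they are left as a pair of nodes joined to each
other by all four colors, cut off from all the other nodes. -/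
def contractLine (π : Fin 4 → G.White ≃ G.Black) (e : G.Line) : Fin 4 → G.White ≃ G.Black :=
  fun c => (π c).trans (Equiv.swap (π c (G.whiteEnd e)) (G.blackEnd e))

/-- Successive contraction of a list of lines. -/
def contractLines (l : List G.Line) : Fin 4 → G.White ≃ G.Black :=
  l.foldl G.contractLine G.coloredLine

/-- In the colored graph `π` the line `e` is a `4`-dipole: its end nodes are joined by exactly
three colored lines. -/
def IsFourDipole (π : Fin 4 → G.White ≃ G.Black) (e : G.Line) : Prop :=
  (Finset.univ.filter fun c => π c (G.whiteEnd e) = G.blackEnd e).card = 3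

/-- Melopoles: non-empty connected single-vertex subgraphs whose lines can be ordered in such a way
that each line is a `4`-dipole once all the previous ones have been contracted. -/
def IsMelopole (H : Finset G.Line) : Prop :=
  H.Nonempty ∧ G.FaceConnected H ∧ G.SingleVertex H ∧
    ∃ l : List G.Line, l.Nodup ∧ l.toFinset = H ∧
      ∀ (i : ℕ) (hi : i < l.length), G.IsFourDipole (G.contractLines (l.take i)) l[i]

/-- Line- and face-disjoint subgraphs: no common line, and no internal face of the union passes
through both of them (so that they are not connected to each other in the union). -/
def LineFaceDisjoint (H H' : Finset G.Line) : Prop :=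
  Disjoint H H' ∧ ∀ e ∈ H, ∀ e' ∈ H', ¬ G.ShareInternalFace (H ∪ H') e e'

/-- Meloforests: sets of melopoles that are pairwise line- and face-disjoint, or nested. -/
def IsMeloforest (F : Finset (Finset G.Line)) : Prop :=
  (∀ H ∈ F, G.IsMelopole H) ∧
    ∀ H ∈ F, ∀ H' ∈ F, G.LineFaceDisjoint H H' ∨ H ⊆ H' ∨ H' ⊆ H

open Classical in
/-- The finite set of all meloforests, including the empty one. -/
noncomputable def meloforests : Finset (Finset (Finset G.Line)) :=
  Finset.univ.filter G.IsMeloforest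

/-! ### Amplitudes -/

/-- One step backwards along the face of color `c` through a line of `U`: the colored line
`(c, w)` (which starts at the white node `w`) ends at a black node; if that node carries a line of
`U`, pass to the colored line of color `c` at the white end of it, otherwise stay. -/
noncomputable def backStep (U : Finset G.Line) (c : Fin 4) (w : G.White) : G.White :=
  open Classical in
  if h : ∃ e ∈ U, G.blackEnd e = G.coloredLine c w then G.whiteEnd h.choose else w

/-- The source of the external face of `U` of color `c` whose target is the colored line `(c, w)`
(and `w` itself if there is no such face). -/
noncomputable def source (U : Finset G.Line) (c : Fin 4) (w : G.White) : G.White :=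
  (G.backStep U c)^[Fintype.card G.White] w

/-- The values of the variables at the external legs after the action of `∏ τ_H`, `H ∈ F`.
There is one angle `θ (c, w)` for each colored line. -/
noncomputable def legAngles (F : Finset (Finset G.Line)) (θ : Fin 4 × G.White → ℝ) :
    G.ExtLeg × Fin 4 → ℝ
  | (Sum.inl w, c) => θ (c, G.source (F.sup id) c w.1)
  | (Sum.inr b, c) => θ (c, (G.coloredLine c).symm b.1)

end FeynmanGraph

/-- The heat kernel of `U(1)` at time `α` in the angle coordinate, normalized with respect to the
Haar probability measure. -/
noncomputable def heatKernel (α θ : ℝ) : ℝ :=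
  Real.sqrt (Real.pi / α) * ∑' n : ℤ, Real.exp (-(θ - 2 * Real.pi * n) ^ 2 / (4 * α))

/-- The Haar probability measure of `U(1)` in the angle coordinate `θ ∈ (0, 2π]`. -/
noncomputable def angleMeasure : Measure ℝ :=
  (ENNReal.ofReal (2 * Real.pi))⁻¹ • volume.restrict (Set.Ioc 0 (2 * Real.pi))

namespace FeynmanGraph

variable (G : FeynmanGraph)

/-- The integrand of `(∏_{H ∈ F} τ_H) A_G`, paired with a test function `φ` of the variables at the
external legs; `α e` and `h e` are the Schwinger parameter and the holonomy of the line `e`.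
The operator `τ_H` replaces, in all factors that do not belong to `H` (lines outside `H`, and the
test function), the target variable of each external face of `H` by its source variable. So the
factor of a line `e` is affected by the `H ∈ F` with `e ∉ H`, and the test function by all of them.
For `F = ∅` this is the integrand of the amplitude of `G` itself. -/
noncomputable def integrand (m : ℝ) (F : Finset (Finset G.Line)) (φ : (G.ExtLeg × Fin 4 → ℝ) → ℂ)
    (x : (G.Line → ℝ) × (G.Line → ℝ) × (Fin 4 × G.White → ℝ)) : ℂ :=
  let α := x.1
  let h := x.2.1
  let θ := x.2.2
  ((∏ e : G.Line, Real.exp (-m ^ 2 * α e) * ∏ c : Fin 4,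
      heatKernel (α e)
        (θ (c, G.source ((F.filter fun H => e ∉ H).sup id) c (G.whiteEnd e)) + h e
          - θ (c, (G.coloredLine c).symm (G.blackEnd e))) : ℝ) : ℂ)
    * φ (G.legAngles F θ)

/-- The integration measure at cutoff `ρ`: Schwinger parameters in `[M ^ (-2ρ), ∞)`, Haar measure
for the holonomies of the lines and for the variables on the colored lines. -/
noncomputable def cutoffMeasure (M : ℝ) (ρ : ℕ) :
    Measure ((G.Line → ℝ) × (G.Line → ℝ) × (Fin 4 × G.White → ℝ)) :=
  (Measure.pi fun _ : G.Line => volume.restrict (Set.Ici ((M ^ (2 * ρ))⁻¹))).prod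
    ((Measure.pi fun _ : G.Line => angleMeasure).prod
      (Measure.pi fun _ : Fin 4 × G.White => angleMeasure))

/-- The regularized renormalized amplitude
`A^R_G = ∑_F ∏_{H ∈ F} (-τ_H) A_G` (sum over all meloforests), paired with `φ`. -/
noncomputable def renormalizedAmplitude (M m : ℝ) (ρ : ℕ)
    (φ : (G.ExtLeg × Fin 4 → ℝ) → ℂ) : ℂ :=
  ∑ F ∈ G.meloforests, (-1) ^ F.card * ∫ x, G.integrand m F φ x ∂(G.cutoffMeasure M ρ)

/-- `φ` is a smooth function on `U(1) ^ (4 N)`, the variables being four angles for each of the `N`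
external legs, and all its mixed partial derivatives of order at most one in each variable,
`φ` itself included, are bounded by `C`. -/
structure IsTestFunction (φ : (G.ExtLeg × Fin 4 → ℝ) → ℂ) (C : ℝ) : Prop where
  smooth : ContDiff ℝ ((⊤ : ℕ∞) : WithTop ℕ∞) φ
  periodic : ∀ x i, φ (x + Pi.single i (2 * Real.pi)) = φ x
  bound : ∀ (k : ℕ) (i : Fin k ↪ G.ExtLeg × Fin 4) (x : G.ExtLeg × Fin 4 → ℝ),
    ‖iteratedFDeriv ℝ k φ x (fun j => Pi.single (i j) 1)‖ ≤ C

end FeynmanGraph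

/-!
The bound is proved in momentum space. By Poisson summation the heat kernels are Fourier series, and
after integration over the holonomies and the angles the amplitude becomes a sum over integer
momenta, one for every line and color and one for every external leg and color. The momenta are
conserved at the lines (their sum over the four colors vanishes) and along the faces; a line
contributes the propagator `exp (-t (m² + s)) / (m² + s)`, where `s` is the square of its momentum and
`t` the cutoff, and the test function contributes its Fourier coefficients, which decay like the
inverse of each external momentum.

*The forest formula.* A set of lines is called melonic if it can be contracted line by line, each
line being a dipole when its turn comes. In a connected graph with external legs a contraction never
cuts off a set of lines (`Melonic.not_closed`), so that a melonic line is joined in exactly three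
colors at the moment of its contraction, and the remaining one, its *free color*, depends on the
line alone (`Melonic.mem_joined_iff`). The melonic lines form a forest, a line being a child of the
line whose contraction closes one of its faces; a melopole is the set of all descendants of a melonic
line, its root, and every set of melopoles is a meloforest (`meloforests_eq`). The only external face
of a melopole runs through its root, in the free color of the root. Therefore the product of the
operators `τ` of a meloforest amounts to putting to zero the momenta of the roots in their free colors
(`source_line`, `bijOn_mask`), and the sum over all meloforests replaces the propagator of every melonic
line by its difference with the propagator at vanishing momentum of free color
(`hasSum_renormalizedAmplitude`).

*Resummation of the melonic lines.* Contraction of a dipole splits off the momenta of three closed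
faces (`extendEquiv`). The sum over them diverges logarithmically when the cutoff is removed, but after
the subtraction only the variation with the external momentum counts, and this converges
(`slowlyVarying_dipole`). The result is a weight on the colored line that replaces the dipole. It grows
like a small power of the momentum and varies accordingly, as do the weights that it has absorbed; the
exponent depends only on the number of lines contracted in the bubble, which is at most `p`. In this
way all melonic lines are summed over, one after the other (`Melonic.exists_weights`).

*Power counting.* The remaining lines are not dipoles. They are explored one by one: the exploration
always proceeds to a line one of whose momenta is known already. If at most two of its momenta are
unknown, conservation leaves a single sum, for which the quadratic decay of the propagator is more
than sufficient. If three are unknown there are two sums, and a small power of one of the momenta is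
missing; this debt is passed on to the next line of the same face, which can be chosen in the same
bubble because the line is not a dipole (`Indebted.step`). A bubble has at most `p` lines, so that the
debt remains small until it is paid. All sums converge, each with a constant that depends on `m` and
`p` only (`norm_le_of_hasSum`).
-/

/-! ### Contraction of sets of lines -/

namespace FeynmanGraph

variable (G : FeynmanGraph)

lemma contractLine_apply (π : Fin 4 → G.White ≃ G.Black) (e : G.Line) (c : Fin 4) (w : G.White) :
    G.contractLine π e c w =
      Equiv.swap (π c (G.whiteEnd e)) (G.blackEnd e) (π c w) := rfl

lemma contractLine_whiteEnd (π : Fin 4 → G.White ≃ G.Black) (e : G.Line) (c : Fin 4) :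
    G.contractLine π e c (G.whiteEnd e) = G.blackEnd e := by
  simp [contractLine_apply]

lemma contractLine_comm (π : Fin 4 → G.White ≃ G.Black) (e e' : G.Line) :
    G.contractLine (G.contractLine π e) e' = G.contractLine (G.contractLine π e') e := by
  rcases eq_or_ne e e' with rfl | h
  · rfl
  funext c
  apply Equiv.ext
  intro x
  have hw : G.whiteEnd e ≠ G.whiteEnd e' := G.whiteEnd.injective.ne h
  have hb : G.blackEnd e ≠ G.blackEnd e' := G.blackEnd.injective.ne h
  have h1 : ∀ y z, π c y = π c z → y = z := fun y z h => (π c).injective h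
  simp only [contractLine_apply, Equiv.swap_apply_def]
  grind

lemma contractLines_append (l : List G.Line) (e : G.Line) :
    G.contractLines (l ++ [e]) = G.contractLine (G.contractLines l) e := by
  simp [contractLines]

lemma contractLines_perm {l l' : List G.Line} (h : l.Perm l') :
    G.contractLines l = G.contractLines l' := by
  have : RightCommutative G.contractLine := ⟨G.contractLine_comm⟩
  exact h.foldl_eq _

/-- The colored graph left by the contraction of all lines of `S`; contractions commute, so that
the order does not matter. -/
noncomputable def contractSet (S : Finset G.Line) : Fin 4 → G.White ≃ G.Black :=
  G.contractLines S.toList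

lemma contractLines_eq_contractSet {l : List G.Line} (h : l.Nodup) :
    G.contractLines l = G.contractSet l.toFinset :=
  G.contractLines_perm (List.toFinset_toList h).symm

lemma contractSet_empty : G.contractSet ∅ = G.coloredLine := by
  simp [contractSet, contractLines]

lemma contractSet_insert_of_notMem {S : Finset G.Line} {e : G.Line} (h : e ∉ S) :
    G.contractSet (insert e S) = G.contractLine (G.contractSet S) e := by
  rw [contractSet, contractSet, ← contractLines_append]
  exact G.contractLines_perm ((Finset.toList_insert h).trans (List.perm_append_singleton e _).symm)

lemma contractSet_whiteEnd {S : Finset G.Line} {e : G.Line} (h : e ∈ S) (c : Fin 4) :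
    G.contractSet S c (G.whiteEnd e) = G.blackEnd e := by
  rw [← Finset.insert_erase h, contractSet_insert_of_notMem _ (Finset.notMem_erase e S),
    contractLine_whiteEnd]

lemma contractSet_insert (S : Finset G.Line) (e : G.Line) :
    G.contractSet (insert e S) = G.contractLine (G.contractSet S) e := by
  by_cases h : e ∈ S
  · rw [Finset.insert_eq_of_mem h]
    funext c
    apply Equiv.ext
    intro x
    simp [contractLine_apply, contractSet_whiteEnd _ h]
  · exact G.contractSet_insert_of_notMem h

lemma contractSet_eq_blackEnd_iff {S : Finset G.Line} {e : G.Line} (h : e ∈ S) (c : Fin 4)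
    (w : G.White) : G.contractSet S c w = G.blackEnd e ↔ w = G.whiteEnd e := by
  rw [← G.contractSet_whiteEnd h c, (G.contractSet S c).injective.eq_iff]

/-- The colors of the colored lines of `π` that join the two ends of the line `e`. -/
def joined (π : Fin 4 → G.White ≃ G.Black) (e : G.Line) : Finset (Fin 4) :=
  Finset.univ.filter fun c => π c (G.whiteEnd e) = G.blackEnd e

lemma mem_joined {π : Fin 4 → G.White ≃ G.Black} {e : G.Line} {c : Fin 4} :
    c ∈ G.joined π e ↔ π c (G.whiteEnd e) = G.blackEnd e := by simp [joined]

lemma joined_contractSet_insert (S : Finset G.Line) (l e : G.Line) :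
    G.joined (G.contractSet S) e ⊆ G.joined (G.contractSet (insert l S)) e := by
  intro c hc
  rw [mem_joined] at hc ⊢
  rcases eq_or_ne e l with rfl | h
  · exact G.contractSet_whiteEnd (Finset.mem_insert_self _ _) c
  · rw [contractSet_insert, contractLine_apply, Equiv.swap_apply_of_ne_of_ne]
    · exact hc
    · exact (G.contractSet S c).injective.ne (G.whiteEnd.injective.ne h)
    · rw [hc]; exact G.blackEnd.injective.ne h

lemma joined_mono {S S' : Finset G.Line} (h : S ⊆ S') (e : G.Line) :
    G.joined (G.contractSet S) e ⊆ G.joined (G.contractSet S') e := by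
  have key : ∀ U : Finset G.Line,
      G.joined (G.contractSet S) e ⊆ G.joined (G.contractSet (U ∪ S)) e := by
    intro U
    induction U using Finset.induction_on with
    | empty => simp
    | insert a U _ ih =>
      rw [Finset.insert_union]
      exact ih.trans (G.joined_contractSet_insert _ _ _)
  simpa [Finset.union_eq_left.2 h] using key S'

/-- A set of lines is *melonic* if it can be contracted line by line in such a way that the ends of
each line are joined by at least three colored lines when its turn comes. -/
inductive Melonic : Finset G.Line → Prop
  | empty : Melonic ∅
  | cons (S : Finset G.Line) (e : G.Line) (hS : Melonic S) (he : e ∉ S)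
      (h : 3 ≤ (G.joined (G.contractSet S) e).card) : Melonic (insert e S)

variable {G}

lemma Melonic.union {S S' : Finset G.Line} (hS : G.Melonic S) (hS' : G.Melonic S') :
    G.Melonic (S ∪ S') := by
  induction hS' with
  | empty => simpa
  | cons U e _ _ h ih =>
    rw [Finset.union_insert]
    by_cases hm : e ∈ S ∪ U
    · rwa [Finset.insert_eq_of_mem hm]
    · exact .cons _ _ ih hm
        (h.trans (Finset.card_le_card (G.joined_mono Finset.subset_union_right e)))

/-- A non-empty set of lines whose ends form a union of components of the original colored graph
exhausts a connected graph. -/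
lemma false_of_closed (hG : G.IsConnected) (hV : ¬ G.IsVacuum) {Y : Finset G.Line}
    (hY : Y.Nonempty)
    (h : ∀ c, ∀ e ∈ Y, ∃ e' ∈ Y, G.coloredLine c (G.whiteEnd e) = G.blackEnd e') : False := by
  -- by counting, the condition holds for the black ends as well
  have hsurj : ∀ c, ∀ e' ∈ Y, ∃ e ∈ Y, G.coloredLine c (G.whiteEnd e) = G.blackEnd e' := by
    intro c
    choose! f hf1 hf2 using h c
    intro e' he'
    have hinj : Set.InjOn f Y := by
      intro a ha b hb hab
      have := (hf2 a ha).trans ((congrArg _ hab).trans (hf2 b hb).symm)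
      exact G.whiteEnd.injective ((G.coloredLine c).injective this)
    obtain ⟨e, he, hfe⟩ := Finset.surjOn_of_injOn_of_card_le f (fun a ha => hf1 a ha) hinj le_rfl he'
    exact ⟨e, he, by rw [hf2 e he, hfe]⟩
  -- the ends of the lines of `Y` form a union of components of the colored extension
  let Z : Set (G.White ⊕ G.Black) :=
    {x | (∃ e ∈ Y, x = Sum.inl (G.whiteEnd e)) ∨ ∃ e ∈ Y, x = Sum.inr (G.blackEnd e)}
  have hadj : ∀ x y, G.coloredExtension.Adj x y → x ∈ Z → y ∈ Z := by
    intro x y hxy hx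
    simp only [coloredExtension, bubbleGraph, SimpleGraph.sup_adj, SimpleGraph.fromRel_adj] at hxy
    rcases hx with ⟨e, he, rfl⟩ | ⟨e, he, rfl⟩
    · rcases hxy with ⟨-, ⟨c, w, h1, h2⟩ | ⟨c, w, h1, h2⟩⟩ | ⟨-, ⟨e', h1, h2⟩ | ⟨e', h1, h2⟩⟩
      · obtain ⟨e', he', h3⟩ := h c e he
        rw [← Sum.inl_injective h1, h3] at h2
        exact Or.inr ⟨e', he', h2⟩
      · simp at h2
      · rw [← G.whiteEnd.injective (Sum.inl_injective h1)] at h2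
        exact Or.inr ⟨e, he, h2⟩
      · simp at h2
    · rcases hxy with ⟨-, ⟨c, w, h1, h2⟩ | ⟨c, w, h1, h2⟩⟩ | ⟨-, ⟨e', h1, h2⟩ | ⟨e', h1, h2⟩⟩
      · simp at h1
      · obtain ⟨e', he', h3⟩ := hsurj c e he
        have h4 : w = G.whiteEnd e' :=
          (G.coloredLine c).injective ((Sum.inr_injective h2).symm.trans h3.symm)
        exact Or.inl ⟨e', he', by rw [h1, h4]⟩
      · simp at h1
      · rw [← G.blackEnd.injective (Sum.inr_injective h2)] at h1
        exact Or.inl ⟨e, he, h1⟩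
  have hall : ∀ x y, G.coloredExtension.Reachable x y → x ∈ Z → y ∈ Z := by
    rintro x y ⟨p⟩
    induction p with
    | nil => exact id
    | cons h _ ih => exact fun hx => ih (hadj _ _ h hx)
  obtain ⟨e, he⟩ := hY
  have hZ : ∀ y, y ∈ Z := fun y => hall _ y (hG.preconnected (Sum.inl (G.whiteEnd e)) y)
    (Or.inl ⟨e, he, rfl⟩)
  rw [IsVacuum, not_isEmpty_iff] at hV
  obtain ⟨w, hw⟩ | ⟨b, hb⟩ := hV
  · rcases hZ (Sum.inl w) with ⟨e, -, h1⟩ | ⟨e, -, h1⟩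
    · exact hw e (Sum.inl_injective h1).symm
    · simp at h1
  · rcases hZ (Sum.inr b) with ⟨e, -, h1⟩ | ⟨e, -, h1⟩
    · simp at h1
    · exact hb e (Sum.inr_injective h1).symm

/-- In a connected graph with external legs, contraction of a melonic set never isolates a
non-empty set of lines: such a set could be pulled back, line by line, to the original graph. -/
lemma Melonic.not_closed (hG : G.IsConnected) (hV : ¬ G.IsVacuum) {S : Finset G.Line}
    (hS : G.Melonic S) {Y : Finset G.Line} (hY : Y.Nonempty) (hd : Disjoint S Y)
    (h : ∀ c, ∀ e ∈ Y, ∃ e' ∈ Y, G.contractSet S c (G.whiteEnd e) = G.blackEnd e') : False := by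
  induction hS generalizing Y with
  | empty => exact false_of_closed hG hV hY (by simpa [contractSet_empty] using h)
  | cons S l hS hl hj ih =>
    have hlY : l ∉ Y := fun hm => Finset.disjoint_left.1 hd (Finset.mem_insert_self _ _) hm
    have hdS : Disjoint S Y := Finset.disjoint_of_subset_left (Finset.subset_insert _ _) hd
    rw [contractSet_insert] at h
    -- undo the contraction of `l`: the colored lines at `Y` change only if one of them passed
    -- through `l`, and then all the other colors of `l` are joined, so that `l` can be added to `Y`
    by_cases hx : ∃ c, ∃ e ∈ Y, G.contractSet S c (G.whiteEnd e) = G.blackEnd l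
    · refine ih (Y := insert l Y) (Finset.insert_nonempty _ _)
        (Finset.disjoint_insert_right.2 ⟨hl, hdS⟩) ?_
      obtain ⟨c₀, x, hxY, hx⟩ := hx
      have hxl : G.whiteEnd x ≠ G.whiteEnd l :=
        G.whiteEnd.injective.ne (fun h => hlY (h ▸ hxY))
      have hnj : c₀ ∉ G.joined (G.contractSet S) l := by
        rw [mem_joined, ← hx, (G.contractSet S c₀).injective.eq_iff]
        exact hxl.symm
      have hjc : ∀ c, c ≠ c₀ → G.contractSet S c (G.whiteEnd l) = G.blackEnd l := by
        intro c hc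
        by_contra hcj
        have hsub : G.joined (G.contractSet S) l ⊆ (Finset.univ.erase c₀).erase c := by
          intro d hd
          simp only [Finset.mem_erase, Finset.mem_univ, and_true]
          exact ⟨fun h => hcj (mem_joined G |>.1 (h ▸ hd)), fun h => hnj (h ▸ hd)⟩
        have := Finset.card_le_card hsub
        rw [Finset.card_erase_of_mem (by simp [hc]), Finset.card_erase_of_mem (by simp)] at this
        simp at this
        omega
      intro c e he
      rcases Finset.mem_insert.1 he with rfl | heY
      · by_cases hc : c = c₀
        · subst hc
          obtain ⟨e', he', h1⟩ := h c x hxY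
          rw [contractLine_apply, hx, Equiv.swap_apply_right] at h1
          exact ⟨e', Finset.mem_insert_of_mem he', h1⟩
        · exact ⟨e, Finset.mem_insert_self _ _, hjc c hc⟩
      · obtain ⟨e', he', h1⟩ := h c e heY
        by_cases hb : G.contractSet S c (G.whiteEnd e) = G.blackEnd l
        · exact ⟨l, Finset.mem_insert_self _ _, hb⟩
        · refine ⟨e', Finset.mem_insert_of_mem he', ?_⟩
          rwa [contractLine_apply, Equiv.swap_apply_of_ne_of_ne _ hb] at h1
          refine (G.contractSet S c).injective.ne (G.whiteEnd.injective.ne ?_)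
          rintro rfl
          exact hlY heY
    · push Not at hx
      refine ih hY hdS ?_
      intro c e he
      obtain ⟨e', he', h1⟩ := h c e he
      refine ⟨e', he', ?_⟩
      rwa [contractLine_apply, Equiv.swap_apply_of_ne_of_ne _ (hx c e he)] at h1
      refine (G.contractSet S c).injective.ne (G.whiteEnd.injective.ne ?_)
      rintro rfl
      exact hlY he

/-- The ends of a line outside a melonic set are joined by at most three colored lines. -/
lemma Melonic.card_joined_le (hG : G.IsConnected) (hV : ¬ G.IsVacuum) {S : Finset G.Line}
    (hS : G.Melonic S) {e : G.Line} (he : e ∉ S) :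
    (G.joined (G.contractSet S) e).card ≤ 3 := by
  by_contra hc
  have h4 : G.joined (G.contractSet S) e = Finset.univ := by
    apply Finset.eq_univ_of_card
    have := Finset.card_le_univ (G.joined (G.contractSet S) e)
    simp at this ⊢
    omega
  refine hS.not_closed hG hV (Finset.singleton_nonempty e) (by simpa using he) ?_
  intro c e' he'
  rw [Finset.mem_singleton] at he'
  subst he'
  exact ⟨e', by simp, (G.mem_joined).1 (h4 ▸ Finset.mem_univ c)⟩

variable (G) in
open Classical in
/-- The largest melonic set of lines: the union of all melopoles. -/
noncomputable def melonicLines : Finset G.Line :=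
  (Finset.univ.filter G.Melonic).sup id

lemma melonic_melonicLines : G.Melonic G.melonicLines := by
  classical
  have : ∀ A : Finset (Finset G.Line), (∀ S ∈ A, G.Melonic S) → G.Melonic (A.sup id) := by
    intro A
    induction A using Finset.induction_on with
    | empty => intro _; exact .empty
    | insert S A _ ih =>
      intro h
      rw [Finset.sup_insert]
      exact (h S (Finset.mem_insert_self _ _)).union
        (ih fun S' hS' => h S' (Finset.mem_insert_of_mem hS'))
  exact this _ (by simp)

lemma Melonic.subset_melonicLines {S : Finset G.Line} (hS : G.Melonic S) :
    S ⊆ G.melonicLines := by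
  classical
  have : S ≤ (Finset.univ.filter G.Melonic).sup id :=
    Finset.le_sup (f := id) (by simpa using hS)
  exact this

lemma card_joined_melonicLines_lt {e : G.Line} (he : e ∉ G.melonicLines) :
    (G.joined (G.contractSet G.melonicLines) e).card < 3 := by
  by_contra h
  push Not at h
  exact he ((Melonic.cons _ e melonic_melonicLines he h).subset_melonicLines
    (Finset.mem_insert_self _ _))

/-- Every line of a melonic set can be contracted after a melonic part of the rest of the set. -/
lemma Melonic.exists_of_mem {S : Finset G.Line} (hS : G.Melonic S) {e : G.Line} (he : e ∈ S) :
    ∃ S' ⊆ S, G.Melonic S' ∧ e ∉ S' ∧ 3 ≤ (G.joined (G.contractSet S') e).card := by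
  induction hS with
  | empty => simp at he
  | cons S l hS hl hj ih =>
    rcases Finset.mem_insert.1 he with rfl | he
    · exact ⟨S, Finset.subset_insert _ _, hS, hl, hj⟩
    · obtain ⟨S', h1, h2⟩ := ih he
      exact ⟨S', h1.trans (Finset.subset_insert _ _), h2⟩

lemma Melonic.exists_list (hG : G.IsConnected) (hV : ¬ G.IsVacuum) {S : Finset G.Line}
    (hS : G.Melonic S) : ∃ l : List G.Line, l.Nodup ∧ l.toFinset = S ∧
      ∀ (i : ℕ) (hi : i < l.length), G.IsFourDipole (G.contractLines (l.take i)) l[i] := by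
  induction hS with
  | empty => exact ⟨[], by simp⟩
  | cons S e hS he hj ih =>
    obtain ⟨l, hl, rfl, h⟩ := ih
    refine ⟨l ++ [e], ?_, ?_, ?_⟩
    · rw [List.nodup_append]
      refine ⟨hl, by simp, ?_⟩
      rintro a ha b hb rfl
      simp only [List.mem_singleton] at hb
      subst hb
      exact he (by simpa using ha)
    · ext x; simp
    · intro i hi
      rw [List.length_append, List.length_singleton] at hi
      rcases Nat.lt_or_ge i l.length with h1 | h1
      · rw [List.take_append_of_le_length h1.le, List.getElem_append_left h1]
        exact h i h1
      · obtain rfl : i = l.length := by omega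
        rw [List.take_left' rfl]
        simp only [List.getElem_concat_length]
        rw [G.contractLines_eq_contractSet hl]
        exact le_antisymm (hS.card_joined_le hG hV he) hj

lemma melonic_of_list {l : List G.Line} (hl : l.Nodup)
    (h : ∀ (i : ℕ) (hi : i < l.length), G.IsFourDipole (G.contractLines (l.take i)) l[i]) :
    G.Melonic l.toFinset := by
  induction l using List.reverseRecOn with
  | nil => exact .empty
  | append_singleton l e ih =>
    rw [List.nodup_append] at hl
    have hm : G.Melonic l.toFinset := ih hl.1 (by
      intro i hi
      have := h i (by simp; omega)
      rwa [List.take_append_of_le_length hi.le, List.getElem_append_left hi] at this)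
    have he : e ∉ l.toFinset := fun hmem =>
      hl.2.2 e (by simpa using hmem) e (by simp) rfl
    have hd := h l.length (by simp)
    rw [List.take_left' rfl] at hd
    simp only [List.getElem_concat_length] at hd
    rw [G.contractLines_eq_contractSet hl.1] at hd
    have : (l ++ [e]).toFinset = insert e l.toFinset := by ext x; simp
    rw [this]
    exact .cons _ _ hm he (ge_of_eq hd)

end FeynmanGraph

/-! ### Faces as cycles of permutations -/

/-- Removing the point `a` from its cycle does not change the cycles of the other points. -/
lemma sameCycle_swap_mul {α : Type*} [Finite α] [DecidableEq α] (σ : Equiv.Perm α) (a : α)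
    {x y : α} (hx : x ≠ a) (hy : y ≠ a) :
    (Equiv.swap (σ a) a * σ).SameCycle x y ↔ σ.SameCycle x y := by
  set τ := Equiv.swap (σ a) a * σ with hτ
  have hap : ∀ z, τ z = Equiv.swap (σ a) a (σ z) := fun z => rfl
  constructor
  · intro h
    obtain ⟨n, -, -, rfl⟩ := h.exists_pow_eq''
    clear hy h
    have step : ∀ z, σ.SameCycle z (τ z) := by
      intro z
      rw [hap, Equiv.swap_apply_def]
      split_ifs with h1 h2
      · rw [σ.injective h1]
      · refine ⟨2, ?_⟩
        rw [← h2]; rfl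
      · exact ⟨1, rfl⟩
    clear hx
    induction n with
    | zero => exact .refl _ _
    | succ n ih =>
      rw [pow_succ']
      exact ih.trans (step _)
  · intro h
    obtain ⟨n, -, -, hn⟩ := h.exists_pow_eq''
    clear h
    induction n using Nat.strong_induction_on generalizing x with
    | _ n ih =>
      match n, hn with
      | 0, hn => rw [← hn]; exact .refl _ _
      | n + 1, hn =>
        rw [pow_succ, Equiv.Perm.mul_apply] at hn
        by_cases h1 : σ x = a
        · match n, hn with
          | 0, hn => exact absurd (hn.symm.trans h1) hy
          | k + 1, hn =>
            rw [pow_succ, Equiv.Perm.mul_apply, h1] at hn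
            have h2 : σ a ≠ a := fun h => hx (σ.injective (h1.trans h.symm))
            have h3 : τ x = σ a := by rw [hap, h1, Equiv.swap_apply_right]
            exact (Equiv.Perm.sameCycle_apply_left.1 (h3 ▸ ih k (by omega) h2 hn))
        · have h3 : τ x = σ x := by
            rw [hap, Equiv.swap_apply_of_ne_of_ne (σ.injective.ne hx) h1]
          exact Equiv.Perm.sameCycle_apply_left.1 (h3 ▸ ih n (by omega) h1 hn)

namespace FeynmanGraph

variable (G : FeynmanGraph)

/-- The face permutation of color `c` after contraction of `S`, acting on the white nodes: follow
the colored line of color `c` from the white node to a black node, and then the line carried by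
that black node to its white end. A black node without a line is sent to the white external leg
at the other end of the same open face, so that the cycles are exactly the faces, open or closed. -/
noncomputable def facePerm (S : Finset G.Line) (c : Fin 4) : Equiv.Perm G.White :=
  (G.contractSet S c).trans (G.contractSet Finset.univ c).symm

lemma facePerm_eq_whiteEnd_iff {S : Finset G.Line} {c : Fin 4} {w : G.White} {e : G.Line} :
    G.facePerm S c w = G.whiteEnd e ↔ G.contractSet S c w = G.blackEnd e := by
  rw [facePerm, Equiv.trans_apply, Equiv.symm_apply_eq,
    G.contractSet_whiteEnd (Finset.mem_univ e)]

lemma facePerm_insert (S : Finset G.Line) (l : G.Line) (c : Fin 4) :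
    G.facePerm (insert l S) c =
      Equiv.swap (G.facePerm S c (G.whiteEnd l)) (G.whiteEnd l) * G.facePerm S c := by
  apply Equiv.ext
  intro w
  simp only [facePerm, contractSet_insert, Equiv.trans_apply, contractLine_apply,
    Equiv.Perm.mul_apply]
  have h : G.whiteEnd l = (G.contractSet Finset.univ c).symm (G.blackEnd l) := by
    rw [Equiv.eq_symm_apply, G.contractSet_whiteEnd (Finset.mem_univ l)]
  conv_rhs => rw [h]
  rw [Function.Injective.swap_apply (G.contractSet Finset.univ c).symm.injective, ← h]

lemma facePerm_whiteEnd {S : Finset G.Line} {e : G.Line} (he : e ∈ S) (c : Fin 4) :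
    G.facePerm S c (G.whiteEnd e) = G.whiteEnd e :=
  G.facePerm_eq_whiteEnd_iff.2 (G.contractSet_whiteEnd he c)

lemma sameCycle_facePerm (S : Finset G.Line) (c : Fin 4) {w w' : G.White}
    (hw : ∀ e ∈ S, w ≠ G.whiteEnd e) (hw' : ∀ e ∈ S, w' ≠ G.whiteEnd e) :
    (G.facePerm S c).SameCycle w w' ↔ (G.facePerm ∅ c).SameCycle w w' := by
  induction S using Finset.induction_on with
  | empty => rfl
  | insert l S _ ih =>
    rw [facePerm_insert, sameCycle_swap_mul _ _ (hw l (Finset.mem_insert_self _ _))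
      (hw' l (Finset.mem_insert_self _ _))]
    exact ih (fun e he => hw e (Finset.mem_insert_of_mem he))
      fun e he => hw' e (Finset.mem_insert_of_mem he)

/-- The face of color `c` through `w` is closed and passes only through lines of `S`. -/
def FaceIn (c : Fin 4) (S : Finset G.Line) (w : G.White) : Prop :=
  ∀ w', (G.facePerm ∅ c).SameCycle w w' → ∃ e ∈ S, w' = G.whiteEnd e

variable {G}

lemma FaceIn.mono {c : Fin 4} {S S' : Finset G.Line} {w : G.White} (h : G.FaceIn c S w)
    (hS : S ⊆ S') : G.FaceIn c S' w := fun w' hw' =>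
  let ⟨e, he, h1⟩ := h w' hw'
  ⟨e, hS he, h1⟩

lemma FaceIn.of_sameCycle {c : Fin 4} {S : Finset G.Line} {w w' : G.White}
    (h : G.FaceIn c S w) (hw : (G.facePerm ∅ c).SameCycle w w') : G.FaceIn c S w' :=
  fun w'' hw'' => h w'' (hw.trans hw'')

lemma FaceIn.mem {c : Fin 4} {S : Finset G.Line} {e : G.Line} {w : G.White}
    (h : G.FaceIn c S w) (hw : (G.facePerm ∅ c).SameCycle w (G.whiteEnd e)) : e ∈ S := by
  obtain ⟨e', he', h1⟩ := h _ hw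
  rwa [G.whiteEnd.injective h1]

/-- A line outside `S` has its ends joined in color `c` after contraction of `S` exactly when its
face of color `c` is closed and passes through no other line outside `S`. -/
lemma mem_joined_iff_faceIn {S : Finset G.Line} {e : G.Line} (he : e ∉ S) {c : Fin 4} :
    c ∈ G.joined (G.contractSet S) e ↔ G.FaceIn c (insert e S) (G.whiteEnd e) := by
  rw [mem_joined, ← facePerm_eq_whiteEnd_iff]
  have hne : ∀ e' ∈ S, G.whiteEnd e ≠ G.whiteEnd e' := by
    intro e' he' h
    exact he (G.whiteEnd.injective h ▸ he')
  constructor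
  · intro h w hw
    by_cases hwS : ∃ e' ∈ S, w = G.whiteEnd e'
    · obtain ⟨e', he', rfl⟩ := hwS
      exact ⟨e', Finset.mem_insert_of_mem he', rfl⟩
    · push Not at hwS
      rw [← G.sameCycle_facePerm S c hne hwS] at hw
      exact ⟨e, Finset.mem_insert_self _ _, (hw.eq_of_left h).symm⟩
  · intro h
    have h1 : ∀ e' ∈ S, G.facePerm S c (G.whiteEnd e) ≠ G.whiteEnd e' := by
      intro e' he' h2
      rw [← G.facePerm_whiteEnd he' c, (G.facePerm S c).injective.eq_iff] at h2
      exact hne e' he' h2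
    have h2 : (G.facePerm S c).SameCycle (G.whiteEnd e) (G.facePerm S c (G.whiteEnd e)) := ⟨1, rfl⟩
    rw [G.sameCycle_facePerm S c hne h1] at h2
    obtain ⟨e', he', h3⟩ := h _ h2
    rcases Finset.mem_insert.1 he' with rfl | he'
    · exact h3
    · exact absurd h3 (h1 e' he')

lemma faceStep_iff {c : Fin 4} {a b : G.Line} :
    G.FaceStep c a b ↔ G.facePerm ∅ c (G.whiteEnd b) = G.whiteEnd a := by
  rw [facePerm_eq_whiteEnd_iff, contractSet_empty, FaceStep]

/-- Two lines share an internal face if they lie on the same cycle of a face permutation and all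
nodes of the cycle carry lines of `H`. (`FaceStep` follows the faces in the direction opposite to
`facePerm`.) -/
lemma shareInternalFace_iff {H : Finset G.Line} {e e' : G.Line} :
    G.ShareInternalFace H e e' ↔
      ∃ c, (G.facePerm ∅ c).SameCycle (G.whiteEnd e) (G.whiteEnd e') ∧
        G.FaceIn c H (G.whiteEnd e) := by
  have step : ∀ {c a b}, Relation.TransGen (fun a b => a ∈ H ∧ b ∈ H ∧ G.FaceStep c a b) a b →
      (G.facePerm ∅ c).SameCycle (G.whiteEnd a) (G.whiteEnd b) := by
    intro c a b h
    induction h with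
    | single h =>
      exact Equiv.Perm.SameCycle.symm ⟨1, faceStep_iff.1 h.2.2⟩
    | tail _ h ih =>
      exact ih.trans (Equiv.Perm.SameCycle.symm ⟨1, faceStep_iff.1 h.2.2⟩)
  constructor
  · rintro ⟨c, h1, h2⟩
    refine ⟨c, step h1, ?_⟩
    set R := fun a b => a ∈ H ∧ b ∈ H ∧ G.FaceStep c a b
    have key : ∀ n : ℕ, ∃ a ∈ H, ((G.facePerm ∅ c)⁻¹ ^ n) (G.whiteEnd e) = G.whiteEnd a ∧
        Relation.TransGen R e a ∧ Relation.TransGen R a e := by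
      intro n
      induction n with
      | zero =>
        obtain ⟨b, hb, -⟩ := Relation.TransGen.head'_iff.1 h1
        exact ⟨e, hb.1, rfl, h1.trans h2, h1.trans h2⟩
      | succ n ih =>
        obtain ⟨a, -, h3, h4, h5⟩ := ih
        obtain ⟨b, hb, hbe⟩ := Relation.TransGen.head'_iff.1 h5
        refine ⟨b, hb.2.1, ?_, h4.tail hb, ?_⟩
        · rw [pow_succ', Equiv.Perm.mul_apply, h3, Equiv.Perm.inv_eq_iff_eq]
          exact (faceStep_iff.1 hb.2.2).symm
        · rcases Relation.reflTransGen_iff_eq_or_transGen.1 hbe with h | h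
          · rw [← h]; exact h1.trans h2
          · exact h
    intro w hw
    obtain ⟨n, -, -, hn⟩ := (Equiv.Perm.sameCycle_inv.2 hw).exists_pow_eq''
    obtain ⟨a, ha, h3, -⟩ := key n
    exact ⟨a, ha, by rw [← hn, h3]⟩
  · rintro ⟨c, h1, h2⟩
    have key : ∀ n : ℕ, ∀ a b, G.FaceIn c H (G.whiteEnd a) →
        ((G.facePerm ∅ c)⁻¹ ^ (n + 1)) (G.whiteEnd a) = G.whiteEnd b →
        Relation.TransGen (fun a b => a ∈ H ∧ b ∈ H ∧ G.FaceStep c a b) a b := by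
      intro n
      induction n with
      | zero =>
        intro a b ha hab
        rw [zero_add, pow_one, Equiv.Perm.inv_eq_iff_eq] at hab
        refine .single ⟨ha.mem (.refl _ _), ha.mem (.symm ⟨1, hab.symm⟩), ?_⟩
        exact faceStep_iff.2 hab.symm
      | succ n ih =>
        intro a b ha hab
        have hs : (G.facePerm ∅ c).SameCycle (G.whiteEnd a)
            ((G.facePerm ∅ c)⁻¹ (G.whiteEnd a)) := ⟨-1, by simp⟩
        obtain ⟨a', ha', h3⟩ := ha _ hs
        rw [pow_succ, Equiv.Perm.mul_apply, h3] at hab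
        refine .head ⟨ha.mem (.refl _ _), ha', ?_⟩ (ih a' b (ha.of_sameCycle (h3 ▸ hs)) hab)
        exact faceStep_iff.2 (by rw [← h3]; exact (G.facePerm ∅ c).apply_symm_apply _)
    have key' : ∀ a b, G.FaceIn c H (G.whiteEnd a) →
        (G.facePerm ∅ c).SameCycle (G.whiteEnd a) (G.whiteEnd b) →
        Relation.TransGen (fun a b => a ∈ H ∧ b ∈ H ∧ G.FaceStep c a b) a b := by
      intro a b ha hab
      obtain ⟨n, hn, -, h3⟩ := (Equiv.Perm.sameCycle_inv.2 hab).exists_pow_eq''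
      obtain ⟨k, rfl⟩ : ∃ k, n = k + 1 := ⟨n - 1, by omega⟩
      exact key k a b ha h3
    exact ⟨c, key' e e' h2 h1, key' e' e (h2.of_sameCycle h1) h1.symm⟩

/-! ### The structure of melopoles -/

open Classical in
variable (G) in
/-- The color of the only face that runs through a melonic line `e` and remains open when `e` is
contracted. -/
noncomputable def freeColor (e : G.Line) : Fin 4 :=
  if h : ∃ c₀, ∀ S, G.Melonic S → e ∉ S → 3 ≤ (G.joined (G.contractSet S) e).card →
    ∀ c, c ∈ G.joined (G.contractSet S) e ↔ c ≠ c₀ then h.choose else 0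

/-- The free color of a line does not depend on the way in which the line is contracted: otherwise
its ends would be joined in all four colors after contraction of a larger melonic set. -/
lemma Melonic.mem_joined_iff (hG : G.IsConnected) (hV : ¬ G.IsVacuum) {S : Finset G.Line}
    {e : G.Line} (hS : G.Melonic S) (he : e ∉ S) (h : 3 ≤ (G.joined (G.contractSet S) e).card)
    (c : Fin 4) : c ∈ G.joined (G.contractSet S) e ↔ c ≠ G.freeColor e := by
  have hex : ∃ c₀, ∀ S, G.Melonic S → e ∉ S → 3 ≤ (G.joined (G.contractSet S) e).card →
      ∀ c, c ∈ G.joined (G.contractSet S) e ↔ c ≠ c₀ := by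
    have h3 : ∀ S, G.Melonic S → e ∉ S → 3 ≤ (G.joined (G.contractSet S) e).card →
        (G.joined (G.contractSet S) e).card = 3 := fun S hS he h =>
      le_antisymm (hS.card_joined_le hG hV he) h
    have h1 : (G.joined (G.contractSet S) e)ᶜ.card = 1 := by
      rw [Finset.card_compl, h3 S hS he h]; simp
    obtain ⟨c₀, hc₀⟩ := Finset.card_eq_one.1 h1
    refine ⟨c₀, fun S' hS' he' h' c => ?_⟩
    have heU : e ∉ S ∪ S' := by simp [he, he']
    have hU := (hS.union hS').card_joined_le hG hV heU
    -- as at most three colors are joined after contraction of the union, it joins no new colors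
    have e1 : G.joined (G.contractSet S) e = G.joined (G.contractSet (S ∪ S')) e :=
      Finset.eq_of_subset_of_card_le (G.joined_mono Finset.subset_union_left e) (hU.trans h)
    have e2 : G.joined (G.contractSet S') e = G.joined (G.contractSet (S ∪ S')) e :=
      Finset.eq_of_subset_of_card_le (G.joined_mono Finset.subset_union_right e) (hU.trans h')
    rw [e2, ← e1, ← not_iff_not, ← Finset.mem_compl, hc₀]
    simp
  have hd : G.freeColor e = hex.choose := dif_pos hex
  rw [hd]
  exact hex.choose_spec S hS he h c

lemma Melonic.faceIn (hG : G.IsConnected) (hV : ¬ G.IsVacuum) {S : Finset G.Line}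
    {e : G.Line} (hS : G.Melonic S) (he : e ∉ S) (h : 3 ≤ (G.joined (G.contractSet S) e).card)
    {c : Fin 4} (hc : c ≠ G.freeColor e) : G.FaceIn c (insert e S) (G.whiteEnd e) :=
  (mem_joined_iff_faceIn he).1 ((hS.mem_joined_iff hG hV he h c).2 hc)

variable (G) in
/-- `e'` is a child of `e`: another line on one of the three faces that are closed by the
contraction of `e`. -/
def IsChild (e' e : G.Line) : Prop :=
  e' ≠ e ∧ ∃ c, c ≠ G.freeColor e ∧ (G.facePerm ∅ c).SameCycle (G.whiteEnd e) (G.whiteEnd e')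

variable (G) in
/-- The least number of lines that have to be contracted before `e`. -/
noncomputable def rank (e : G.Line) : ℕ :=
  sInf {n | ∃ S, G.Melonic S ∧ e ∉ S ∧ 3 ≤ (G.joined (G.contractSet S) e).card ∧ S.card = n}

lemma rank_le {S : Finset G.Line} {e : G.Line} (hS : G.Melonic S) (he : e ∉ S)
    (h : 3 ≤ (G.joined (G.contractSet S) e).card) : G.rank e ≤ S.card :=
  Nat.sInf_le ⟨S, hS, he, h, rfl⟩

lemma exists_card_eq_rank {e : G.Line} (he : e ∈ G.melonicLines) :
    ∃ S, G.Melonic S ∧ e ∉ S ∧ 3 ≤ (G.joined (G.contractSet S) e).card ∧ S.card = G.rank e := by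
  obtain ⟨S, -, h1, h2, h3⟩ := melonic_melonicLines.exists_of_mem he
  exact Nat.sInf_mem (s := {n | ∃ S, G.Melonic S ∧ e ∉ S ∧
    3 ≤ (G.joined (G.contractSet S) e).card ∧ S.card = n}) ⟨_, S, h1, h2, h3, rfl⟩

/-- Melonic sets contain the children of their lines. -/
lemma Melonic.mem_of_isChild (hG : G.IsConnected) (hV : ¬ G.IsVacuum) {S : Finset G.Line}
    (hS : G.Melonic S) {e e' : G.Line} (he : e ∈ S) (h : G.IsChild e' e) : e' ∈ S := by
  obtain ⟨S', h1, h2, h3, h4⟩ := hS.exists_of_mem he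
  obtain ⟨hne, c, hc, hs⟩ := h
  exact h1 ((Finset.mem_insert.1 ((h2.faceIn hG hV h3 h4 hc).mem hs)).resolve_left hne)

lemma IsChild.mem_melonicLines (hG : G.IsConnected) (hV : ¬ G.IsVacuum) {e e' : G.Line}
    (h : G.IsChild e' e) (he : e ∈ G.melonicLines) : e' ∈ G.melonicLines :=
  melonic_melonicLines.mem_of_isChild hG hV he h

lemma IsChild.rank_lt (hG : G.IsConnected) (hV : ¬ G.IsVacuum) {e e' : G.Line}
    (h : G.IsChild e' e) (he : e ∈ G.melonicLines) : G.rank e' < G.rank e := by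
  obtain ⟨S, h1, h2, h3, h4⟩ := exists_card_eq_rank he
  obtain ⟨hne, c, hc, hs⟩ := h
  have he' : e' ∈ S :=
    (Finset.mem_insert.1 ((h1.faceIn hG hV h2 h3 hc).mem hs)).resolve_left hne
  obtain ⟨S', g1, g2, g3, g4⟩ := h1.exists_of_mem he'
  rw [← h4]
  exact (rank_le g2 g3 g4).trans_lt
    (Finset.card_lt_card ⟨g1, fun h => g3 (h he')⟩)

/-- A line is linked to its parent through its free color: otherwise each of the two lines would be
a child of the other. -/
lemma isChild_color (hG : G.IsConnected) (hV : ¬ G.IsVacuum) {e e' : G.Line}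
    (he : e ∈ G.melonicLines) {c : Fin 4} (hne : e' ≠ e) (hc : c ≠ G.freeColor e)
    (hs : (G.facePerm ∅ c).SameCycle (G.whiteEnd e) (G.whiteEnd e')) : c = G.freeColor e' := by
  by_contra hc'
  have h1 : G.IsChild e' e := ⟨hne, c, hc, hs⟩
  have h2 : G.IsChild e e' := ⟨hne.symm, c, hc', hs.symm⟩
  exact absurd ((h1.rank_lt hG hV he).trans (h2.rank_lt hG hV (h1.mem_melonicLines hG hV he)))
    (lt_irrefl _)

/-- A line has at most one parent: two parents would lie on the same face, and each of them would be
a child of the other. -/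
lemma IsChild.eq_of_isChild (hG : G.IsConnected) (hV : ¬ G.IsVacuum) {e e₁ e₂ : G.Line}
    (h₁ : G.IsChild e e₁) (h₂ : G.IsChild e e₂) (he₁ : e₁ ∈ G.melonicLines)
    (he₂ : e₂ ∈ G.melonicLines) : e₁ = e₂ := by
  by_contra hne
  obtain ⟨n1, c1, hc1, hs1⟩ := h₁
  obtain ⟨n2, c2, hc2, hs2⟩ := h₂
  have e1 := isChild_color hG hV he₁ n1 hc1 hs1
  have e2 := isChild_color hG hV he₂ n2 hc2 hs2
  obtain rfl : c1 = c2 := e1.trans e2.symm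
  have h12 : G.IsChild e₂ e₁ := ⟨Ne.symm hne, c1, hc1, hs1.trans hs2.symm⟩
  have h21 : G.IsChild e₁ e₂ := ⟨hne, c1, hc2, hs2.trans hs1.symm⟩
  exact absurd ((h12.rank_lt hG hV he₁).trans (h21.rank_lt hG hV he₂)) (lt_irrefl _)

/-- A closed face that passes only through melonic lines is closed by the contraction of one of
its lines. -/
lemma FaceIn.exists_closing (hG : G.IsConnected) (hV : ¬ G.IsVacuum) {S : Finset G.Line}
    (hS : G.Melonic S) {c : Fin 4} {w : G.White} (h : G.FaceIn c S w) :
    ∃ g ∈ S, c ≠ G.freeColor g ∧ (G.facePerm ∅ c).SameCycle w (G.whiteEnd g) := by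
  induction hS with
  | empty => obtain ⟨e, he, -⟩ := h w (.refl _ _); simp at he
  | cons S l hS hl hj ih =>
    by_cases hw : (G.facePerm ∅ c).SameCycle w (G.whiteEnd l)
    · refine ⟨l, Finset.mem_insert_self _ _, ?_, hw⟩
      rw [← hS.mem_joined_iff hG hV hl hj, mem_joined_iff_faceIn hl]
      exact h.of_sameCycle hw
    · have h' : G.FaceIn c S w := by
        intro w' hw'
        obtain ⟨e, he, rfl⟩ := h w' hw'
        rcases Finset.mem_insert.1 he with rfl | he
        · exact absurd hw' hw
        · exact ⟨e, he, rfl⟩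
      obtain ⟨g, hg, h1⟩ := ih h'
      exact ⟨g, Finset.mem_insert_of_mem hg, h1⟩

open Classical in
variable (G) in
/-- The melopole with root `r`: the melonic lines from which `r` is reached by passing from
children to parents. -/
noncomputable def melopole (r : G.Line) : Finset G.Line :=
  G.melonicLines.filter fun e => Relation.ReflTransGen G.IsChild e r

lemma mem_melopole {r e : G.Line} :
    e ∈ G.melopole r ↔ e ∈ G.melonicLines ∧ Relation.ReflTransGen G.IsChild e r := by
  simp [melopole]

lemma self_mem_melopole {r : G.Line} (hr : r ∈ G.melonicLines) : r ∈ G.melopole r :=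
  mem_melopole.2 ⟨hr, .refl⟩

lemma melopole_subset (r : G.Line) : G.melopole r ⊆ G.melonicLines := fun _ h =>
  (mem_melopole.1 h).1

lemma melopole_mono {r s : G.Line} (h : r ∈ G.melopole s) : G.melopole r ⊆ G.melopole s :=
  fun _ he => mem_melopole.2 ⟨(mem_melopole.1 he).1,
    (mem_melopole.1 he).2.trans (mem_melopole.1 h).2⟩

lemma mem_melopole_of_isChild (hG : G.IsConnected) (hV : ¬ G.IsVacuum) {r e e' : G.Line}
    (he : e ∈ G.melopole r) (h : G.IsChild e' e) : e' ∈ G.melopole r :=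
  mem_melopole.2 ⟨h.mem_melonicLines hG hV (mem_melopole.1 he).1, .head h (mem_melopole.1 he).2⟩

lemma mem_melonicLines_of_chain (hG : G.IsConnected) (hV : ¬ G.IsVacuum) {r e : G.Line}
    (hr : r ∈ G.melonicLines) (h : Relation.ReflTransGen G.IsChild e r) :
    e ∈ G.melonicLines := by
  induction h using Relation.ReflTransGen.head_induction_on with
  | refl => exact hr
  | head h _ ih => exact h.mem_melonicLines hG hV ih

/-- A line of a melopole other than its root has its parent in the melopole. -/
lemma parent_mem_melopole (hG : G.IsConnected) (hV : ¬ G.IsVacuum) {r e g : G.Line}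
    (hr : r ∈ G.melonicLines) (he : e ∈ G.melopole r) (hne : e ≠ r) (h : G.IsChild e g)
    (hg : g ∈ G.melonicLines) : g ∈ G.melopole r := by
  rcases Relation.reflTransGen_iff_eq_or_transGen.1 (mem_melopole.1 he).2 with h1 | h1
  · exact absurd h1.symm hne
  · obtain ⟨g', h2, h3⟩ := Relation.TransGen.head'_iff.1 h1
    have hg' := mem_melonicLines_of_chain hG hV hr h3
    rw [h.eq_of_isChild hG hV h2 hg hg']
    exact mem_melopole.2 ⟨hg', h3⟩

lemma rank_le_of_mem_melopole (hG : G.IsConnected) (hV : ¬ G.IsVacuum) {r e : G.Line}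
    (hr : r ∈ G.melonicLines) (he : e ∈ G.melopole r) : G.rank e ≤ G.rank r := by
  have h := (mem_melopole.1 he).2
  have : G.rank e ≤ G.rank r ∧ e ∈ G.melonicLines := by
    clear he
    induction h using Relation.ReflTransGen.head_induction_on with
    | refl => exact ⟨le_rfl, hr⟩
    | head h _ ih =>
      exact ⟨(h.rank_lt hG hV ih.2).le.trans ih.1, h.mem_melonicLines hG hV ih.2⟩
  exact this.1

lemma rank_lt_of_mem_melopole (hG : G.IsConnected) (hV : ¬ G.IsVacuum) {r e : G.Line}
    (hr : r ∈ G.melonicLines) (he : e ∈ G.melopole r) (hne : e ≠ r) : G.rank e < G.rank r := by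
  rcases Relation.reflTransGen_iff_eq_or_transGen.1 (mem_melopole.1 he).2 with h1 | h1
  · exact absurd h1.symm hne
  · obtain ⟨g, h2, h3⟩ := Relation.TransGen.head'_iff.1 h1
    have hg := mem_melonicLines_of_chain hG hV hr h3
    exact (h2.rank_lt hG hV hg).trans_le
      (rank_le_of_mem_melopole hG hV hr (mem_melopole.2 ⟨hg, h3⟩))

lemma melopole_injOn (hG : G.IsConnected) (hV : ¬ G.IsVacuum) :
    Set.InjOn G.melopole G.melonicLines := by
  intro r hr s hs h
  by_contra hne
  have h1 : r ∈ G.melopole s := h ▸ self_mem_melopole hr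
  have h2 : s ∈ G.melopole r := h ▸ self_mem_melopole hs
  exact absurd ((rank_lt_of_mem_melopole hG hV hs h1 hne).trans
    (rank_lt_of_mem_melopole hG hV hr h2 (Ne.symm hne))) (lt_irrefl _)

/-- Sets of melonic lines that contain the children of their lines are melonic. -/
lemma melonic_of_isChild_mem (hG : G.IsConnected) (hV : ¬ G.IsVacuum) (S : Finset G.Line)
    (hS : S ⊆ G.melonicLines) (h : ∀ e ∈ S, ∀ e', G.IsChild e' e → e' ∈ S) : G.Melonic S := by
  induction hn : S.card generalizing S with
  | zero => rw [Finset.card_eq_zero.1 hn]; exact .empty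
  | succ n ih =>
    have hne : S.Nonempty := by rw [← Finset.card_pos, hn]; omega
    -- a line of maximal rank is not a child of another line of `S`, so it can be contracted last
    obtain ⟨e, he, hmax⟩ := S.exists_max_image G.rank hne
    have hm : G.Melonic (S.erase e) := by
      refine ih _ ((Finset.erase_subset _ _).trans hS) ?_ (by rw [Finset.card_erase_of_mem he]; omega)
      intro a ha a' ha'
      have haS := Finset.mem_of_mem_erase ha
      refine Finset.mem_erase.2 ⟨?_, h a haS a' ha'⟩
      rintro rfl
      exact absurd (ha'.rank_lt hG hV (hS haS)) (not_lt.2 (hmax a haS))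
    rw [← Finset.insert_erase he]
    refine .cons _ _ hm (Finset.notMem_erase _ _) ?_
    have hsub : Finset.univ.erase (G.freeColor e) ⊆ G.joined (G.contractSet (S.erase e)) e := by
      intro c hc
      rw [mem_joined_iff_faceIn (Finset.notMem_erase _ _), Finset.insert_erase he]
      obtain ⟨S', -, g2, g3, g4⟩ := melonic_melonicLines.exists_of_mem (hS he)
      intro w hw
      obtain ⟨e', he', rfl⟩ := g2.faceIn hG hV g3 g4 (Finset.ne_of_mem_erase hc) w hw
      refine ⟨e', ?_, rfl⟩
      by_cases hee : e' = e
      · rwa [hee]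
      · exact h e he e' ⟨hee, c, Finset.ne_of_mem_erase hc, hw⟩
    have := Finset.card_le_card hsub
    rwa [Finset.card_erase_of_mem (Finset.mem_univ _), Finset.card_univ, Fintype.card_fin] at this

lemma melonic_melopole (hG : G.IsConnected) (hV : ¬ G.IsVacuum) (r : G.Line) :
    G.Melonic (G.melopole r) :=
  melonic_of_isChild_mem hG hV _ (melopole_subset r) fun _ he _ h =>
    mem_melopole_of_isChild hG hV he h

lemma faceIn_melopole_of_ne_freeColor (hG : G.IsConnected) (hV : ¬ G.IsVacuum) {r e : G.Line}
    (he : e ∈ G.melopole r) {c : Fin 4} (hc : c ≠ G.freeColor e) :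
    G.FaceIn c (G.melopole r) (G.whiteEnd e) := by
  obtain ⟨S', -, g2, g3, g4⟩ := melonic_melonicLines.exists_of_mem (mem_melopole.1 he).1
  intro w hw
  obtain ⟨e', he', rfl⟩ := g2.faceIn hG hV g3 g4 hc w hw
  refine ⟨e', ?_, rfl⟩
  by_cases hee : e' = e
  · rwa [hee]
  · exact mem_melopole_of_isChild hG hV he ⟨hee, c, hc, hw⟩

/-- All faces through a line of a melopole other than its root are internal. -/
lemma faceIn_melopole_of_ne_root (hG : G.IsConnected) (hV : ¬ G.IsVacuum) {r e : G.Line}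
    (hr : r ∈ G.melonicLines) (he : e ∈ G.melopole r) (hne : e ≠ r) (c : Fin 4) :
    G.FaceIn c (G.melopole r) (G.whiteEnd e) := by
  by_cases hc : c = G.freeColor e
  · rcases Relation.reflTransGen_iff_eq_or_transGen.1 (mem_melopole.1 he).2 with h1 | h1
    · exact absurd h1.symm hne
    · obtain ⟨g, h2, h3⟩ := Relation.TransGen.head'_iff.1 h1
      have hg := mem_melonicLines_of_chain hG hV hr h3
      obtain ⟨n1, c', hc', hs⟩ := h2
      have : c' = c := (isChild_color hG hV hg n1 hc' hs).trans hc.symm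
      subst this
      exact (faceIn_melopole_of_ne_freeColor hG hV (mem_melopole.2 ⟨hg, h3⟩) hc').of_sameCycle hs
  · exact faceIn_melopole_of_ne_freeColor hG hV he hc

/-- The face of free color through the root of a melopole is the external face of the melopole. -/
lemma not_faceIn_melopole_root (hG : G.IsConnected) (hV : ¬ G.IsVacuum) {r : G.Line}
    (hr : r ∈ G.melonicLines) :
    ¬ G.FaceIn (G.freeColor r) (G.melopole r) (G.whiteEnd r) := by
  intro h
  obtain ⟨g, hg, hc, hs⟩ := h.exists_closing hG hV (melonic_melopole hG hV r)
  have hne : r ≠ g := by rintro rfl; exact hc rfl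
  have h1 : G.IsChild r g := ⟨hne, _, hc, hs.symm⟩
  exact absurd (h1.rank_lt hG hV (mem_melopole.1 hg).1)
    (not_lt.2 (rank_le_of_mem_melopole hG hV hr hg))

/-! ### Classification of melopoles and meloforests -/

lemma bubbleGraph_reachable (c : Fin 4) (w : G.White) :
    G.bubbleGraph.Reachable (Sum.inl w) (Sum.inr (G.coloredLine c w)) := by
  apply SimpleGraph.Adj.reachable
  simp only [bubbleGraph, SimpleGraph.fromRel_adj]
  exact ⟨by simp, Or.inl ⟨c, w, rfl, rfl⟩⟩

/-- The contraction of a melonic set joins only nodes of the same bubble. -/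
lemma Melonic.reachable {S : Finset G.Line} (hS : G.Melonic S) :
    (∀ c w, G.bubbleGraph.Reachable (Sum.inl w) (Sum.inr (G.contractSet S c w))) ∧
      ∀ e ∈ S, G.bubbleGraph.Reachable (Sum.inl (G.whiteEnd e)) (Sum.inr (G.blackEnd e)) := by
  induction hS with
  | empty => exact ⟨by simpa [contractSet_empty] using bubbleGraph_reachable, by simp⟩
  | cons S l hS hl hj ih =>
    have hl' : G.bubbleGraph.Reachable (Sum.inl (G.whiteEnd l)) (Sum.inr (G.blackEnd l)) := by
      obtain ⟨c, hc⟩ := Finset.card_pos.1 (lt_of_lt_of_le (by omega) hj)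
      rw [← (mem_joined G).1 hc]
      exact ih.1 c _
    refine ⟨fun c w => ?_, fun e he => ?_⟩
    · rw [contractSet_insert, contractLine_apply, Equiv.swap_apply_def]
      split_ifs with h1 h2
      · rwa [(G.contractSet S c).injective h1]
      · have := ih.1 c w
        rw [h2] at this
        exact (this.trans hl'.symm).trans (ih.1 c _)
      · exact ih.1 c w
    · rcases Finset.mem_insert.1 he with rfl | he
      · exact hl'
      · exact ih.2 e he

lemma FaceIn.reachable {c : Fin 4} {w w' : G.White} (h : G.FaceIn c G.melonicLines w)
    (hw : (G.facePerm ∅ c).SameCycle w w') :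
    G.bubbleGraph.Reachable (Sum.inl w) (Sum.inl w') := by
  obtain ⟨n, -, -, rfl⟩ := hw.exists_pow_eq''
  clear hw
  induction n with
  | zero => exact .refl _
  | succ n ih =>
    refine ih.trans ?_
    rw [pow_succ', Equiv.Perm.mul_apply]
    set x := ((G.facePerm ∅ c) ^ n) w
    have hx : (G.facePerm ∅ c).SameCycle w ((G.facePerm ∅ c) x) :=
      ⟨(n + 1 : ℕ), by rw [zpow_natCast, pow_succ']; rfl⟩
    obtain ⟨e, he, h1⟩ := h _ hx
    rw [h1]
    have h2 := bubbleGraph_reachable c x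
    rw [facePerm_eq_whiteEnd_iff, contractSet_empty] at h1
    rw [h1] at h2
    exact h2.trans (melonic_melonicLines.reachable.2 e he).symm

lemma isMelopole_melopole (hG : G.IsConnected) (hV : ¬ G.IsVacuum) {r : G.Line}
    (hr : r ∈ G.melonicLines) : G.IsMelopole (G.melopole r) := by
  have hchild : ∀ e g, g ∈ G.melopole r → G.IsChild e g →
      G.ShareInternalFace (G.melopole r) e g ∧ G.ShareInternalFace (G.melopole r) g e ∧
      G.bubbleGraph.Reachable (Sum.inl (G.whiteEnd g)) (Sum.inl (G.whiteEnd e)) := by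
    rintro e g hg ⟨-, c, hc, hs⟩
    have h1 := faceIn_melopole_of_ne_freeColor hG hV hg hc
    exact ⟨shareInternalFace_iff.2 ⟨c, hs.symm, h1.of_sameCycle hs⟩,
      shareInternalFace_iff.2 ⟨c, hs, h1⟩, (h1.mono (melopole_subset r)).reachable hs⟩
  have hall : ∀ e, Relation.ReflTransGen G.IsChild e r →
      e ∈ G.melopole r ∧
      Relation.ReflTransGen (G.ShareInternalFace (G.melopole r)) e r ∧
      Relation.ReflTransGen (G.ShareInternalFace (G.melopole r)) r e ∧
      G.bubbleGraph.Reachable (Sum.inl (G.whiteEnd r)) (Sum.inl (G.whiteEnd e)) := by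
    intro e h
    induction h using Relation.ReflTransGen.head_induction_on with
    | refl => exact ⟨self_mem_melopole hr, .refl, .refl, .refl _⟩
    | head h _ ih =>
      obtain ⟨h1, h2, h3⟩ := hchild _ _ ih.1 h
      exact ⟨mem_melopole_of_isChild hG hV ih.1 h, .head h1 ih.2.1, .tail ih.2.2.1 h2,
        ih.2.2.2.trans h3⟩
  refine ⟨⟨r, self_mem_melopole hr⟩, ?_, ?_, (melonic_melopole hG hV r).exists_list hG hV⟩
  · intro e he e' he'
    exact (hall e (mem_melopole.1 he).2).2.1.trans (hall e' (mem_melopole.1 he').2).2.2.1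
  · intro e he e' he'
    have h1 := (hall e (mem_melopole.1 he).2).2.2.2.symm.trans
      (hall e' (mem_melopole.1 he').2).2.2.2
    exact ⟨h1, h1.trans (melonic_melonicLines.reachable.2 e' (mem_melopole.1 he').1)⟩

/-- Every melopole has a root. -/
lemma IsMelopole.exists_root (hG : G.IsConnected) (hV : ¬ G.IsVacuum) {H : Finset G.Line}
    (h : G.IsMelopole H) : ∃ r ∈ G.melonicLines, H = G.melopole r := by
  obtain ⟨hne, hconn, -, l, hl, rfl, hd⟩ := h
  have hm : G.Melonic l.toFinset := melonic_of_list hl hd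
  -- the root is a line of maximal rank; connectedness leads from it to all the other lines
  obtain ⟨r, hr, hmax⟩ := l.toFinset.exists_max_image G.rank hne
  have hT := hm.subset_melonicLines
  refine ⟨r, hT hr, Finset.Subset.antisymm ?_ ?_⟩
  · intro e he
    have h1 := hconn r hr e he
    clear he
    induction h1 with
    | refl => exact self_mem_melopole (hT hr)
    | @tail a b _ hab ih =>
      obtain ⟨c, hs, hf⟩ := shareInternalFace_iff.1 hab
      by_cases hba : b = a
      · rwa [hba]
      have hbH : b ∈ l.toFinset := hf.mem hs
      by_cases hc : c = G.freeColor a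
      · obtain ⟨g, hg, hgc, hgs⟩ := hf.exists_closing hG hV hm
        -- the common face is closed by the contraction of `g`, which is the parent of `a`
        have hag : a ≠ g := by rintro rfl; exact hgc hc
        have hga : G.IsChild a g := ⟨hag, c, hgc, hgs.symm⟩
        have hgr : g ∈ G.melopole r := by
          by_cases har : a = r
          · subst har
            -- a line of maximal rank has no parent in the melopole
            exact absurd (hga.rank_lt hG hV (hT hg)) (not_lt.2 (hmax g hg))
          · exact parent_mem_melopole hG hV (hT hr) ih har hga (hT hg)
        by_cases hbg : b = g
        · rwa [hbg]
        · exact mem_melopole_of_isChild hG hV hgr ⟨hbg, c, hgc, hgs.symm.trans hs⟩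
      · exact mem_melopole_of_isChild hG hV ih ⟨hba, c, hc, hs⟩
  · intro e he
    have h1 := (mem_melopole.1 he).2
    clear he
    induction h1 using Relation.ReflTransGen.head_induction_on with
    | refl => exact hr
    | head h _ ih => exact hm.mem_of_isChild hG hV ih h

/-- Two melopoles are nested, or line- and face-disjoint. -/
lemma lineFaceDisjoint_melopole (hG : G.IsConnected) (hV : ¬ G.IsVacuum) {r s : G.Line}
    (hr : r ∈ G.melonicLines) (hs : s ∈ G.melonicLines) (hrs : r ∉ G.melopole s)
    (hsr : s ∉ G.melopole r) : G.LineFaceDisjoint (G.melopole r) (G.melopole s) := by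
  -- a common line would lead, through its unique chain of ancestors, to both roots
  have hdisj : ∀ e, e ∈ G.melopole r → e ∉ G.melopole s := by
    intro e he
    have h1 := (mem_melopole.1 he).2
    clear he
    induction h1 using Relation.ReflTransGen.head_induction_on with
    | refl => exact hrs
    | @head e g h h2 ih =>
      intro hes
      have hg := mem_melonicLines_of_chain hG hV hr h2
      refine ih (parent_mem_melopole hG hV hs hes ?_ h hg)
      rintro rfl
      exact hsr (mem_melopole.2 ⟨hs, .head h h2⟩)
  refine ⟨Finset.disjoint_left.2 fun e h1 h2 => hdisj e h1 h2, ?_⟩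
  intro e he e' he' hsh
  obtain ⟨c, hcyc, hf⟩ := shareInternalFace_iff.1 hsh
  have hm : G.Melonic (G.melopole r ∪ G.melopole s) :=
    (melonic_melopole hG hV r).union (melonic_melopole hG hV s)
  obtain ⟨g, hg, hgc, hgs⟩ := hf.exists_closing hG hV hm
  have key : ∀ t a, g ∈ G.melopole t → (G.facePerm ∅ c).SameCycle (G.whiteEnd g) (G.whiteEnd a) →
      a ∈ G.melopole t := by
    intro t a hgt ha
    by_cases hag : a = g
    · rwa [hag]
    · exact mem_melopole_of_isChild hG hV hgt ⟨hag, c, hgc, ha⟩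
  rcases Finset.mem_union.1 hg with hg | hg
  · exact hdisj e' (key r e' hg (hgs.symm.trans hcyc)) he'
  · exact hdisj e he (key s e hg hgs.symm)

/-- The meloforests are exactly the sets of melopoles `melopole r`, with `r` in an arbitrary set of
melonic lines. -/
lemma meloforests_eq (hG : G.IsConnected) (hV : ¬ G.IsVacuum) :
    G.meloforests = G.melonicLines.powerset.image fun R => R.image G.melopole := by
  ext F
  simp only [meloforests, Finset.mem_filter, Finset.mem_univ, true_and, Finset.mem_image,
    Finset.mem_powerset]
  constructor
  · rintro ⟨h1, -⟩
    refine ⟨G.melonicLines.filter fun r => G.melopole r ∈ F, Finset.filter_subset _ _, ?_⟩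
    ext H
    simp only [Finset.mem_image, Finset.mem_filter]
    constructor
    · rintro ⟨r, ⟨-, h2⟩, rfl⟩
      exact h2
    · intro hH
      obtain ⟨r, hr, rfl⟩ := (h1 H hH).exists_root hG hV
      exact ⟨r, ⟨hr, hH⟩, rfl⟩
  · rintro ⟨R, hR, rfl⟩
    refine ⟨?_, ?_⟩
    · intro H hH
      obtain ⟨r, hr, rfl⟩ := Finset.mem_image.1 hH
      exact isMelopole_melopole hG hV (hR hr)
    · intro H hH H' hH'
      obtain ⟨r, hr, rfl⟩ := Finset.mem_image.1 hH
      obtain ⟨s, hs, rfl⟩ := Finset.mem_image.1 hH'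
      by_cases h1 : r ∈ G.melopole s
      · exact Or.inr (Or.inl (melopole_mono h1))
      by_cases h2 : s ∈ G.melopole r
      · exact Or.inr (Or.inr (melopole_mono h2))
      exact Or.inl (lineFaceDisjoint_melopole hG hV (hR hr) (hR hs) h1 h2)

/-- Summation over meloforests is summation over sets of melonic lines. -/
lemma sum_meloforests (hG : G.IsConnected) (hV : ¬ G.IsVacuum) {E : Type*} [AddCommMonoid E]
    (f : Finset (Finset G.Line) → E) :
    ∑ F ∈ G.meloforests, f F = ∑ R ∈ G.melonicLines.powerset, f (R.image G.melopole) := by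
  rw [meloforests_eq hG hV, Finset.sum_image]
  intro R hR R' hR' h
  replace h : R.image G.melopole = R'.image G.melopole := h
  have hinj := melopole_injOn hG hV
  ext r
  constructor
  · intro hr
    obtain ⟨s, hs, h1⟩ := Finset.mem_image.1 (h ▸ Finset.mem_image_of_mem G.melopole hr :
      G.melopole r ∈ R'.image G.melopole)
    rwa [← hinj (Finset.mem_powerset.1 hR' hs) (Finset.mem_powerset.1 hR hr) h1]
  · intro hr
    obtain ⟨s, hs, h1⟩ := Finset.mem_image.1 (h ▸ Finset.mem_image_of_mem G.melopole hr :
      G.melopole r ∈ R.image G.melopole)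
    rwa [← hinj (Finset.mem_powerset.1 hR hs) (Finset.mem_powerset.1 hR' hr) h1]

lemma card_image_melopole (hG : G.IsConnected) (hV : ¬ G.IsVacuum) {R : Finset G.Line}
    (hR : R ⊆ G.melonicLines) : (R.image G.melopole).card = R.card :=
  Finset.card_image_of_injOn ((melopole_injOn hG hV).mono hR)

end FeynmanGraph

/-! ### Sources of external faces -/

namespace FeynmanGraph

variable {G : FeynmanGraph}

lemma backStep_of_mem {U : Finset G.Line} {c : Fin 4} {w : G.White} {e : G.Line} (he : e ∈ U)
    (h : G.facePerm ∅ c w = G.whiteEnd e) : G.backStep U c w = G.facePerm ∅ c w := by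
  have h' := facePerm_eq_whiteEnd_iff G |>.1 h
  rw [contractSet_empty] at h'
  have hex : ∃ e ∈ U, G.blackEnd e = G.coloredLine c w := ⟨e, he, h'.symm⟩
  rw [backStep, dif_pos hex, h]
  congr 1
  exact G.blackEnd.injective (hex.choose_spec.2.trans h')

lemma backStep_of_notMem {U : Finset G.Line} {c : Fin 4} {w : G.White}
    (h : ∀ e ∈ U, G.facePerm ∅ c w ≠ G.whiteEnd e) : G.backStep U c w = w := by
  have hex : ¬ ∃ e ∈ U, G.blackEnd e = G.coloredLine c w := by
    rintro ⟨e, he, h1⟩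
    refine h e he (facePerm_eq_whiteEnd_iff G |>.2 ?_)
    rw [contractSet_empty, h1]
  rw [backStep, dif_neg hex]

lemma backStep_congr {U E : Finset G.Line} {c : Fin 4} {w : G.White}
    (h : (∃ e ∈ U, G.facePerm ∅ c w = G.whiteEnd e) ↔
      ∃ e ∈ E, G.facePerm ∅ c w = G.whiteEnd e) : G.backStep U c w = G.backStep E c w := by
  by_cases h1 : ∃ e ∈ U, G.facePerm ∅ c w = G.whiteEnd e
  · obtain ⟨e, he, h2⟩ := h1
    obtain ⟨e', he', h3⟩ := h.1 ⟨e, he, h2⟩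
    rw [backStep_of_mem he h2, backStep_of_mem he' h3]
  · have h1' : ¬ ∃ e ∈ E, G.facePerm ∅ c w = G.whiteEnd e := fun h' => h1 (h.2 h')
    push Not at h1 h1'
    rw [backStep_of_notMem h1, backStep_of_notMem h1']

lemma iterate_backStep (E : Finset G.Line) (c : Fin 4) (w : G.White) (n : ℕ) :
    ∃ k : ℕ, (G.backStep E c)^[n] w = ((G.facePerm ∅ c) ^ k) w ∧
      ∀ i, 1 ≤ i → i ≤ k → ∃ r ∈ E, ((G.facePerm ∅ c) ^ i) w = G.whiteEnd r := by
  induction n with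
  | zero => exact ⟨0, rfl, fun i h1 h2 => by omega⟩
  | succ n ih =>
    obtain ⟨k, h1, h2⟩ := ih
    rw [Function.iterate_succ_apply', h1]
    by_cases h : ∃ e ∈ E, G.facePerm ∅ c (((G.facePerm ∅ c) ^ k) w) = G.whiteEnd e
    · obtain ⟨e, he, h3⟩ := h
      refine ⟨k + 1, by rw [backStep_of_mem he h3, pow_succ']; rfl, fun i hi1 hi2 => ?_⟩
      rcases Nat.lt_or_ge i (k + 1) with h4 | h4
      · exact h2 i hi1 (by omega)
      · obtain rfl : i = k + 1 := by omega
        exact ⟨e, he, by rw [pow_succ']; exact h3⟩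
    · push Not at h
      exact ⟨k, backStep_of_notMem h, h2⟩

lemma faceIn_of_periodic {E : Finset G.Line} {c : Fin 4} {w : G.White} {k : ℕ}
    (hk : ((G.facePerm ∅ c) ^ (k + 1)) w = w)
    (h : ∀ i, 1 ≤ i → i ≤ k + 1 → ∃ r ∈ E, ((G.facePerm ∅ c) ^ i) w = G.whiteEnd r) :
    G.FaceIn c E w := by
  intro w' hw'
  obtain ⟨n, -, -, rfl⟩ := hw'.exists_pow_eq''
  have key : ∃ i, 1 ≤ i ∧ i ≤ k + 1 ∧
      ((G.facePerm ∅ c) ^ n) w = ((G.facePerm ∅ c) ^ i) w := by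
    clear hw'
    induction n with
    | zero => exact ⟨k + 1, by omega, le_rfl, hk.symm⟩
    | succ n ih =>
      obtain ⟨i, h1, h2, h3⟩ := ih
      rw [pow_succ', Equiv.Perm.mul_apply, h3]
      rcases Nat.lt_or_ge i (k + 1) with h4 | h4
      · exact ⟨i + 1, by omega, by omega, by rw [pow_succ', Equiv.Perm.mul_apply]⟩
      · obtain rfl : i = k + 1 := by omega
        exact ⟨1, le_rfl, by omega, by rw [hk, pow_one]⟩
  obtain ⟨i, h1, h2, h3⟩ := key
  obtain ⟨r, hr, h4⟩ := h i h1 h2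
  exact ⟨r, hr, h3.trans h4⟩

lemma source_congr {U E : Finset G.Line} {c : Fin 4} {w : G.White}
    (h : ∀ n, G.backStep U c ((G.backStep E c)^[n] w) = G.backStep E c ((G.backStep E c)^[n] w)) :
    G.source U c w = G.source E c w := by
  rw [source, source]
  induction Fintype.card G.White with
  | zero => rfl
  | succ n ih => rw [Function.iterate_succ_apply', Function.iterate_succ_apply', ih, h]

section Source

variable {E : Finset G.Line} {c : Fin 4}

/-- When no closed face consists of lines of `E`, the source of an external face of `E` is
reached, i.e. the face does not go on. -/
lemma facePerm_source_ne (hE : ∀ w, ¬ G.FaceIn c E w) (w : G.White) (e : G.Line) (he : e ∈ E) :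
    G.facePerm ∅ c (G.source E c w) ≠ G.whiteEnd e := by
  -- the iteration either has come to rest or has followed the face through lines of `E` only
  have key : ∀ n, (∀ e ∈ E, G.facePerm ∅ c ((G.backStep E c)^[n] w) ≠ G.whiteEnd e) ∨
      ((G.backStep E c)^[n] w = ((G.facePerm ∅ c) ^ n) w ∧
        ∀ i, 1 ≤ i → i ≤ n + 1 → ∃ r ∈ E, ((G.facePerm ∅ c) ^ i) w = G.whiteEnd r) := by
    intro n
    induction n with
    | zero =>
      rw [or_iff_not_imp_left]
      intro h
      push Not at h
      obtain ⟨e, he, h1⟩ := h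
      refine ⟨rfl, fun i h2 h3 => ⟨e, he, ?_⟩⟩
      obtain rfl : i = 1 := by omega
      simpa using h1
    | succ n ih =>
      rw [Function.iterate_succ_apply']
      rcases ih with ih | ⟨h1, h2⟩
      · rw [backStep_of_notMem ih]
        exact Or.inl ih
      · obtain ⟨r, hr, h3⟩ := h2 (n + 1) (by omega) le_rfl
        have h4 : G.backStep E c ((G.backStep E c)^[n] w) = ((G.facePerm ∅ c) ^ (n + 1)) w := by
          rw [pow_succ', Equiv.Perm.mul_apply] at h3 ⊢
          rw [h1, backStep_of_mem hr h3]
        rw [h4, or_iff_not_imp_left]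
        intro h
        push Not at h
        obtain ⟨e, he, h5⟩ := h
        refine ⟨rfl, fun i hi1 hi2 => ?_⟩
        rcases Nat.lt_or_ge i (n + 2) with h6 | h6
        · exact h2 i hi1 (by omega)
        · obtain rfl : i = n + 2 := by omega
          exact ⟨e, he, by rw [pow_succ', Equiv.Perm.mul_apply]; exact h5⟩
  rcases key (Fintype.card G.White) with h | ⟨-, h⟩
  · exact h e he
  · exfalso
    -- in the second case it has met the same node twice, and the face is closed
    obtain ⟨i, j, hij, h1⟩ := Fintype.exists_ne_map_eq_of_card_lt
      (fun i : Fin (Fintype.card G.White + 1) => ((G.facePerm ∅ c) ^ (i : ℕ)) w) (by simp)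
    wlog hlt : i < j generalizing i j
    · exact this j i hij.symm h1.symm (lt_of_le_of_ne (not_lt.1 hlt) hij.symm)
    have hlt' : (i : ℕ) < j := hlt
    obtain ⟨k, hk⟩ : ∃ k, (j : ℕ) = i + (k + 1) := ⟨j - i - 1, by omega⟩
    simp only [hk, pow_add _ (i : ℕ), Equiv.Perm.mul_apply] at h1
    refine hE w (faceIn_of_periodic (k := k) (((G.facePerm ∅ c) ^ (i : ℕ)).injective h1).symm ?_)
    intro l hl1 hl2
    exact h l hl1 (by omega)

lemma source_facePerm (hE : ∀ w, ¬ G.FaceIn c E w) {w : G.White} {e : G.Line} (he : e ∈ E)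
    (h : G.facePerm ∅ c w = G.whiteEnd e) : G.source E c (G.whiteEnd e) = G.source E c w := by
  rw [← h, ← backStep_of_mem he h, source, source, ← Function.iterate_succ_apply,
    Function.iterate_succ_apply']
  exact backStep_of_notMem (facePerm_source_ne hE w)

lemma source_eq_self {w : G.White} (h : ∀ e ∈ E, G.facePerm ∅ c w ≠ G.whiteEnd e) :
    G.source E c w = w :=
  Function.iterate_fixed (backStep_of_notMem h) _

lemma source_injOn : Set.InjOn (G.source E c) {w | ∀ e ∈ E, w ≠ G.whiteEnd e} := by
  intro w hw w' hw' h
  obtain ⟨k, h1, h2⟩ := iterate_backStep E c w (Fintype.card G.White)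
  obtain ⟨k', h1', h2'⟩ := iterate_backStep E c w' (Fintype.card G.White)
  rw [source, source, h1, h1'] at h
  clear h1 h1'
  wlog hk : k ≤ k' generalizing w w' k k'
  · exact (this hw' hw k' h2' k h.symm h2 (by omega)).symm
  obtain ⟨d, rfl⟩ := Nat.exists_eq_add_of_le hk
  rw [pow_add, Equiv.Perm.mul_apply] at h
  have h3 := ((G.facePerm ∅ c) ^ k).injective h
  rcases Nat.eq_zero_or_pos d with rfl | hd
  · simpa using h3
  · obtain ⟨r, hr, h4⟩ := h2' d hd (by omega)
    exact absurd (h3.trans h4) (hw r hr)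

/-- Every colored line that is not followed by a line of `E` is the source of a white node that does
not carry a line of `E`; by `source_injOn`, of exactly one. -/
lemma exists_source_eq (hE : ∀ w, ¬ G.FaceIn c E w) {x : G.White}
    (hx : ∀ e ∈ E, G.facePerm ∅ c x ≠ G.whiteEnd e) :
    ∃ w, (∀ e ∈ E, w ≠ G.whiteEnd e) ∧ G.source E c w = x := by
  classical
  let A : Finset G.White := Finset.univ.filter fun w => ∀ e ∈ E, w ≠ G.whiteEnd e
  let B : Finset G.White := Finset.univ.filter fun w => ∀ e ∈ E, G.facePerm ∅ c w ≠ G.whiteEnd e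
  have hcard : B.card ≤ A.card :=
    Finset.card_le_card_of_injOn (G.facePerm ∅ c) (by intro w hw; simpa [A, B] using hw)
      (G.facePerm ∅ c).injective.injOn
  have hsurj := Finset.surjOn_of_injOn_of_card_le (G.source E c) (s := A) (t := B)
    (by intro w _; simpa [A, B] using facePerm_source_ne hE w)
    (source_injOn.mono (by intro w; simp [A])) hcard
  obtain ⟨w, hw, h⟩ := hsurj (by simpa [B] using hx : x ∈ (B : Set G.White))
  exact ⟨w, by simpa [A] using hw, h⟩

end Source

variable (G) in
/-- The lines of `R` whose free color is `c`. -/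
noncomputable def withFreeColor (R : Finset G.Line) (c : Fin 4) : Finset G.Line :=
  R.filter fun r => G.freeColor r = c

lemma mem_withFreeColor {R : Finset G.Line} {c : Fin 4} {r : G.Line} :
    r ∈ G.withFreeColor R c ↔ r ∈ R ∧ G.freeColor r = c := by simp [withFreeColor]

/-- A closed face of melonic lines is not the free face of the line that closes it. -/
lemma not_faceIn_withFreeColor (hG : G.IsConnected) (hV : ¬ G.IsVacuum) {R : Finset G.Line}
    (hR : R ⊆ G.melonicLines) (c : Fin 4) (w : G.White) :
    ¬ G.FaceIn c (G.withFreeColor R c) w := by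
  intro h
  have hsub : G.withFreeColor R c ⊆ G.melonicLines := (Finset.filter_subset _ _).trans hR
  obtain ⟨g, -, hgc, hgs⟩ := (h.mono hsub).exists_closing hG hV melonic_melonicLines
  exact hgc (mem_withFreeColor.1 (h.mem hgs)).2.symm

lemma mem_of_not_faceIn_melopole (hG : G.IsConnected) (hV : ¬ G.IsVacuum) {r a : G.Line}
    (hr : r ∈ G.melonicLines) (ha : a ∈ G.melopole r) {c : Fin 4}
    (h : ¬ G.FaceIn c (G.melopole r) (G.whiteEnd a)) : a = r ∧ G.freeColor r = c := by
  by_cases har : a = r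
  · subst har
    refine ⟨rfl, ?_⟩
    by_contra hc
    exact h (faceIn_melopole_of_ne_freeColor hG hV ha (Ne.symm hc))
  · exact absurd (faceIn_melopole_of_ne_root hG hV hr ha har c) h

/-- For the factor of a line `e`, the operators `τ` of a set of melopoles with roots `R` skip
exactly the roots, each in its free color. -/
lemma source_line (hG : G.IsConnected) (hV : ¬ G.IsVacuum) {R : Finset G.Line}
    (hR : R ⊆ G.melonicLines) (c : Fin 4) (e : G.Line) :
    G.source (((R.image G.melopole).filter fun H => e ∉ H).sup id) c (G.whiteEnd e) =
      G.source (G.withFreeColor R c) c (G.whiteEnd e) := by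
  apply source_congr
  intro n
  obtain ⟨k, h1, h2⟩ := iterate_backStep (G.withFreeColor R c) c (G.whiteEnd e) n
  rw [h1]
  apply backStep_congr
  have hcyc : ∀ a, G.facePerm ∅ c (((G.facePerm ∅ c) ^ k) (G.whiteEnd e)) = G.whiteEnd a →
      (G.facePerm ∅ c).SameCycle (G.whiteEnd e) (G.whiteEnd a) := fun a ha =>
    ⟨(k + 1 : ℕ), by rw [zpow_natCast, pow_succ']; exact ha⟩
  constructor
  · rintro ⟨a, ha, h3⟩
    obtain ⟨H, hH, haH⟩ := Finset.mem_sup.1 ha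
    rw [Finset.mem_filter, Finset.mem_image] at hH
    obtain ⟨⟨r, hr, rfl⟩, heH⟩ := hH
    -- the face passes through `e`, which is not in the melopole, so it is external
    have h4 : ¬ G.FaceIn c (G.melopole r) (G.whiteEnd a) := fun hf =>
      heH (hf.mem (hcyc a h3).symm)
    obtain ⟨rfl, h5⟩ := mem_of_not_faceIn_melopole hG hV (hR hr) haH h4
    exact ⟨a, mem_withFreeColor.2 ⟨hr, h5⟩, h3⟩
  · rintro ⟨a, ha, h3⟩
    obtain ⟨haR, hac⟩ := mem_withFreeColor.1 ha
    refine ⟨a, Finset.mem_sup.2 ⟨G.melopole a, Finset.mem_filter.2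
      ⟨Finset.mem_image_of_mem _ haR, ?_⟩, self_mem_melopole (hR haR)⟩, h3⟩
    -- a melopole containing `e` could have `a` as its root only if the face were internal to it
    intro hea
    by_cases hne : e = a
    · subst hne
      have h4 : ((G.facePerm ∅ c) ^ (k + 1)) (G.whiteEnd e) = G.whiteEnd e := by
        rw [pow_succ']; exact h3
      refine not_faceIn_withFreeColor hG hV hR c _ (faceIn_of_periodic h4 ?_)
      intro i hi1 hi2
      rcases Nat.lt_or_ge i (k + 1) with h6 | h6
      · exact h2 i hi1 (by omega)
      · obtain rfl : i = k + 1 := by omega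
        exact ⟨e, ha, h4⟩
    · refine not_faceIn_melopole_root hG hV (hR haR) ?_
      rw [hac]
      exact (faceIn_melopole_of_ne_root hG hV (hR haR) hea hne c).of_sameCycle (hcyc a h3)

/-- As `source_line`, for the test function, on which the operators of all the melopoles act. -/
lemma source_leg (hG : G.IsConnected) (hV : ¬ G.IsVacuum) {R : Finset G.Line}
    (hR : R ⊆ G.melonicLines) (c : Fin 4) {w : G.White} (hw : ∀ e, G.whiteEnd e ≠ w) :
    G.source ((R.image G.melopole).sup id) c w = G.source (G.withFreeColor R c) c w := by
  apply source_congr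
  intro n
  obtain ⟨k, h1, h2⟩ := iterate_backStep (G.withFreeColor R c) c w n
  rw [h1]
  apply backStep_congr
  constructor
  · rintro ⟨a, ha, h3⟩
    obtain ⟨H, hH, haH⟩ := Finset.mem_sup.1 ha
    obtain ⟨r, hr, rfl⟩ := Finset.mem_image.1 hH
    have h4 : ¬ G.FaceIn c (G.melopole r) (G.whiteEnd a) := by
      intro hf
      have hcyc : (G.facePerm ∅ c).SameCycle w (G.whiteEnd a) :=
        ⟨(k + 1 : ℕ), by rw [zpow_natCast, pow_succ']; exact h3⟩
      obtain ⟨e, -, h5⟩ := hf _ hcyc.symm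
      exact hw e h5.symm
    obtain ⟨rfl, h5⟩ := mem_of_not_faceIn_melopole hG hV (hR hr) haH h4
    exact ⟨a, mem_withFreeColor.2 ⟨hr, h5⟩, h3⟩
  · rintro ⟨a, ha, h3⟩
    obtain ⟨haR, -⟩ := mem_withFreeColor.1 ha
    exact ⟨a, Finset.mem_sup.2 ⟨G.melopole a, Finset.mem_image_of_mem _ haR,
      self_mem_melopole (hR haR)⟩, h3⟩

/-! ### Momentum configurations -/

variable (G) in
/-- Momenta: an integer for every line and color, and one for every external leg and color. -/
abbrev Momenta : Type := (G.Line → Fin 4 → ℤ) × (G.ExtLeg × Fin 4 → ℤ)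

open Classical in
/-- The momentum of color `c` that enters a white node from its line or external leg. -/
noncomputable def whiteMom (x : G.Momenta) (c : Fin 4) (w : G.White) : ℤ :=
  if h : ∃ e, G.whiteEnd e = w then x.1 h.choose c
  else x.2 (Sum.inl ⟨w, fun e he => h ⟨e, he⟩⟩, c)

open Classical in
/-- The momentum of color `c` that leaves a black node into its line or external leg. -/
noncomputable def blackMom (x : G.Momenta) (c : Fin 4) (b : G.Black) : ℤ :=
  if h : ∃ e, G.blackEnd e = b then x.1 h.choose c
  else -x.2 (Sum.inr ⟨b, fun e he => h ⟨e, he⟩⟩, c)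

lemma whiteMom_whiteEnd (x : G.Momenta) (c : Fin 4) (e : G.Line) :
    whiteMom x c (G.whiteEnd e) = x.1 e c := by
  have h : ∃ e', G.whiteEnd e' = G.whiteEnd e := ⟨e, rfl⟩
  rw [whiteMom, dif_pos h, G.whiteEnd.injective h.choose_spec]

lemma blackMom_blackEnd (x : G.Momenta) (c : Fin 4) (e : G.Line) :
    blackMom x c (G.blackEnd e) = x.1 e c := by
  have h : ∃ e', G.blackEnd e' = G.blackEnd e := ⟨e, rfl⟩
  rw [blackMom, dif_pos h, G.blackEnd.injective h.choose_spec]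

lemma whiteMom_leg (x : G.Momenta) (c : Fin 4) (w : {w : G.White // ∀ e, G.whiteEnd e ≠ w}) :
    whiteMom x c w.1 = x.2 (Sum.inl w, c) := by
  have h : ¬ ∃ e', G.whiteEnd e' = w.1 := fun ⟨e, he⟩ => w.2 e he
  rw [whiteMom, dif_neg h]

lemma blackMom_leg (x : G.Momenta) (c : Fin 4) (b : {b : G.Black // ∀ e, G.blackEnd e ≠ b}) :
    blackMom x c b.1 = -x.2 (Sum.inr b, c) := by
  have h : ¬ ∃ e', G.blackEnd e' = b.1 := fun ⟨e, he⟩ => b.2 e he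
  rw [blackMom, dif_neg h]

lemma white_cases (w : G.White) :
    (∃ e, w = G.whiteEnd e) ∨ ∃ v : {w : G.White // ∀ e, G.whiteEnd e ≠ w}, w = v.1 := by
  by_cases h : ∃ e, w = G.whiteEnd e
  · exact Or.inl h
  · exact Or.inr ⟨⟨w, fun e he => h ⟨e, he.symm⟩⟩, rfl⟩

lemma black_cases (b : G.Black) :
    (∃ e, b = G.blackEnd e) ∨ ∃ v : {b : G.Black // ∀ e, G.blackEnd e ≠ b}, b = v.1 := by
  by_cases h : ∃ e, b = G.blackEnd e
  · exact Or.inl h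
  · exact Or.inr ⟨⟨b, fun e he => h ⟨e, he.symm⟩⟩, rfl⟩

variable (G) in
/-- The momentum configurations that are conserved along all faces after contraction of `S`; the
lines of `S` carry no momentum. -/
def solutions (S : Finset G.Line) : Set G.Momenta :=
  {x | (∀ e ∈ S, x.1 e = 0) ∧ ∀ c w, whiteMom x c w = blackMom x c (G.contractSet S c w)}

variable (G) in
/-- Momentum conservation on the colored lines, when the lines of `R` are skipped in their free
color. -/
def skipSolutions (R : Finset G.Line) : Set G.Momenta :=
  {x | ∀ c w, ∑ w', (if G.source (G.withFreeColor R c) c w' = w then whiteMom x c w' else 0) =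
    blackMom x c (G.coloredLine c w)}

/-- Set to zero the momenta of the lines of `R` in their free colors. -/
noncomputable def mask (R : Finset G.Line) (N : G.Line → Fin 4 → ℤ) : G.Line → Fin 4 → ℤ :=
  fun e c => if e ∈ R ∧ G.freeColor e = c then 0 else N e c

lemma mem_solutions_empty {x : G.Momenta} : x ∈ G.solutions ∅ ↔
    ∀ c w, whiteMom x c w = blackMom x c (G.coloredLine c w) := by
  simp [solutions, contractSet_empty]

lemma facePerm_empty_eq {c : Fin 4} {w : G.White} {e : G.Line} :
    G.facePerm ∅ c w = G.whiteEnd e ↔ G.coloredLine c w = G.blackEnd e := by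
  rw [facePerm_eq_whiteEnd_iff, contractSet_empty]

/-- Conservation with skips means that the skipped momenta vanish, and that all the others reappear
at their sources. -/
lemma mem_skipSolutions_iff (hG : G.IsConnected) (hV : ¬ G.IsVacuum) {R : Finset G.Line}
    (hR : R ⊆ G.melonicLines) {x : G.Momenta} :
    x ∈ G.skipSolutions R ↔ (∀ r ∈ R, x.1 r (G.freeColor r) = 0) ∧
      ∀ c w, (∀ r ∈ G.withFreeColor R c, w ≠ G.whiteEnd r) →
        whiteMom x c w =
          blackMom x c (G.coloredLine c (G.source (G.withFreeColor R c) c w)) := by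
  have hE := fun c => not_faceIn_withFreeColor hG hV hR c
  have hsum : (∀ r ∈ R, x.1 r (G.freeColor r) = 0) → ∀ c w,
      (∀ r ∈ G.withFreeColor R c, w ≠ G.whiteEnd r) →
      ∑ w', (if G.source (G.withFreeColor R c) c w' = G.source (G.withFreeColor R c) c w
        then whiteMom x c w' else 0) = whiteMom x c w := by
    intro h0 c w hw
    -- other nodes either have another source or carry a skipped line, whose momentum vanishes
    rw [Finset.sum_eq_single w]
    · simp
    · intro w' _ hne
      by_cases h1 : ∀ r ∈ G.withFreeColor R c, w' ≠ G.whiteEnd r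
      · rw [if_neg]
        intro h2
        exact hne (source_injOn h1 hw h2)
      · push Not at h1
        obtain ⟨r, hr, rfl⟩ := h1
        obtain ⟨hrR, rfl⟩ := mem_withFreeColor.1 hr
        rw [whiteMom_whiteEnd, h0 r hrR, ite_self]
    · simp
  constructor
  · intro hx
    have h0 : ∀ r ∈ R, x.1 r (G.freeColor r) = 0 := by
      intro r hr
      have h1 := hx (G.freeColor r) ((G.coloredLine (G.freeColor r)).symm (G.blackEnd r))
      rw [Equiv.apply_symm_apply, blackMom_blackEnd] at h1
      rw [← h1]
      refine Finset.sum_eq_zero fun w' _ => if_neg fun h2 => ?_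
      refine facePerm_source_ne (hE _) w' r (mem_withFreeColor.2 ⟨hr, rfl⟩) ?_
      rw [h2, facePerm_empty_eq, Equiv.apply_symm_apply]
    exact ⟨h0, fun c w hw => by rw [← hx c, hsum h0 c w hw]⟩
  · rintro ⟨h0, h1⟩ c w
    by_cases hw : ∀ e ∈ G.withFreeColor R c, G.facePerm ∅ c w ≠ G.whiteEnd e
    · obtain ⟨w', h2, rfl⟩ := exists_source_eq (hE c) hw
      rw [hsum h0 c w' h2, h1 c w' h2]
    · push Not at hw
      obtain ⟨e, he, h2⟩ := hw
      obtain ⟨heR, hec⟩ := mem_withFreeColor.1 he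
      rw [facePerm_empty_eq.1 h2, blackMom_blackEnd, ← hec, h0 e heR]
      refine Finset.sum_eq_zero fun w' _ => if_neg fun h3 => ?_
      refine facePerm_source_ne (hE _) w' e ?_ (by rw [h3, hec]; exact h2)
      rwa [hec]

lemma whiteMom_mask {R : Finset G.Line} {x : G.Momenta} {c : Fin 4} {w : G.White}
    (hw : ∀ r ∈ G.withFreeColor R c, w ≠ G.whiteEnd r) :
    whiteMom (mask R x.1, x.2) c w = whiteMom x c w := by
  rcases white_cases w with ⟨e, rfl⟩ | ⟨v, rfl⟩
  · rw [whiteMom_whiteEnd, whiteMom_whiteEnd]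
    refine if_neg ?_
    exact fun h => hw e (mem_withFreeColor.2 h) rfl
  · rw [whiteMom_leg, whiteMom_leg]

lemma blackMom_mask {R : Finset G.Line} {x : G.Momenta} {c : Fin 4} {b : G.Black}
    (hb : ∀ r ∈ G.withFreeColor R c, b ≠ G.blackEnd r) :
    blackMom (mask R x.1, x.2) c b = blackMom x c b := by
  rcases black_cases b with ⟨e, rfl⟩ | ⟨v, rfl⟩
  · rw [blackMom_blackEnd, blackMom_blackEnd]
    refine if_neg ?_
    exact fun h => hb e (mem_withFreeColor.2 h) rfl
  · rw [blackMom_leg, blackMom_leg]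

/-- A conserved momentum is constant up to the source. -/
lemma whiteMom_eq_source {E : Finset G.Line} {c : Fin 4} {x : G.Momenta}
    (hx : x ∈ G.solutions ∅) (w : G.White) :
    whiteMom x c w = blackMom x c (G.coloredLine c (G.source E c w)) := by
  rw [← mem_solutions_empty.1 hx, source]
  induction Fintype.card G.White with
  | zero => rfl
  | succ n ih =>
    rw [Function.iterate_succ_apply', ih]
    set y := (G.backStep E c)^[n] w
    by_cases h : ∃ e ∈ E, G.facePerm ∅ c y = G.whiteEnd e
    · obtain ⟨e, he, h1⟩ := h
      rw [backStep_of_mem he h1, h1, whiteMom_whiteEnd, mem_solutions_empty.1 hx,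
        facePerm_empty_eq.1 h1, blackMom_blackEnd]
    · push Not at h
      rw [backStep_of_notMem h]

/-- Masking is a bijection from the conserved momenta to the momenta conserved with skips: the
masked momenta can be read off from the rest of their faces. -/
lemma bijOn_mask (hG : G.IsConnected) (hV : ¬ G.IsVacuum) {R : Finset G.Line}
    (hR : R ⊆ G.melonicLines) :
    Set.BijOn (fun x : G.Momenta => ((mask R x.1, x.2) : G.Momenta)) (G.solutions ∅)
      (G.skipSolutions R) := by
  have hE := fun c => not_faceIn_withFreeColor hG hV hR c
  have hne : ∀ c w, ∀ r ∈ G.withFreeColor R c,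
      G.coloredLine c (G.source (G.withFreeColor R c) c w) ≠ G.blackEnd r := by
    intro c w r hr h
    exact facePerm_source_ne (hE c) w r hr (facePerm_empty_eq.2 h)
  refine ⟨?_, ?_, ?_⟩
  · intro x hx
    rw [mem_skipSolutions_iff hG hV hR]
    refine ⟨fun r hr => if_pos ⟨hr, rfl⟩, fun c w hw => ?_⟩
    rw [whiteMom_mask hw, blackMom_mask (hne c w)]
    exact whiteMom_eq_source hx w
  · rintro ⟨N, q⟩ hx ⟨N', q'⟩ hx' h
    obtain ⟨h1, rfl⟩ := Prod.mk.injEq _ _ _ _ ▸ h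
    simp only [Prod.mk.injEq, and_true] at h ⊢
    funext e c
    have e1 := whiteMom_eq_source (E := G.withFreeColor R c) (c := c) hx (G.whiteEnd e)
    have e2 := whiteMom_eq_source (E := G.withFreeColor R c) (c := c) hx' (G.whiteEnd e)
    rw [whiteMom_whiteEnd, ← blackMom_mask (hne c _)] at e1 e2
    simp only at e1 e2
    rw [e1, e2, h]
  · rintro ⟨N, q⟩ hx
    obtain ⟨h0, h1⟩ := (mem_skipSolutions_iff hG hV hR).1 hx
    let N' : G.Line → Fin 4 → ℤ := fun e c =>
      if e ∈ R ∧ G.freeColor e = c then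
        blackMom (N, q) c (G.coloredLine c (G.source (G.withFreeColor R c) c (G.whiteEnd e)))
      else N e c
    have hmask : mask R N' = N := by
      funext e c
      by_cases h : e ∈ R ∧ G.freeColor e = c
      · rw [mask, if_pos h, ← h.2]
        exact (h0 e h.1).symm
      · rw [mask, if_neg h]
        exact if_neg h
    refine ⟨(N', q), mem_solutions_empty.2 fun c w => ?_, by simp only [hmask]⟩
    have hwhite : whiteMom (N', q) c w =
        blackMom (N, q) c (G.coloredLine c (G.source (G.withFreeColor R c) c w)) := by
      by_cases hw : ∀ r ∈ G.withFreeColor R c, w ≠ G.whiteEnd r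
      · rw [← whiteMom_mask hw, ← h1 c w hw]
        simp only [hmask]
      · push Not at hw
        obtain ⟨r, hr, rfl⟩ := hw
        rw [whiteMom_whiteEnd]
        exact if_pos (mem_withFreeColor.1 hr)
    rw [hwhite]
    by_cases hw : ∀ e ∈ G.withFreeColor R c, G.facePerm ∅ c w ≠ G.whiteEnd e
    · rw [source_eq_self hw, ← blackMom_mask (R := R) (x := (N', q))]
      · simp only [hmask]
      · intro r hr h
        exact hw r hr (facePerm_empty_eq.2 h)
    · push Not at hw
      obtain ⟨e, he, h2⟩ := hw
      rw [facePerm_empty_eq.1 h2, blackMom_blackEnd, ← source_facePerm (hE c) he h2]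
      exact (if_pos (mem_withFreeColor.1 he)).symm

end FeynmanGraph

/-! ### Power counting for graphs without four-dipoles -/

/-- The weight `1 + |n|` of a momentum. -/
noncomputable def bracket (n : ℤ) : ℝ := 1 + |(n : ℝ)|

lemma one_le_bracket (n : ℤ) : 1 ≤ bracket n := by
  rw [bracket]; linarith [abs_nonneg (n : ℝ)]

lemma bracket_pos (n : ℤ) : 0 < bracket n := zero_lt_one.trans_le (one_le_bracket n)

namespace FeynmanGraph

variable {G : FeynmanGraph}

/-- The size of the momentum of a line. -/
noncomputable def lineSize (N : Fin 4 → ℤ) : ℝ := 1 + ∑ c, |(N c : ℝ)|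

lemma one_le_lineSize (N : Fin 4 → ℤ) : 1 ≤ lineSize N := by
  rw [lineSize]
  linarith [Finset.sum_nonneg fun (c : Fin 4) (_ : c ∈ Finset.univ) => abs_nonneg (N c : ℝ)]

lemma lineSize_pos (N : Fin 4 → ℤ) : 0 < lineSize N := zero_lt_one.trans_le (one_le_lineSize N)

lemma bracket_le_lineSize (N : Fin 4 → ℤ) (c : Fin 4) : bracket (N c) ≤ lineSize N := by
  rw [bracket, lineSize]
  linarith [Finset.single_le_sum (f := fun c => |(N c : ℝ)|) (fun c _ => abs_nonneg _)
    (Finset.mem_univ c)]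

variable (G) in
/-- The momentum configurations that survive the contraction of all melonic lines and the
integration over the holonomies. -/
def skeletonMomenta : Set G.Momenta :=
  {x | x ∈ G.solutions G.melonicLines ∧ ∀ e, ∑ c, x.1 e c = 0}

/-- The momentum of the line `e` in color `c` is a function of the external momenta and of the
momenta in `B`. -/
def Determined (B : Finset (G.Line × Fin 4)) (e : G.Line) (c : Fin 4) : Prop :=
  ∀ x ∈ G.skeletonMomenta, ∀ y ∈ G.skeletonMomenta, x.2 = y.2 →
    (∀ s ∈ B, x.1 s.1 s.2 = y.1 s.1 s.2) → x.1 e c = y.1 e c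

lemma Determined.mono {B B' : Finset (G.Line × Fin 4)} {e : G.Line} {c : Fin 4}
    (h : Determined B e c) (hB : B ⊆ B') : Determined B' e c :=
  fun x hx y hy hq hs => h x hx y hy hq fun s hs' => hs s (hB hs')

lemma Determined.congr {B : Finset (G.Line × Fin 4)} {e e' : G.Line} {c : Fin 4}
    (h : Determined B e c) (he : ∀ x ∈ G.skeletonMomenta, x.1 e' c = x.1 e c) :
    Determined B e' c := fun x hx y hy hq hs => by
  rw [he x hx, he y hy, h x hx y hy hq hs]

/-- The line `e` is hooked to the bubble of the node `v`. -/
def Touches (e : G.Line) (v : G.White ⊕ G.Black) : Prop :=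
  G.bubbleGraph.Reachable v (Sum.inl (G.whiteEnd e)) ∨
    G.bubbleGraph.Reachable v (Sum.inr (G.blackEnd e))

open Classical in
/-- The number of lines of `D` that are hooked to the bubble of `v`. -/
noncomputable def touchCount (D : Finset G.Line) (v : G.White ⊕ G.Black) : ℕ :=
  (D.filter fun e => Touches e v).card

lemma touchCount_le {p : ℕ} (hp : G.OrderAtMost p) (D : Finset G.Line)
    (v : G.White ⊕ G.Black) : touchCount D v ≤ p := by
  classical
  refine le_trans ?_ (hp v)
  rw [touchCount, ← Set.ncard_coe_finset]
  refine Set.ncard_le_ncard_of_injOn (fun e =>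
    if G.bubbleGraph.Reachable v (Sum.inl (G.whiteEnd e)) then Sum.inl (G.whiteEnd e)
    else Sum.inr (G.blackEnd e)) ?_ ?_ (Set.toFinite _)
  · intro e he
    have h := (Finset.mem_filter.1 (Finset.mem_coe.1 he)).2
    by_cases h1 : G.bubbleGraph.Reachable v (Sum.inl (G.whiteEnd e))
    · simp [h1]
    · simpa [h1] using h.resolve_left h1
  · intro e _ e' _ h
    by_cases h1 : G.bubbleGraph.Reachable v (Sum.inl (G.whiteEnd e)) <;>
    by_cases h2 : G.bubbleGraph.Reachable v (Sum.inl (G.whiteEnd e')) <;>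
    simp [h1, h2] at h <;> exact h

lemma touchCount_insert {D : Finset G.Line} {v : G.White ⊕ G.Black} {e : G.Line} (he : e ∉ D)
    (h : Touches e v) : touchCount (insert e D) v = touchCount D v + 1 := by
  classical
  rw [touchCount, touchCount, Finset.filter_insert, if_pos h, Finset.card_insert_of_notMem]
  simp [he]

section Skeleton

variable {B : Finset (G.Line × Fin 4)} {D : Finset G.Line} {e : G.Line} {c : Fin 4}

/-- If the momentum of a line is not determined, the colored line at its white end leads to a line
that has not been explored. -/
lemma exists_white_neighbor (hD : ∀ e ∈ D, ∀ c, Determined B e c) (he : e ∉ G.melonicLines)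
    (h : ¬ Determined B e c) :
    ∃ e', e' ∉ G.melonicLines ∧ e' ∉ D ∧
      G.contractSet G.melonicLines c (G.whiteEnd e) = G.blackEnd e' ∧
      ∀ x ∈ G.skeletonMomenta, x.1 e' c = x.1 e c := by
  rcases black_cases (G.contractSet G.melonicLines c (G.whiteEnd e)) with ⟨e', h1⟩ | ⟨b, h1⟩
  · have h2 : ∀ x ∈ G.skeletonMomenta, x.1 e' c = x.1 e c := by
      intro x hx
      rw [← whiteMom_whiteEnd x c e, hx.1.2, h1, blackMom_blackEnd]
    refine ⟨e', ?_, ?_, h1, h2⟩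
    · intro he'
      rw [contractSet_eq_blackEnd_iff _ he'] at h1
      exact he (G.whiteEnd.injective h1 ▸ he')
    · exact fun he' => h ((hD e' he' c).congr fun x hx => (h2 x hx).symm)
  · refine absurd (fun x hx y hy hq _ => ?_) h
    rw [← whiteMom_whiteEnd x c e, ← whiteMom_whiteEnd y c e, hx.1.2, hy.1.2, h1, blackMom_leg,
      blackMom_leg, hq]

lemma exists_black_neighbor (hD : ∀ e ∈ D, ∀ c, Determined B e c) (he : e ∉ G.melonicLines)
    (h : ¬ Determined B e c) :
    ∃ e', e' ∉ G.melonicLines ∧ e' ∉ D ∧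
      G.contractSet G.melonicLines c (G.whiteEnd e') = G.blackEnd e ∧
      ∀ x ∈ G.skeletonMomenta, x.1 e' c = x.1 e c := by
  rcases white_cases ((G.contractSet G.melonicLines c).symm (G.blackEnd e)) with ⟨e', h1⟩ | ⟨b, h1⟩
  · rw [Equiv.symm_apply_eq] at h1
    have h2 : ∀ x ∈ G.skeletonMomenta, x.1 e' c = x.1 e c := by
      intro x hx
      rw [← whiteMom_whiteEnd x c e', hx.1.2, ← h1, blackMom_blackEnd]
    refine ⟨e', ?_, ?_, h1.symm, h2⟩
    · intro he'
      rw [contractSet_whiteEnd _ he'] at h1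
      exact he (G.blackEnd.injective h1 ▸ he')
    · exact fun he' => h ((hD e' he' c).congr fun x hx => (h2 x hx).symm)
  · rw [Equiv.symm_apply_eq] at h1
    refine absurd (fun x hx y hy hq _ => ?_) h
    rw [← blackMom_blackEnd x c e, ← blackMom_blackEnd y c e, h1, ← hx.1.2, ← hy.1.2,
      whiteMom_leg, whiteMom_leg, hq]

/-- A line with three undetermined momenta has, in the same bubble, an unexplored neighbor that
shares one of them, since it is not a four-dipole. -/
lemma exists_next {a : Fin 4} {v : G.White ⊕ G.Black}
    (hD : ∀ e ∈ D, ∀ c, Determined B e c) (he : e ∉ G.melonicLines) (hv : Touches e v)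
    (h : ∀ c, c ≠ a → ¬ Determined B e c) :
    ∃ c, c ≠ a ∧ ∃ e', e' ≠ e ∧ e' ∉ G.melonicLines ∧ e' ∉ D ∧ Touches e' v ∧
      ∀ x ∈ G.skeletonMomenta, x.1 e' c = x.1 e c := by
  by_contra hcon
  push Not at hcon
  have hreach := (melonic_melonicLines (G := G)).reachable.1
  have hj : Finset.univ.erase a ⊆ G.joined (G.contractSet G.melonicLines) e := by
    intro c hc
    have hca := Finset.ne_of_mem_erase hc
    rw [mem_joined]
    rcases hv with hv | hv
    · obtain ⟨e', h1, h2, h3, h4⟩ := exists_white_neighbor hD he (h c hca)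
      by_cases hee : e' = e
      · rw [h3, hee]
      · obtain ⟨x, hx, h5⟩ := hcon c hca e' hee h1 h2 (Or.inr (by
          have := hv.trans (hreach c (G.whiteEnd e))
          rwa [h3] at this))
        exact absurd (h4 x hx) h5
    · obtain ⟨e', h1, h2, h3, h4⟩ := exists_black_neighbor hD he (h c hca)
      by_cases hee : e' = e
      · rw [← h3, hee]
      · obtain ⟨x, hx, h5⟩ := hcon c hca e' hee h1 h2 (Or.inl (by
          have := hreach c (G.whiteEnd e')
          rw [h3] at this
          exact hv.trans this.symm))
        exact absurd (h4 x hx) h5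
  have h1 := Finset.card_le_card hj
  rw [Finset.card_erase_of_mem (Finset.mem_univ _), Finset.card_univ, Fintype.card_fin] at h1
  have h2 := card_joined_melonicLines_lt he
  omega

end Skeleton

/-- The momenta of the lines of `D` are determined by the external ones and those in `B`, and the
propagators of `D` make the sum over the momenta in `B` converge. The quadratic decay of the
propagator is reduced by `4 * δ` because a line carries a weight for each of its four colors. -/
structure Summed (δ : ℝ) (D : Finset G.Line) (B : Finset (G.Line × Fin 4)) : Prop where
  sub : ∀ s ∈ B, s.1 ∈ D
  det : ∀ e ∈ D, ∀ c, Determined B e c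
  le : ∀ x ∈ G.skeletonMomenta, ∏ e ∈ D, lineSize (x.1 e) ^ (-(2 - 4 * δ)) ≤
    ∏ s ∈ B, bracket (x.1 s.1 s.2) ^ (-(1 + δ))

/-- As `Summed`, but the sum over one of the momenta lacks some decay. This momentum is shared with
the unexplored line `e`, which is hooked to the bubble of `v`. The missing exponent is proportional
to the number of explored lines at this bubble. -/
structure Indebted (δ : ℝ) (D : Finset G.Line) (B : Finset (G.Line × Fin 4))
    (v : G.White ⊕ G.Black) (e : G.Line) (a : Fin 4) : Prop where
  sub : ∀ s ∈ B, s.1 ∈ D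
  det : ∀ e ∈ D, ∀ c, Determined B e c
  notMem : e ∉ D
  not_melonic : e ∉ G.melonicLines
  touches : Touches e v
  det_line : Determined B e a
  le : ∀ x ∈ G.skeletonMomenta, ∏ e ∈ D, lineSize (x.1 e) ^ (-(2 - 4 * δ)) ≤
    bracket (x.1 e a) ^ (6 * δ * touchCount D v) *
      ∏ s ∈ B, bracket (x.1 s.1 s.2) ^ (-(1 + δ))

/-- One step of the exploration: summing over the undetermined momenta of the line `e`. A line with
at most two undetermined momenta leaves one free sum and pays the debt; a line with three leaves two
free sums, which its propagator misses by a small power, and this debt is passed on to a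
neighbor. -/
lemma Indebted.step {p : ℕ} (hp : G.OrderAtMost p) {δ : ℝ} (hδ : 0 < δ)
    (hδp : 6 * δ * p + 5 * δ ≤ 1) {D : Finset G.Line} {B : Finset (G.Line × Fin 4)}
    {v : G.White ⊕ G.Black} {e : G.Line} {a : Fin 4} (h : Indebted δ D B v e a) :
    ∃ B', Summed δ (insert e D) B' ∨ ∃ e' a', Indebted δ (insert e D) B' v e' a' := by
  classical
  set η := 6 * δ * touchCount D v with hη
  have hη0 : 0 ≤ η := by positivity
  have hηp : η ≤ 6 * δ * p :=
    mul_le_mul_of_nonneg_left (by exact_mod_cast touchCount_le hp D v) (by positivity)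
  let U : Finset (Fin 4) := Finset.univ.filter fun c => ¬ Determined B e c
  have haU : a ∉ U := by simp [U, h.det_line]
  -- general bookkeeping for the choice of a set `U'` of new summation variables
  have main : ∀ U' ⊆ U, (∀ c ∈ U, c ∉ U' → ∀ d ∈ U, d ∉ U' → c = d) →
      (∀ s ∈ B ∪ U'.image (Prod.mk e), s.1 ∈ insert e D) ∧
      (∀ e' ∈ insert e D, ∀ c, Determined (B ∪ U'.image (Prod.mk e)) e' c) ∧
      ∀ x ∈ G.skeletonMomenta, ∏ e ∈ insert e D, lineSize (x.1 e) ^ (-(2 - 4 * δ)) ≤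
        (lineSize (x.1 e) ^ (-(2 - 4 * δ)) * bracket (x.1 e a) ^ η *
          ∏ c ∈ U', bracket (x.1 e c) ^ (1 + δ)) *
        ∏ s ∈ B ∪ U'.image (Prod.mk e), bracket (x.1 s.1 s.2) ^ (-(1 + δ)) := by
    intro U' hU' hU
    refine ⟨?_, ?_, ?_⟩
    · intro s hs
      rcases Finset.mem_union.1 hs with hs | hs
      · exact Finset.mem_insert_of_mem (h.sub s hs)
      · obtain ⟨c, -, rfl⟩ := Finset.mem_image.1 hs
        exact Finset.mem_insert_self _ _
    · intro e' he' c
      rcases Finset.mem_insert.1 he' with rfl | he'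
      · have hother : ∀ d, d ∉ U ∨ d ∈ U' → Determined (B ∪ U'.image (Prod.mk e')) e' d := by
          rintro d (hd | hd)
          · refine Determined.mono ?_ Finset.subset_union_left
            simpa [U] using hd
          · intro x _ y _ _ hs
            exact hs (e', d) (Finset.mem_union_right _ (Finset.mem_image_of_mem _ hd))
        by_cases hc : c ∉ U ∨ c ∈ U'
        · exact hother c hc
        · push Not at hc
          -- the last momentum of the line follows from conservation
          intro x hx y hy hq hs
          have e1 := hx.2 e'
          have e2 := hy.2 e'
          rw [← Finset.add_sum_erase _ _ (Finset.mem_univ c)] at e1 e2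
          have e3 : ∑ d ∈ Finset.univ.erase c, x.1 e' d = ∑ d ∈ Finset.univ.erase c, y.1 e' d := by
            refine Finset.sum_congr rfl fun d hd => hother d ?_ x hx y hy hq hs
            by_contra hd'
            push Not at hd'
            exact Finset.ne_of_mem_erase hd (hU d hd'.1 hd'.2 c hc.1 hc.2)
          linarith
      · exact (h.det e' he' c).mono Finset.subset_union_left
    · intro x hx
      have hdisj : Disjoint B (U'.image (Prod.mk e)) := by
        rw [Finset.disjoint_left]
        intro s hs hs'
        obtain ⟨c, -, rfl⟩ := Finset.mem_image.1 hs'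
        exact h.notMem (h.sub _ hs)
      rw [Finset.prod_insert h.notMem, Finset.prod_union hdisj,
        Finset.prod_image (by intro c _ d _ hcd; exact (Prod.mk.inj hcd).2)]
      have e1 : (∏ c ∈ U', bracket (x.1 e c) ^ (1 + δ)) *
          ∏ c ∈ U', bracket (x.1 e c) ^ (-(1 + δ)) = 1 := by
        rw [← Finset.prod_mul_distrib]
        refine Finset.prod_eq_one fun c _ => ?_
        rw [← Real.rpow_add (bracket_pos _), add_neg_cancel, Real.rpow_zero]
      calc lineSize (x.1 e) ^ (-(2 - 4 * δ)) * ∏ e ∈ D, lineSize (x.1 e) ^ (-(2 - 4 * δ))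
          ≤ lineSize (x.1 e) ^ (-(2 - 4 * δ)) * (bracket (x.1 e a) ^ η *
              ∏ s ∈ B, bracket (x.1 s.1 s.2) ^ (-(1 + δ))) :=
            mul_le_mul_of_nonneg_left (h.le x hx) (Real.rpow_nonneg (lineSize_pos _).le _)
        _ = (lineSize (x.1 e) ^ (-(2 - 4 * δ)) * bracket (x.1 e a) ^ η *
              ((∏ c ∈ U', bracket (x.1 e c) ^ (1 + δ)) *
                ∏ c ∈ U', bracket (x.1 e c) ^ (-(1 + δ)))) *
              ∏ s ∈ B, bracket (x.1 s.1 s.2) ^ (-(1 + δ)) := by rw [e1]; ring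
        _ = _ := by ring
  have hfac : ∀ x : G.Momenta, lineSize (x.1 e) ^ (-(2 - 4 * δ)) * bracket (x.1 e a) ^ η ≤
      lineSize (x.1 e) ^ (-(2 - 4 * δ) + η) := by
    intro x
    rw [Real.rpow_add (lineSize_pos _)]
    exact mul_le_mul_of_nonneg_left
      (Real.rpow_le_rpow (bracket_pos _).le (bracket_le_lineSize _ a) hη0)
      (Real.rpow_nonneg (lineSize_pos _).le _)
  have hprodnn : ∀ (x : G.Momenta) (B' : Finset (G.Line × Fin 4)),
      0 ≤ ∏ s ∈ B', bracket (x.1 s.1 s.2) ^ (-(1 + δ)) := fun x B' =>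
    Finset.prod_nonneg fun s _ => Real.rpow_nonneg (bracket_pos _).le _
  -- `U` is the set of the colors in which the momentum of the line is not determined
  by_cases hcard : U.card ≤ 2
  · -- at most one free sum, which the decay of the propagator covers together with the debt
    obtain ⟨U', hU', h1, hU⟩ : ∃ U' ⊆ U, U'.card ≤ 1 ∧
        ∀ c ∈ U, c ∉ U' → ∀ d ∈ U, d ∉ U' → c = d := by
      rcases U.eq_empty_or_nonempty with h0 | ⟨u, hu⟩
      · exact ⟨∅, by simp, by simp, by simp [h0]⟩
      · refine ⟨U.erase u, Finset.erase_subset _ _, ?_, ?_⟩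
        · rw [Finset.card_erase_of_mem hu]; omega
        · intro c hc hc' d hd hd'
          simp only [Finset.mem_erase, not_and_or, not_not] at hc' hd'
          rw [hc'.resolve_right (not_not.2 hc), hd'.resolve_right (not_not.2 hd)]
    obtain ⟨m1, m2, m3⟩ := main U' hU' hU
    refine ⟨_, Or.inl ⟨m1, m2, fun x hx => (m3 x hx).trans ?_⟩⟩
    refine mul_le_of_le_one_left (hprodnn _ _) ?_
    have h2 : ∏ c ∈ U', bracket (x.1 e c) ^ (1 + δ) ≤ lineSize (x.1 e) ^ (1 + δ) := by
      rcases Finset.card_le_one_iff_subset_singleton.1 h1 with ⟨u, hu⟩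
      rcases Finset.subset_singleton_iff.1 hu with rfl | rfl
      · rw [Finset.prod_empty]
        exact Real.one_le_rpow (one_le_lineSize _) (by linarith)
      · rw [Finset.prod_singleton]
        exact Real.rpow_le_rpow (bracket_pos _).le (bracket_le_lineSize _ _) (by linarith)
    calc lineSize (x.1 e) ^ (-(2 - 4 * δ)) * bracket (x.1 e a) ^ η *
          ∏ c ∈ U', bracket (x.1 e c) ^ (1 + δ)
        ≤ lineSize (x.1 e) ^ (-(2 - 4 * δ) + η) * lineSize (x.1 e) ^ (1 + δ) :=
          mul_le_mul (hfac x) h2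
            (Finset.prod_nonneg fun s _ => Real.rpow_nonneg (bracket_pos _).le _)
            (Real.rpow_nonneg (lineSize_pos _).le _)
      _ = lineSize (x.1 e) ^ (-(2 - 4 * δ) + η + (1 + δ)) :=
          (Real.rpow_add (lineSize_pos _) _ _).symm
      _ ≤ 1 := Real.rpow_le_one_of_one_le_of_nonpos (one_le_lineSize _) (by linarith)
  · -- two free sums, one of them over the momentum shared with a neighbor; the propagator pays for
    -- all but the power `η + 6 * δ` of this momentum
    have hUeq : U = Finset.univ.erase a := by
      apply Finset.eq_of_subset_of_card_le
      · intro c hc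
        exact Finset.mem_erase.2 ⟨fun h => haU (h ▸ hc), Finset.mem_univ _⟩
      · rw [Finset.card_erase_of_mem (Finset.mem_univ _), Finset.card_univ, Fintype.card_fin]
        omega
    have hnd : ∀ c, c ≠ a → ¬ Determined B e c := by
      intro c hc
      have : c ∈ U := by rw [hUeq]; simp [hc]
      simpa [U] using this
    obtain ⟨a', ha', e', hee, he'm, he'D, he't, he'x⟩ :=
      exists_next h.det h.not_melonic h.touches hnd
    obtain ⟨b, hb⟩ : (U.erase a').Nonempty := by
      rw [← Finset.card_pos, Finset.card_erase_of_mem (by rw [hUeq]; simp [ha'])]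
      omega
    have ha'U : a' ∈ U := by rw [hUeq]; simp [ha']
    have hbU : b ∈ U := Finset.mem_of_mem_erase hb
    have hba : b ≠ a' := Finset.ne_of_mem_erase hb
    have hU3 : (U \ {a', b}).card ≤ 1 := by
      rw [Finset.card_sdiff_of_subset (by
        intro z hz
        rcases Finset.mem_insert.1 hz with rfl | hz
        · exact ha'U
        · rwa [Finset.mem_singleton.1 hz]), Finset.card_pair hba.symm, hUeq,
        Finset.card_erase_of_mem (Finset.mem_univ _), Finset.card_univ, Fintype.card_fin]
    obtain ⟨m1, m2, m3⟩ := main {a', b} (by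
      intro z hz
      rcases Finset.mem_insert.1 hz with rfl | hz
      · exact ha'U
      · rwa [Finset.mem_singleton.1 hz]) (fun c hc hc' d hd hd' =>
        Finset.card_le_one.1 hU3 c (Finset.mem_sdiff.2 ⟨hc, hc'⟩) d
          (Finset.mem_sdiff.2 ⟨hd, hd'⟩))
    refine ⟨_, Or.inr ⟨e', a', m1, m2, ?_, he'm, he't, ?_, fun x hx => (m3 x hx).trans ?_⟩⟩
    · simp [hee, he'D]
    · exact (m2 e (Finset.mem_insert_self _ _) a').congr he'x
    refine mul_le_mul_of_nonneg_right ?_ (hprodnn _ _)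
    rw [touchCount_insert h.notMem h.touches, he'x x hx, Finset.prod_pair hba.symm]
    have e0 : 6 * δ * ((touchCount D v + 1 : ℕ) : ℝ) = η + 6 * δ := by rw [hη]; push_cast; ring
    rw [e0]
    have h1 : bracket (x.1 e a') ^ (1 + δ) ≤
        bracket (x.1 e a') ^ (η + 6 * δ) * lineSize (x.1 e) ^ (1 - 5 * δ - η) := by
      have : bracket (x.1 e a') ^ (1 + δ) = bracket (x.1 e a') ^ (η + 6 * δ) *
          bracket (x.1 e a') ^ (1 - 5 * δ - η) := by
        rw [← Real.rpow_add (bracket_pos _)]; ring_nf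
      rw [this]
      exact mul_le_mul_of_nonneg_left
        (Real.rpow_le_rpow (bracket_pos _).le (bracket_le_lineSize _ _) (by linarith))
        (Real.rpow_nonneg (bracket_pos _).le _)
    have h2 : bracket (x.1 e b) ^ (1 + δ) ≤ lineSize (x.1 e) ^ (1 + δ) :=
      Real.rpow_le_rpow (bracket_pos _).le (bracket_le_lineSize _ _) (by linarith)
    have hl := lineSize_pos (x.1 e)
    calc lineSize (x.1 e) ^ (-(2 - 4 * δ)) * bracket (x.1 e a) ^ η *
          (bracket (x.1 e a') ^ (1 + δ) * bracket (x.1 e b) ^ (1 + δ))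
        ≤ lineSize (x.1 e) ^ (-(2 - 4 * δ) + η) *
          ((bracket (x.1 e a') ^ (η + 6 * δ) * lineSize (x.1 e) ^ (1 - 5 * δ - η)) *
            lineSize (x.1 e) ^ (1 + δ)) := by
          refine mul_le_mul (hfac x) (mul_le_mul h1 h2 ?_ ?_) ?_ ?_
          · exact Real.rpow_nonneg (bracket_pos _).le _
          · exact mul_nonneg (Real.rpow_nonneg (bracket_pos _).le _) (Real.rpow_nonneg hl.le _)
          · exact mul_nonneg (Real.rpow_nonneg (bracket_pos _).le _)
              (Real.rpow_nonneg (bracket_pos _).le _)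
          · exact Real.rpow_nonneg hl.le _
      _ = bracket (x.1 e a') ^ (η + 6 * δ) * (lineSize (x.1 e) ^ (-(2 - 4 * δ) + η) *
            lineSize (x.1 e) ^ (1 - 5 * δ - η) * lineSize (x.1 e) ^ (1 + δ)) := by ring
      _ = bracket (x.1 e a') ^ (η + 6 * δ) := by
          rw [← Real.rpow_add hl, ← Real.rpow_add hl]
          rw [show -(2 - 4 * δ) + η + (1 - 5 * δ - η) + (1 + δ) = 0 by ring, Real.rpow_zero,
            mul_one]

/-- As long as not all lines have been explored, there is an unexplored line with a determined
momentum: otherwise the unexplored lines would be cut off from the rest of the graph. -/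
lemma Summed.exists_indebted (hG : G.IsConnected) (hV : ¬ G.IsVacuum) {δ : ℝ} (hδ : 0 < δ)
    {D : Finset G.Line} {B : Finset (G.Line × Fin 4)} (h : Summed δ D B)
    (hne : (G.melonicLinesᶜ \ D).Nonempty) : ∃ v e a, Indebted δ D B v e a := by
  by_contra hcon
  refine melonic_melonicLines.not_closed hG hV hne ?_ ?_
  · exact Finset.disjoint_left.2 fun e he he' => by simp [he] at he'
  intro c e he
  simp only [Finset.mem_sdiff, Finset.mem_compl] at he
  by_cases hdet : Determined B e c
  · refine absurd ⟨Sum.inl (G.whiteEnd e), e, c, h.sub, h.det, he.2, he.1, Or.inl (.refl _), hdet,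
      fun x hx => (h.le x hx).trans ?_⟩ hcon
    refine le_mul_of_one_le_left (Finset.prod_nonneg fun s _ =>
      Real.rpow_nonneg (bracket_pos _).le _) (Real.one_le_rpow (one_le_bracket _) (by positivity))
  · obtain ⟨e', h1, h2, h3, -⟩ := exists_white_neighbor h.det he.1 hdet
    exact ⟨e', by simp [h1, h2], h3⟩

/-- Power counting: after contraction of all melonic lines, the propagators make the sum over
independent internal momenta converge. -/
lemma exists_summed (hG : G.IsConnected) (hV : ¬ G.IsVacuum) {p : ℕ} (hp : G.OrderAtMost p)
    {δ : ℝ} (hδ : 0 < δ) (hδp : 6 * δ * p + 5 * δ ≤ 1) :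
    ∃ B, Summed δ G.melonicLinesᶜ B := by
  have key : ∀ n, ∀ D ⊆ G.melonicLinesᶜ, (G.melonicLinesᶜ \ D).card = n →
      (∃ B, Summed δ D B ∨ ∃ v e a, Indebted δ D B v e a) → ∃ B, Summed δ G.melonicLinesᶜ B := by
    intro n
    induction n with
    | zero =>
      rintro D hD hn ⟨B, h | ⟨v, e, a, h⟩⟩
      · rw [Finset.card_eq_zero, Finset.sdiff_eq_empty_iff_subset] at hn
        rw [Finset.Subset.antisymm hD hn] at h
        exact ⟨B, h⟩
      · rw [Finset.card_eq_zero, Finset.sdiff_eq_empty_iff_subset] at hn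
        exact absurd (hn (Finset.mem_compl.2 h.not_melonic)) h.notMem
    | succ n ih =>
      rintro D hD hn ⟨B, h⟩
      obtain ⟨v, e, a, h⟩ : ∃ v e a, Indebted δ D B v e a := by
        rcases h with h | h
        · exact h.exists_indebted hG hV hδ (by rw [← Finset.card_pos, hn]; omega)
        · exact h
      obtain ⟨B', hB'⟩ := h.step hp hδ hδp
      have he : e ∈ G.melonicLinesᶜ := Finset.mem_compl.2 h.not_melonic
      refine ih (insert e D) (Finset.insert_subset he hD) ?_ ⟨B', ?_⟩
      · rw [Finset.sdiff_insert, Finset.card_erase_of_mem (by simp [h.not_melonic, h.notMem]), hn]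
        rfl
      · rcases hB' with h | ⟨e', a', h⟩
        · exact Or.inl h
        · exact Or.inr ⟨v, e', a', h⟩
  exact key _ ∅ (by simp) rfl ⟨∅, Or.inl ⟨by simp, by simp, by simp⟩⟩

end FeynmanGraph

/-! ### Sums of powers of momenta -/

lemma summable_bracket {b : ℝ} (hb : 1 < b) : Summable fun n : ℤ => bracket n ^ (-b) := by
  have h1 : Summable fun n : ℤ => |(n : ℝ)| ^ (-b) + (Pi.single 0 1 : ℤ → ℝ) n :=
    (Real.summable_abs_int_rpow hb).add (hasSum_pi_single 0 (1 : ℝ)).summable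
  refine h1.of_nonneg_of_le (fun n => Real.rpow_nonneg (bracket_pos n).le _) fun n => ?_
  rcases eq_or_ne n 0 with rfl | hn
  · simp [bracket, Real.zero_rpow (by linarith : -b ≠ 0)]
  · have h0 : 0 < |(n : ℝ)| := abs_pos.2 (by exact_mod_cast hn)
    rw [Pi.single_eq_of_ne hn, add_zero]
    exact Real.rpow_le_rpow_of_nonpos h0 (by rw [bracket]; linarith) (by linarith)

/-- A sum of powers of momenta. -/
noncomputable def bracketSum (b : ℝ) : ℝ := ∑' n : ℤ, bracket n ^ (-b)

lemma one_le_bracketSum {b : ℝ} (hb : 1 < b) : 1 ≤ bracketSum b := by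
  have := (summable_bracket hb).le_tsum 0 fun n _ => Real.rpow_nonneg (bracket_pos n).le _
  rw [bracketSum]
  exact le_trans (le_of_eq (by simp [bracket])) this

lemma summable_bracket_mul {b : ℝ} (hb : 1 < b) :
    Summable fun x : ℤ × ℤ => bracket x.1 ^ (-b) * bracket x.2 ^ (-b) :=
  (summable_bracket hb).mul_of_nonneg (summable_bracket hb)
    (fun n => Real.rpow_nonneg (bracket_pos n).le _) fun n => Real.rpow_nonneg (bracket_pos n).le _

lemma tsum_bracket_mul {b : ℝ} (hb : 1 < b) :
    ∑' x : ℤ × ℤ, bracket x.1 ^ (-b) * bracket x.2 ^ (-b) = bracketSum b ^ 2 := by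
  rw [sq, bracketSum, (summable_bracket hb).tsum_mul_tsum (summable_bracket hb)
    (summable_bracket_mul hb)]

lemma bracket_neg (n : ℤ) : bracket (-n) = bracket n := by simp [bracket]

lemma bracket_add_one_le (n : ℤ) : bracket (n + 1) ≤ 2 * bracket n := by
  have := abs_add_le (n : ℝ) 1
  rw [abs_one] at this
  simp only [bracket]; push_cast
  linarith [abs_nonneg (n : ℝ)]

lemma bracket_le_add_one (n : ℤ) : bracket n ≤ 2 * bracket (n + 1) := by
  have := bracket_add_one_le (-(n + 1))
  rw [bracket_neg] at this
  rwa [show -(n + 1) + 1 = -n by ring, bracket_neg] at this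

/-! ### Slowly varying weights -/

/-- Functions of a momentum that grow like a small power and vary accordingly. -/
structure SlowlyVarying (ε A : ℝ) (ρ : ℤ → ℝ) : Prop where
  bound : ∀ n, |ρ n| ≤ A * bracket n ^ ε
  diff : ∀ n, |ρ (n + 1) - ρ n| ≤ A * bracket n ^ (ε - 1)

lemma slowlyVarying_one {ε A : ℝ} (hε : 0 ≤ ε) (hA : 1 ≤ A) :
    SlowlyVarying ε A fun _ => 1 := by
  refine ⟨fun n => ?_, fun n => ?_⟩
  · rw [abs_one]
    exact one_le_mul_of_one_le_of_one_le hA (Real.one_le_rpow (one_le_bracket n) hε)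
  · rw [sub_self, abs_zero]
    exact mul_nonneg (by linarith) (Real.rpow_nonneg (bracket_pos n).le _)

namespace SlowlyVarying

variable {ε A : ℝ} {ρ : ℤ → ℝ}

lemma mono (h : SlowlyVarying ε A ρ) {ε' A' : ℝ} (hε : ε ≤ ε') (hA : A ≤ A') (hA' : 0 ≤ A') :
    SlowlyVarying ε' A' ρ := by
  have hp : ∀ (n : ℤ) (s t : ℝ), s ≤ t → A * bracket n ^ s ≤ A' * bracket n ^ t := fun n s t hst =>
    have h0 : 0 ≤ bracket n ^ s := Real.rpow_nonneg (bracket_pos n).le s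
    mul_le_mul hA (Real.rpow_le_rpow_of_exponent_le (one_le_bracket n) hst) h0 hA'
  exact ⟨fun n => (h.bound n).trans (hp n _ _ hε),
    fun n => (h.diff n).trans (hp n _ _ (by linarith))⟩

lemma nonneg (h : SlowlyVarying ε A ρ) : 0 ≤ A := by
  have h0 := (abs_nonneg _).trans (h.bound 0)
  simpa [bracket] using h0

lemma mul (h : SlowlyVarying ε A ρ) {ε' A' : ℝ} {ρ' : ℤ → ℝ} (h' : SlowlyVarying ε' A' ρ')
    (hε0 : 0 ≤ ε) (hε1 : ε ≤ 1) : SlowlyVarying (ε + ε') (3 * (A * A')) fun n => ρ n * ρ' n := by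
  have hA := h.nonneg
  have hA' := h'.nonneg
  refine ⟨fun n => ?_, fun n => ?_⟩
  · have hb := bracket_pos n
    rw [abs_mul, Real.rpow_add hb]
    calc |ρ n| * |ρ' n| ≤ (A * bracket n ^ ε) * (A' * bracket n ^ ε') :=
          mul_le_mul (h.bound n) (h'.bound n) (abs_nonneg _) (by positivity)
      _ = 1 * (A * A') * (bracket n ^ ε * bracket n ^ ε') := by ring
      _ ≤ _ := by gcongr; norm_num
  · have hb := bracket_pos n
    have e1 : ρ (n + 1) * ρ' (n + 1) - ρ n * ρ' n =
        ρ (n + 1) * (ρ' (n + 1) - ρ' n) + (ρ (n + 1) - ρ n) * ρ' n := by ring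
    have e2 : |ρ (n + 1)| ≤ 2 * A * bracket n ^ ε := by
      refine (h.bound _).trans ?_
      have : bracket (n + 1) ^ ε ≤ 2 * bracket n ^ ε := by
        calc bracket (n + 1) ^ ε ≤ (2 * bracket n) ^ ε :=
              Real.rpow_le_rpow (bracket_pos _).le (bracket_add_one_le n) hε0
          _ = 2 ^ ε * bracket n ^ ε := Real.mul_rpow (by norm_num) hb.le
          _ ≤ 2 ^ (1 : ℝ) * bracket n ^ ε := by
            gcongr
            norm_num
          _ = _ := by rw [Real.rpow_one]
      calc A * bracket (n + 1) ^ ε ≤ A * (2 * bracket n ^ ε) := by gcongr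
        _ = _ := by ring
    rw [e1]
    refine (abs_add_le _ _).trans ?_
    rw [abs_mul, abs_mul]
    calc |ρ (n + 1)| * |ρ' (n + 1) - ρ' n| + |ρ (n + 1) - ρ n| * |ρ' n|
        ≤ (2 * A * bracket n ^ ε) * (A' * bracket n ^ (ε' - 1)) +
          (A * bracket n ^ (ε - 1)) * (A' * bracket n ^ ε') := by
          gcongr
          · exact h'.diff n
          · exact h.diff n
          · exact h'.bound n
      _ = 2 * (A * A') * (bracket n ^ ε * bracket n ^ (ε' - 1)) +
          (A * A') * (bracket n ^ (ε - 1) * bracket n ^ ε') := by ring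
      _ = 3 * (A * A') * bracket n ^ (ε + ε' - 1) := by
          rw [← Real.rpow_add hb, ← Real.rpow_add hb]
          rw [show ε + (ε' - 1) = ε + ε' - 1 by ring, show ε - 1 + ε' = ε + ε' - 1 by ring]
          ring

/-- A function that vanishes at `0` is controlled by its differences. -/
lemma of_diff (hε : 0 < ε) (hε1 : ε ≤ 1) (hA : 0 ≤ A) (h0 : ρ 0 = 0)
    (h : ∀ n, |ρ (n + 1) - ρ n| ≤ A * bracket n ^ (ε - 1)) :
    SlowlyVarying ε (2 / ε * A) ρ := by
  -- concavity of `x ^ ε` bounds the sum of the differences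
  have hstep : ∀ x : ℝ, 1 ≤ x → x ^ (ε - 1) ≤ 2 / ε * ((x + 1) ^ ε - x ^ ε) := by
    intro x hx
    have hx1 : 0 < x + 1 := by linarith
    have h1 := rpow_one_add_le_one_add_mul_self (s := -(1 / (x + 1))) (p := ε)
      (by rw [neg_le_neg_iff, div_le_one hx1]; linarith) hε.le hε1
    have h2 : 1 + -(1 / (x + 1)) = x / (x + 1) := by field_simp; ring
    rw [h2, Real.div_rpow (by linarith) hx1.le, div_le_iff₀ (Real.rpow_pos_of_pos hx1 _)] at h1
    have h3 : (x + 1) ^ (ε - 1) = (x + 1) ^ ε / (x + 1) := by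
      rw [Real.rpow_sub hx1, Real.rpow_one]
    have h4 : x ^ (ε - 1) ≤ 2 * (x + 1) ^ (ε - 1) := by
      have h5 : (2 * x) ^ (ε - 1) ≤ (x + 1) ^ (ε - 1) :=
        Real.rpow_le_rpow_of_nonpos hx1 (by linarith) (by linarith)
      have h6 : (2 : ℝ)⁻¹ ≤ 2 ^ (ε - 1) := by
        rw [← Real.rpow_neg_one]
        exact Real.rpow_le_rpow_of_exponent_le (by norm_num) (by linarith)
      rw [Real.mul_rpow (by norm_num) (by linarith)] at h5
      have h7 := mul_le_mul_of_nonneg_right h6 (Real.rpow_nonneg (by linarith : 0 ≤ x) (ε - 1))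
      linarith
    have h5 : ε * (x + 1) ^ (ε - 1) ≤ (x + 1) ^ ε - x ^ ε := by
      rw [h3]
      have : (1 + ε * -(1 / (x + 1))) * (x + 1) ^ ε =
        (x + 1) ^ ε - ε * ((x + 1) ^ ε / (x + 1)) := by ring
      linarith
    calc x ^ (ε - 1) ≤ 2 * (x + 1) ^ (ε - 1) := h4
      _ = 2 / ε * (ε * (x + 1) ^ (ε - 1)) := by field_simp
      _ ≤ _ := by gcongr
  have hC : 0 ≤ 2 / ε * A := by positivity
  have hnat : ∀ k : ℕ, |ρ k| ≤ 2 / ε * A * bracket k ^ ε ∧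
      |ρ (-k)| ≤ 2 / ε * A * bracket k ^ ε := by
    intro k
    induction k with
    | zero =>
      have := mul_nonneg hC (Real.rpow_nonneg (bracket_pos ((0 : ℕ) : ℤ)).le ε)
      simpa [h0] using this
    | succ k ih =>
      have hbk : bracket (k : ℤ) = 1 + k := by simp [bracket]
      have hbk1 : bracket ((k + 1 : ℕ) : ℤ) = 1 + k + 1 := by
        simp only [bracket]; push_cast
        rw [abs_of_nonneg (by positivity)]; ring
      have hs := mul_le_mul_of_nonneg_left (hstep (1 + k)
        (by linarith [Nat.cast_nonneg (α := ℝ) k])) hA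
      rw [hbk1]
      rw [hbk] at ih
      have e : A * (2 / ε * ((1 + (k : ℝ) + 1) ^ ε - (1 + k) ^ ε)) =
        2 / ε * A * (1 + k + 1) ^ ε - 2 / ε * A * (1 + k) ^ ε := by ring
      constructor
      · have h1 := h k
        rw [hbk] at h1
        have h2 := abs_add_le (ρ (k + 1) - ρ k) (ρ k)
        rw [sub_add_cancel] at h2
        push_cast
        linarith [ih.1]
      · have h1 := h (-(k + 1 : ℤ))
        rw [show -((k : ℤ) + 1) + 1 = -k by ring, bracket_neg] at h1
        have h3 : bracket ((k : ℤ) + 1) ^ (ε - 1) ≤ (1 + k) ^ (ε - 1) := by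
          rw [← hbk]
          refine Real.rpow_le_rpow_of_nonpos (bracket_pos _) ?_ (by linarith)
          have : bracket ((k : ℤ) + 1) = 1 + k + 1 := by exact_mod_cast hbk1
          rw [this, hbk]; linarith
        have h4 := mul_le_mul_of_nonneg_left h3 hA
        have h2 := abs_sub_abs_le_abs_sub (ρ (-((k : ℤ) + 1))) (ρ (-k))
        rw [abs_sub_comm] at h2
        push_cast
        linarith [ih.2]
  refine ⟨fun n => ?_, fun n => (h n).trans ?_⟩
  · rcases Int.eq_nat_or_neg n with ⟨k, rfl | rfl⟩
    · exact (hnat k).1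
    · rw [bracket_neg]; exact (hnat k).2
  · have : (1 : ℝ) ≤ 2 / ε := by rw [le_div_iff₀ hε]; linarith
    have h1 := mul_le_mul_of_nonneg_right this hA
    rw [one_mul] at h1
    gcongr
    exact Real.rpow_nonneg (bracket_pos n).le _

end SlowlyVarying

/-! ### The propagator and the renormalized dipole -/

/-- The propagator with cutoff `t`, at a momentum of square `s`. -/
noncomputable def propagator (m t s : ℝ) : ℝ := Real.exp (-(t * (m ^ 2 + s))) / (m ^ 2 + s)

section Propagator

variable {m t : ℝ}

lemma propagator_nonneg (s : ℝ) (hs : 0 ≤ s) : 0 ≤ propagator m t s := by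
  unfold propagator; positivity

lemma propagator_le (hm : m ≠ 0) (ht : 0 ≤ t) {s : ℝ} (hs : 0 ≤ s) :
    propagator m t s ≤ 1 / (m ^ 2 + s) := by
  have h : 0 < m ^ 2 + s := by positivity
  unfold propagator
  gcongr
  exact Real.exp_le_one_iff.2 (by have := mul_nonneg ht h.le; linarith)

lemma mul_exp_neg_le (x : ℝ) : x * Real.exp (-x) ≤ 1 := by
  have h := Real.add_one_le_exp x
  rw [Real.exp_neg, ← div_eq_mul_inv, div_le_one (Real.exp_pos x)]
  linarith

lemma propagator_le_sq (hm : m ≠ 0) (ht : 0 < t) {s : ℝ} (hs : 0 ≤ s) :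
    propagator m t s ≤ t⁻¹ / (m ^ 2 + s) ^ 2 := by
  have h : 0 < m ^ 2 + s := by positivity
  unfold propagator
  rw [div_le_div_iff₀ h (by positivity)]
  have h1 := mul_exp_neg_le (t * (m ^ 2 + s))
  have h2 : Real.exp (-(t * (m ^ 2 + s))) * (m ^ 2 + s) ≤ t⁻¹ := by
    rw [← one_div, le_div_iff₀ ht]; linarith
  calc _ = (Real.exp (-(t * (m ^ 2 + s))) * (m ^ 2 + s)) * (m ^ 2 + s) := by ring
    _ ≤ _ := by gcongr

/-- The propagator is Lipschitz, uniformly in the cutoff. -/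
lemma abs_propagator_sub_le (hm : m ≠ 0) (ht : 0 ≤ t) {s s' y : ℝ} (hs : 0 ≤ s) (hs' : 0 ≤ s')
    (hy : 0 < y) (h1 : y ≤ m ^ 2 + s) (h2 : y ≤ m ^ 2 + s') :
    |propagator m t s - propagator m t s'| ≤ 2 * |s - s'| / y ^ 2 := by
  wlog h : s ≤ s' generalizing s s'
  · rw [abs_sub_comm, abs_sub_comm s]
    exact this hs' hs h2 h1 (by linarith)
  set a := m ^ 2 + s with ha
  set b := m ^ 2 + s' with hb
  have ha0 : 0 < a := by positivity
  have hab : a ≤ b := by linarith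
  have hb0 : 0 < b := by linarith
  have hanti : Real.exp (-(t * b)) ≤ Real.exp (-(t * a)) :=
    Real.exp_le_exp.2 (neg_le_neg (mul_le_mul_of_nonneg_left hab ht))
  have hle : propagator m t s' ≤ propagator m t s := by
    unfold propagator
    rw [← ha, ← hb]
    exact div_le_div₀ (Real.exp_pos _).le hanti ha0 hab
  rw [abs_of_nonneg (by linarith), abs_of_nonpos (by linarith)]
  have e1 : Real.exp (-(t * a)) - Real.exp (-(t * b)) ≤ (b - a) / a := by
    have h3 : Real.exp (-(t * b)) = Real.exp (-(t * a)) * Real.exp (-(t * (b - a))) := by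
      rw [← Real.exp_add]; ring_nf
    have h4 := Real.add_one_le_exp (-(t * (b - a)))
    have h5 : t * Real.exp (-(t * a)) ≤ 1 / a := by
      rcases ht.eq_or_lt with rfl | ht
      · simpa using ha0.le
      · rw [le_div_iff₀ ha0]
        have := mul_exp_neg_le (t * a)
        linarith
    calc Real.exp (-(t * a)) - Real.exp (-(t * b))
        = Real.exp (-(t * a)) * (1 - Real.exp (-(t * (b - a)))) := by rw [h3]; ring
      _ ≤ Real.exp (-(t * a)) * (t * (b - a)) := by gcongr; linarith
      _ = (t * Real.exp (-(t * a))) * (b - a) := by ring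
      _ ≤ 1 / a * (b - a) := by gcongr
      _ = _ := by ring
  have e2 : propagator m t s - propagator m t s' ≤ 2 * (b - a) / a ^ 2 := by
    unfold propagator
    rw [← ha, ← hb]
    have h6 : Real.exp (-(t * b)) ≤ 1 :=
      Real.exp_le_one_iff.2 (by have := mul_nonneg ht hb0.le; linarith)
    calc Real.exp (-(t * a)) / a - Real.exp (-(t * b)) / b
        = (Real.exp (-(t * a)) - Real.exp (-(t * b))) / a +
            Real.exp (-(t * b)) * ((b - a) / (a * b)) := by field_simp; ring
      _ ≤ (b - a) / a / a + 1 * ((b - a) / (a * a)) := by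
          gcongr
      _ = _ := by field_simp; ring
  calc propagator m t s - propagator m t s' ≤ 2 * (b - a) / a ^ 2 := e2
    _ ≤ 2 * (b - a) / y ^ 2 := by
      gcongr
    _ = _ := by rw [ha, hb]; ring

end Propagator

/-- The propagator of a line, with momentum conservation from the integral over the holonomy. -/
noncomputable def lineKernel (m t : ℝ) (N : Fin 4 → ℤ) : ℝ :=
  if ∑ c, N c = 0 then propagator m t (∑ c, (N c : ℝ) ^ 2) else 0

/-- The dipole subtracted at zero external momentum, with weights on its three internal faces. -/
noncomputable def dipole (m t : ℝ) (ρ : Fin 3 → ℤ → ℝ) (c : Fin 4) (k : ℤ) : ℝ :=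
  ∑' a : Fin 3 → ℤ, (lineKernel m t (c.insertNth k a) - lineKernel m t (c.insertNth 0 a)) *
    ∏ i, ρ i (a i)

section Dipole

variable {m t : ℝ} {ρ : Fin 3 → ℤ → ℝ}

/-- The summand of the dipole after the sum over one momentum. -/
noncomputable def dipoleTerm (m t : ℝ) (ρ : Fin 3 → ℤ → ℝ) (k : ℤ) (x : ℤ × ℤ) : ℝ :=
  propagator m t ((x.1 : ℝ) ^ 2 + (x.2 : ℝ) ^ 2 + ((-x.1 - x.2 - k : ℤ) : ℝ) ^ 2 + (k : ℝ) ^ 2) *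
    (ρ 0 x.1 * ρ 1 x.2 * ρ 2 (-x.1 - x.2 - k))

lemma lineKernel_insertNth (c : Fin 4) (k : ℤ) (a : Fin 3 → ℤ) :
    lineKernel m t (c.insertNth k a) =
      if k + (a 0 + a 1 + a 2) = 0 then
        propagator m t ((k : ℝ) ^ 2 + ((a 0 : ℝ) ^ 2 + (a 1 : ℝ) ^ 2 + (a 2 : ℝ) ^ 2)) else 0 := by
  rw [lineKernel, Fin.sum_univ_succAbove _ c, Fin.sum_univ_succAbove _ c]
  simp only [Fin.insertNth_apply_same, Fin.insertNth_apply_succAbove, Fin.sum_univ_three]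

/-- On the support of the kernel, one of the momenta of the internal faces is a function of the
other two. -/
lemma lineKernel_embed (c : Fin 4) (k : ℤ) :
    Function.Injective (fun x : ℤ × ℤ => (![x.1, x.2, -x.1 - x.2 - k] : Fin 3 → ℤ)) ∧
    (Function.support fun a : Fin 3 → ℤ => lineKernel m t (c.insertNth k a) * ∏ i, ρ i (a i)) ⊆
      Set.range (fun x : ℤ × ℤ => (![x.1, x.2, -x.1 - x.2 - k] : Fin 3 → ℤ)) ∧
    (fun a : Fin 3 → ℤ => lineKernel m t (c.insertNth k a) * ∏ i, ρ i (a i)) ∘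
      (fun x : ℤ × ℤ => (![x.1, x.2, -x.1 - x.2 - k] : Fin 3 → ℤ)) = dipoleTerm m t ρ k := by
  refine ⟨?_, ?_, ?_⟩
  · rintro ⟨a, b⟩ ⟨a', b'⟩ h
    have h0 := congrFun h 0
    have h1 := congrFun h 1
    simp only [Matrix.cons_val_zero, Matrix.cons_val_one] at h0 h1
    rw [h0, h1]
  · intro a ha
    rw [Function.mem_support, lineKernel_insertNth] at ha
    have h : k + (a 0 + a 1 + a 2) = 0 := by
      by_contra h
      rw [if_neg h, zero_mul] at ha
      exact ha rfl
    refine ⟨(a 0, a 1), ?_⟩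
    funext i
    fin_cases i
    · rfl
    · rfl
    · simp; omega
  · funext x
    simp only [Function.comp_apply, lineKernel_insertNth, Fin.prod_univ_three, dipoleTerm]
    rw [if_pos (by simp; ring)]
    simp only [Matrix.cons_val_zero, Matrix.cons_val_one, Matrix.cons_val]
    congr 2
    ring

lemma tsum_lineKernel (c : Fin 4) (k : ℤ) :
    ∑' a : Fin 3 → ℤ, lineKernel m t (c.insertNth k a) * ∏ i, ρ i (a i) =
      ∑' x, dipoleTerm m t ρ k x := by
  obtain ⟨h1, h2, h3⟩ := lineKernel_embed (m := m) (t := t) (ρ := ρ) c k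
  rw [← h1.tsum_eq h2]
  exact tsum_congr fun x => congrFun h3 x

lemma summable_lineKernel (c : Fin 4) (k : ℤ) (h : Summable (dipoleTerm m t ρ k)) :
    Summable fun a : Fin 3 → ℤ => lineKernel m t (c.insertNth k a) * ∏ i, ρ i (a i) := by
  obtain ⟨h1, h2, h3⟩ := lineKernel_embed (m := m) (t := t) (ρ := ρ) c k
  rw [← h1.summable_iff, h3]
  · exact h
  · intro a ha
    by_contra hne
    exact ha (h2 hne)

/-- The size of the momenta of a dipole. -/
noncomputable def dipoleSize (k : ℤ) (x : ℤ × ℤ) : ℝ :=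
  1 + |(x.1 : ℝ)| + |(x.2 : ℝ)| + |(k : ℝ)|

lemma one_le_dipoleSize (k : ℤ) (x : ℤ × ℤ) : 1 ≤ dipoleSize k x := by
  unfold dipoleSize
  linarith [abs_nonneg (x.1 : ℝ), abs_nonneg (x.2 : ℝ), abs_nonneg (k : ℝ)]

lemma bracket_le_dipoleSize (k : ℤ) (x : ℤ × ℤ) : bracket x.1 ≤ dipoleSize k x ∧
    bracket x.2 ≤ dipoleSize k x ∧ bracket k ≤ dipoleSize k x ∧
    bracket (-x.1 - x.2 - k) ≤ dipoleSize k x ∧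
    bracket (-x.1 - x.2 - k - 1) ≤ 2 * dipoleSize k x := by
  unfold dipoleSize bracket
  have h1 := abs_nonneg (x.1 : ℝ)
  have h2 := abs_nonneg (x.2 : ℝ)
  have h3 := abs_nonneg (k : ℝ)
  refine ⟨by linarith, by linarith, by linarith, ?_, ?_⟩
  · push_cast
    have : |-(x.1 : ℝ) - x.2 - k| ≤ |(x.1 : ℝ)| + |(x.2 : ℝ)| + |(k : ℝ)| := by
      rw [abs_le]
      constructor <;>
      linarith [neg_abs_le (x.1 : ℝ), neg_abs_le (x.2 : ℝ), neg_abs_le (k : ℝ),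
        le_abs_self (x.1 : ℝ), le_abs_self (x.2 : ℝ), le_abs_self (k : ℝ)]
    linarith
  · push_cast
    have : |-(x.1 : ℝ) - x.2 - k - 1| ≤ |(x.1 : ℝ)| + |(x.2 : ℝ)| + |(k : ℝ)| + 1 := by
      rw [abs_le]
      constructor <;>
      linarith [neg_abs_le (x.1 : ℝ), neg_abs_le (x.2 : ℝ), neg_abs_le (k : ℝ),
        le_abs_self (x.1 : ℝ), le_abs_self (x.2 : ℝ), le_abs_self (k : ℝ)]
    linarith

lemma dipoleSize_sq_le (k : ℤ) (x : ℤ × ℤ) (c : ℝ) :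
    min 1 (m ^ 2) / 4 * dipoleSize k x ^ 2 ≤
      m ^ 2 + ((x.1 : ℝ) ^ 2 + (x.2 : ℝ) ^ 2 + c ^ 2 + (k : ℝ) ^ 2) := by
  have h1 : dipoleSize k x ^ 2 ≤ 4 * (1 + ((x.1 : ℝ) ^ 2 + (x.2 : ℝ) ^ 2 + (k : ℝ) ^ 2)) := by
    unfold dipoleSize
    rw [← sq_abs (x.1 : ℝ), ← sq_abs (x.2 : ℝ), ← sq_abs (k : ℝ)]
    nlinarith [sq_nonneg (1 - |(x.1 : ℝ)|), sq_nonneg (1 - |(x.2 : ℝ)|), sq_nonneg (1 - |(k : ℝ)|),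
      sq_nonneg (|(x.1 : ℝ)| - |(x.2 : ℝ)|), sq_nonneg (|(x.1 : ℝ)| - |(k : ℝ)|),
      sq_nonneg (|(x.2 : ℝ)| - |(k : ℝ)|)]
  have h0 : 0 ≤ min 1 (m ^ 2) := le_min zero_le_one (sq_nonneg m)
  have h2 := min_le_left 1 (m ^ 2)
  have h3 := min_le_right 1 (m ^ 2)
  have hs : 0 ≤ (x.1 : ℝ) ^ 2 + (x.2 : ℝ) ^ 2 + (k : ℝ) ^ 2 := by positivity
  have h4 := mul_le_mul_of_nonneg_left h1 h0
  have h5 := mul_le_mul_of_nonneg_right h2 hs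
  nlinarith [sq_nonneg c]

lemma abs_dipole_weights_le {ε A : ℝ} (hε : 0 ≤ ε) (hρ : ∀ i, SlowlyVarying ε A (ρ i)) (k : ℤ)
    (x : ℤ × ℤ) : |ρ 0 x.1 * ρ 1 x.2| ≤ A ^ 2 * dipoleSize k x ^ (2 * ε) ∧
      |ρ 2 (-x.1 - x.2 - k)| ≤ A * dipoleSize k x ^ ε := by
  obtain ⟨h1, h2, -, h4, -⟩ := bracket_le_dipoleSize k x
  have hQ : 0 < dipoleSize k x := zero_lt_one.trans_le (one_le_dipoleSize k x)
  have hA := (hρ 0).nonneg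
  have key : ∀ i n, bracket n ≤ dipoleSize k x → |ρ i n| ≤ A * dipoleSize k x ^ ε :=
    fun i n hn => ((hρ i).bound n).trans (mul_le_mul_of_nonneg_left
      (Real.rpow_le_rpow (bracket_pos n).le hn hε) hA)
  refine ⟨?_, key 2 _ h4⟩
  rw [abs_mul, two_mul ε, Real.rpow_add hQ]
  calc |ρ 0 x.1| * |ρ 1 x.2| ≤ (A * dipoleSize k x ^ ε) * (A * dipoleSize k x ^ ε) :=
        mul_le_mul (key 0 _ h1) (key 1 _ h2) (abs_nonneg _) (by positivity)
    _ = _ := by ring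

/-- With a cutoff, the sums in the dipole converge. -/
lemma summable_dipoleTerm (hm : m ≠ 0) (ht : 0 < t) {ε A : ℝ} (hε : 0 ≤ ε) (hε1 : 3 * ε ≤ 1)
    (hρ : ∀ i, SlowlyVarying ε A (ρ i)) (k : ℤ) : Summable (dipoleTerm m t ρ k) := by
  set κ := min 1 (m ^ 2) / 4 with hκ
  have hκ0 : 0 < κ := by
    have : 0 < min 1 (m ^ 2) := lt_min one_pos (by positivity)
    positivity
  have hA := (hρ 0).nonneg
  refine Summable.of_norm_bounded
    (g := fun x : ℤ × ℤ => t⁻¹ / κ ^ 2 * A ^ 3 *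
      (bracket x.1 ^ (-(3 / 2 : ℝ)) * bracket x.2 ^ (-(3 / 2 : ℝ))))
    ((summable_bracket_mul (by norm_num)).mul_left _) ?_
  intro x
  have hQ1 := one_le_dipoleSize k x
  have hQ : 0 < dipoleSize k x := by linarith
  obtain ⟨hw1, hw2⟩ := abs_dipole_weights_le hε hρ k x
  obtain ⟨h1, h2, -⟩ := bracket_le_dipoleSize k x
  have hs := dipoleSize_sq_le (m := m) k x ((-x.1 - x.2 - k : ℤ) : ℝ)
  rw [← hκ] at hs
  set s := (x.1 : ℝ) ^ 2 + (x.2 : ℝ) ^ 2 + ((-x.1 - x.2 - k : ℤ) : ℝ) ^ 2 + (k : ℝ) ^ 2 with hsdef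
  have hs0 : 0 ≤ s := by positivity
  have hP : propagator m t s ≤ t⁻¹ / κ ^ 2 * dipoleSize k x ^ (-4 : ℝ) := by
    refine (propagator_le_sq hm ht hs0).trans ?_
    have e : t⁻¹ / κ ^ 2 * dipoleSize k x ^ (-4 : ℝ) = t⁻¹ / (κ * dipoleSize k x ^ 2) ^ 2 := by
      rw [Real.rpow_neg hQ.le]
      have : dipoleSize k x ^ (4 : ℝ) = dipoleSize k x ^ (4 : ℕ) := by
        rw [← Real.rpow_natCast]; norm_num
      rw [this]; field_simp
    rw [e]
    gcongr
  rw [Real.norm_eq_abs, dipoleTerm, abs_mul, abs_mul, abs_of_nonneg (propagator_nonneg s hs0)]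
  calc propagator m t s * (|ρ 0 x.1 * ρ 1 x.2| * |ρ 2 (-x.1 - x.2 - k)|)
      ≤ (t⁻¹ / κ ^ 2 * dipoleSize k x ^ (-4 : ℝ)) *
          ((A ^ 2 * dipoleSize k x ^ (2 * ε)) * (A * dipoleSize k x ^ ε)) := by
        gcongr
    _ = t⁻¹ / κ ^ 2 * A ^ 3 * dipoleSize k x ^ (-4 + 2 * ε + ε) := by
        rw [Real.rpow_add hQ, Real.rpow_add hQ]; ring
    _ ≤ t⁻¹ / κ ^ 2 * A ^ 3 * dipoleSize k x ^ (-(3 / 2 : ℝ) + -(3 / 2 : ℝ)) := by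
        exact mul_le_mul_of_nonneg_left
          (Real.rpow_le_rpow_of_exponent_le hQ1 (by linarith)) (by positivity)
    _ ≤ _ := by
        rw [Real.rpow_add hQ]
        refine mul_le_mul_of_nonneg_left ?_ (by positivity)
        refine mul_le_mul ?_ ?_ (Real.rpow_nonneg hQ.le _) (Real.rpow_nonneg (bracket_pos _).le _)
        · exact Real.rpow_le_rpow_of_nonpos (bracket_pos _) h1 (by norm_num)
        · exact Real.rpow_le_rpow_of_nonpos (bracket_pos _) h2 (by norm_num)

/-- The bookkeeping of exponents in the estimate of a dipole. -/
lemma dipole_powers_le {A κ ε Q b₁ b₂ k d : ℝ} (hA : 0 ≤ A) (hκ0 : 0 < κ) (hκ1 : κ ≤ 1 / 4)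
    (hε : 0 ≤ ε) (hε1 : 5 * ε ≤ 1) (hQ : 0 < Q) (h1 : 0 < b₁) (h2 : 0 < b₂) (hk : 0 < k)
    (hd : 0 < d) (hb1 : b₁ ≤ Q) (hb2 : b₂ ≤ Q) (hb3 : k ≤ Q) (hb5 : d ≤ 2 * Q) :
    (A ^ 2 * Q ^ (2 * ε)) * ((192 / κ ^ 2 * Q ^ (-3 : ℝ)) * (A * Q ^ ε) +
        (4 / κ * Q ^ (-2 : ℝ)) * (A * d ^ (ε - 1))) ≤
      (256 / κ ^ 2 * A ^ 3 * k ^ (5 * ε - 1)) *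
        (b₁ ^ (-(1 + ε)) * b₂ ^ (-(1 + ε)) + b₁ ^ (-(1 + ε)) * d ^ (-(1 + ε))) := by
  have hQk : Q ^ (5 * ε - 1) ≤ k ^ (5 * ε - 1) :=
    Real.rpow_le_rpow_of_nonpos hk hb3 (by linarith)
  have hQ1' : Q ^ (-(1 + ε)) ≤ b₁ ^ (-(1 + ε)) :=
    Real.rpow_le_rpow_of_nonpos h1 hb1 (by linarith)
  have hQ2' : Q ^ (-(1 + ε)) ≤ b₂ ^ (-(1 + ε)) :=
    Real.rpow_le_rpow_of_nonpos h2 hb2 (by linarith)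
  have hQd : Q ^ (-(2 * ε)) ≤ 2 * d ^ (-(2 * ε)) := by
    have h1 : (2 * Q) ^ (-(2 * ε)) ≤ d ^ (-(2 * ε)) :=
      Real.rpow_le_rpow_of_nonpos hd hb5 (by linarith)
    rw [Real.mul_rpow (by norm_num) hQ.le] at h1
    have h2 : (2 : ℝ)⁻¹ ≤ 2 ^ (-(2 * ε)) := by
      rw [← Real.rpow_neg_one]
      exact Real.rpow_le_rpow_of_exponent_le (by norm_num) (by linarith)
    have h3 := mul_le_mul_of_nonneg_right h2 (Real.rpow_nonneg hQ.le (-(2 * ε)))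
    linarith
  have p1 : Q ^ (2 * ε) * Q ^ (-3 : ℝ) * Q ^ ε =
      Q ^ (5 * ε - 1) * (Q ^ (-(1 + ε)) * Q ^ (-(1 + ε))) := by
    rw [← Real.rpow_add hQ, ← Real.rpow_add hQ, ← Real.rpow_add hQ, ← Real.rpow_add hQ]
    ring_nf
  have p2 : Q ^ (2 * ε) * Q ^ (-2 : ℝ) =
      Q ^ (5 * ε - 1) * (Q ^ (-(1 + ε)) * Q ^ (-(2 * ε))) := by
    rw [← Real.rpow_add hQ, ← Real.rpow_add hQ, ← Real.rpow_add hQ]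
    ring_nf
  have p3 : d ^ (-(2 * ε)) * d ^ (ε - 1) = d ^ (-(1 + ε)) := by
    rw [← Real.rpow_add hd]; ring_nf
  have q0 := Real.rpow_nonneg hQ.le (5 * ε - 1)
  have q1 := Real.rpow_nonneg hQ.le (-(1 + ε))
  have q2 := Real.rpow_nonneg hQ.le (-(2 * ε))
  have r1 := Real.rpow_nonneg h1.le (-(1 + ε))
  have r2 := Real.rpow_nonneg h2.le (-(1 + ε))
  have r3 := Real.rpow_nonneg hk.le (5 * ε - 1)
  have r4 := Real.rpow_nonneg hd.le (ε - 1)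
  have r5 := Real.rpow_nonneg hd.le (-(1 + ε))
  have s1 : Q ^ (5 * ε - 1) * (Q ^ (-(1 + ε)) * Q ^ (-(1 + ε))) ≤
      k ^ (5 * ε - 1) * (b₁ ^ (-(1 + ε)) * b₂ ^ (-(1 + ε))) :=
    mul_le_mul hQk (mul_le_mul hQ1' hQ2' q1 r1) (mul_nonneg q1 q1) r3
  have s2 : Q ^ (5 * ε - 1) * (Q ^ (-(1 + ε)) * Q ^ (-(2 * ε))) * d ^ (ε - 1) ≤
      2 * (k ^ (5 * ε - 1) * (b₁ ^ (-(1 + ε)) * d ^ (-(1 + ε)))) := by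
    calc _ ≤ k ^ (5 * ε - 1) * (b₁ ^ (-(1 + ε)) * (2 * d ^ (-(2 * ε)))) * d ^ (ε - 1) :=
          mul_le_mul_of_nonneg_right (mul_le_mul hQk (mul_le_mul hQ1' hQd q2 r1)
            (mul_nonneg q1 q2) r3) r4
      _ = 2 * (k ^ (5 * ε - 1) * (b₁ ^ (-(1 + ε)) * (d ^ (-(2 * ε)) * d ^ (ε - 1)))) := by ring
      _ = _ := by rw [p3]
  have c1 : 192 / κ ^ 2 ≤ 256 / κ ^ 2 := by gcongr; norm_num
  have c2 : 4 / κ * 2 ≤ 256 / κ ^ 2 := by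
    rw [div_mul_eq_mul_div, div_le_div_iff₀ hκ0 (by positivity)]
    nlinarith
  have hA3 : 0 ≤ A ^ 3 := pow_nonneg hA 3
  calc _ = 192 / κ ^ 2 * A ^ 3 * (Q ^ (2 * ε) * Q ^ (-3 : ℝ) * Q ^ ε) +
        4 / κ * A ^ 3 * ((Q ^ (2 * ε) * Q ^ (-2 : ℝ)) * d ^ (ε - 1)) := by
        generalize Q ^ (2 * ε) = u1
        generalize Q ^ (-3 : ℝ) = u2
        generalize Q ^ (-2 : ℝ) = u3
        generalize Q ^ ε = u4
        generalize d ^ (ε - 1) = u5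
        ring
    _ ≤ 192 / κ ^ 2 * A ^ 3 * (k ^ (5 * ε - 1) * (b₁ ^ (-(1 + ε)) * b₂ ^ (-(1 + ε)))) +
        4 / κ * A ^ 3 * (2 * (k ^ (5 * ε - 1) * (b₁ ^ (-(1 + ε)) * d ^ (-(1 + ε))))) := by
        rw [p1, p2]
        exact add_le_add (mul_le_mul_of_nonneg_left s1 (by positivity))
          (mul_le_mul_of_nonneg_left s2 (by positivity))
    _ = 192 / κ ^ 2 * (A ^ 3 * (k ^ (5 * ε - 1) * (b₁ ^ (-(1 + ε)) * b₂ ^ (-(1 + ε))))) +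
        4 / κ * 2 * (A ^ 3 * (k ^ (5 * ε - 1) * (b₁ ^ (-(1 + ε)) * d ^ (-(1 + ε))))) := by
        generalize k ^ (5 * ε - 1) = u1
        generalize b₁ ^ (-(1 + ε)) = u2
        generalize b₂ ^ (-(1 + ε)) = u3
        generalize d ^ (-(1 + ε)) = u4
        ring
    _ ≤ 256 / κ ^ 2 * (A ^ 3 * (k ^ (5 * ε - 1) * (b₁ ^ (-(1 + ε)) * b₂ ^ (-(1 + ε))))) +
        256 / κ ^ 2 * (A ^ 3 * (k ^ (5 * ε - 1) * (b₁ ^ (-(1 + ε)) * d ^ (-(1 + ε))))) :=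
        add_le_add (mul_le_mul_of_nonneg_right c1 (by positivity))
          (mul_le_mul_of_nonneg_right c2 (by positivity))
    _ = _ := by
        generalize k ^ (5 * ε - 1) = u1
        generalize b₁ ^ (-(1 + ε)) = u2
        generalize b₂ ^ (-(1 + ε)) = u3
        generalize d ^ (-(1 + ε)) = u4
        ring

/-- The variation of the summand of the dipole with the external momentum is summable without
cutoff: one power of the momenta is gained. -/
lemma abs_dipoleTerm_sub_le (hm : m ≠ 0) (ht : 0 ≤ t) {ε A : ℝ} (hε : 0 ≤ ε) (hε1 : 5 * ε ≤ 1)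
    (hρ : ∀ i, SlowlyVarying ε A (ρ i)) (k : ℤ) (x : ℤ × ℤ) :
    |dipoleTerm m t ρ (k + 1) x - dipoleTerm m t ρ k x| ≤
      (256 / (min 1 (m ^ 2) / 4) ^ 2 * A ^ 3 * bracket k ^ (5 * ε - 1)) *
        (bracket x.1 ^ (-(1 + ε)) * bracket x.2 ^ (-(1 + ε)) +
          bracket x.1 ^ (-(1 + ε)) * bracket (-x.1 - x.2 - k - 1) ^ (-(1 + ε))) := by
  set κ := min 1 (m ^ 2) / 4 with hκ
  have hκ0 : 0 < κ := by
    have : 0 < min 1 (m ^ 2) := lt_min one_pos (by positivity)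
    positivity
  have hκ1 : κ ≤ 1 / 4 := by rw [hκ]; linarith [min_le_left 1 (m ^ 2)]
  have hA := (hρ 0).nonneg
  have hQ1 := one_le_dipoleSize k x
  set Q := dipoleSize k x with hQdef
  have hQ : 0 < Q := by linarith
  obtain ⟨hw1, hw2⟩ := abs_dipole_weights_le hε hρ k x
  obtain ⟨hb1, hb2, hb3, hb4, hb5⟩ := bracket_le_dipoleSize k x
  rw [← hQdef] at hw1 hw2 hb1 hb2 hb3 hb4 hb5
  have hs := dipoleSize_sq_le (m := m) k x ((-x.1 - x.2 - k : ℤ) : ℝ)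
  have hs' := dipoleSize_sq_le (m := m) (k + 1) x ((-x.1 - x.2 - (k + 1) : ℤ) : ℝ)
  rw [← hκ] at hs hs'
  set s := (x.1 : ℝ) ^ 2 + (x.2 : ℝ) ^ 2 + ((-x.1 - x.2 - k : ℤ) : ℝ) ^ 2 + (k : ℝ) ^ 2 with hsdef
  set s' := (x.1 : ℝ) ^ 2 + (x.2 : ℝ) ^ 2 + ((-x.1 - x.2 - (k + 1) : ℤ) : ℝ) ^ 2 +
    ((k + 1 : ℤ) : ℝ) ^ 2 with hsdef'
  have hs0 : 0 ≤ s := by positivity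
  have hs0' : 0 ≤ s' := by positivity
  have hQQ : Q ≤ 2 * dipoleSize (k + 1) x := by
    have h := bracket_le_add_one k
    simp only [hQdef, dipoleSize, bracket] at h ⊢
    linarith [abs_nonneg (x.1 : ℝ), abs_nonneg (x.2 : ℝ)]
  have hy : 0 < κ / 4 * Q ^ 2 := by positivity
  have hy1 : κ / 4 * Q ^ 2 ≤ m ^ 2 + s := by nlinarith [sq_nonneg Q]
  have hy2 : κ / 4 * Q ^ 2 ≤ m ^ 2 + s' := by
    refine le_trans ?_ hs'
    have : Q ^ 2 ≤ (2 * dipoleSize (k + 1) x) ^ 2 := by gcongr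
    nlinarith
  have hcQ : |((-x.1 - x.2 - k : ℤ) : ℝ)| ≤ Q := by
    have := hb4; unfold bracket at this; linarith
  have hkQ : |(k : ℝ)| ≤ Q := by
    have := hb3; unfold bracket at this; linarith
  have hds : |s' - s| ≤ 6 * Q := by
    have e : s' - s = 2 * (k : ℝ) + 2 - 2 * ((-x.1 - x.2 - k : ℤ) : ℝ) := by
      rw [hsdef, hsdef']; push_cast; ring
    rw [e, abs_le]
    constructor <;> linarith [neg_abs_le (k : ℝ), le_abs_self (k : ℝ),
      neg_abs_le ((-x.1 - x.2 - k : ℤ) : ℝ), le_abs_self ((-x.1 - x.2 - k : ℤ) : ℝ)]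
  have hdP : |propagator m t s' - propagator m t s| ≤ 192 / κ ^ 2 * Q ^ (-3 : ℝ) := by
    refine (abs_propagator_sub_le hm ht hs0' hs0 hy hy2 hy1).trans ?_
    have e : 192 / κ ^ 2 * Q ^ (-3 : ℝ) = 2 * (6 * Q) / (κ / 4 * Q ^ 2) ^ 2 := by
      rw [Real.rpow_neg hQ.le]
      have : Q ^ (3 : ℝ) = Q ^ (3 : ℕ) := by rw [← Real.rpow_natCast]; norm_num
      rw [this]; field_simp; norm_num
    rw [e]
    gcongr
  have hP : propagator m t s' ≤ 4 / κ * Q ^ (-2 : ℝ) := by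
    refine (propagator_le hm ht hs0').trans ?_
    have e : 4 / κ * Q ^ (-2 : ℝ) = 1 / (κ / 4 * Q ^ 2) := by
      rw [Real.rpow_neg hQ.le]
      have : Q ^ (2 : ℝ) = Q ^ (2 : ℕ) := by rw [← Real.rpow_natCast]; norm_num
      rw [this]; field_simp
    rw [e]
    gcongr
  -- the last weight varies by a power of the third internal momentum
  have hdρ : |ρ 2 (-x.1 - x.2 - (k + 1)) - ρ 2 (-x.1 - x.2 - k)| ≤
      A * bracket (-x.1 - x.2 - k - 1) ^ (ε - 1) := by
    have := (hρ 2).diff (-x.1 - x.2 - k - 1)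
    rw [sub_add_cancel] at this
    rw [abs_sub_comm, show -x.1 - x.2 - (k + 1) = -x.1 - x.2 - k - 1 by ring]
    exact this
  set d := -x.1 - x.2 - k - 1 with hd
  have e1 : dipoleTerm m t ρ (k + 1) x - dipoleTerm m t ρ k x =
      (ρ 0 x.1 * ρ 1 x.2) * ((propagator m t s' - propagator m t s) * ρ 2 (-x.1 - x.2 - k) +
        propagator m t s' * (ρ 2 (-x.1 - x.2 - (k + 1)) - ρ 2 (-x.1 - x.2 - k))) := by
    simp only [dipoleTerm, ← hsdef, ← hsdef']; ring
  rw [e1, abs_mul]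
  have hmul : |(propagator m t s' - propagator m t s) * ρ 2 (-x.1 - x.2 - k) +
        propagator m t s' * (ρ 2 (-x.1 - x.2 - (k + 1)) - ρ 2 (-x.1 - x.2 - k))| ≤
      (192 / κ ^ 2 * Q ^ (-3 : ℝ)) * (A * Q ^ ε) +
        (4 / κ * Q ^ (-2 : ℝ)) * (A * bracket d ^ (ε - 1)) := by
    refine (abs_add_le _ _).trans ?_
    rw [abs_mul, abs_mul, abs_of_nonneg (propagator_nonneg s' hs0')]
    refine add_le_add (mul_le_mul hdP hw2 (abs_nonneg _) ?_)
      (mul_le_mul hP hdρ (abs_nonneg _) ?_)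
    · exact mul_nonneg (by positivity) (Real.rpow_nonneg hQ.le _)
    · exact mul_nonneg (by positivity) (Real.rpow_nonneg hQ.le _)
  refine (mul_le_mul hw1 hmul (abs_nonneg _)
    (mul_nonneg (sq_nonneg A) (Real.rpow_nonneg hQ.le _))).trans ?_
  exact dipole_powers_le hA hκ0 hκ1 hε hε1 hQ (bracket_pos _) (bracket_pos _) (bracket_pos _)
    (bracket_pos _) hb1 hb2 hb3 hb5

/-- The renormalized dipole with slowly varying weights on its internal faces is again slowly
varying, uniformly in the cutoff: subtraction at zero momentum turns the logarithmic divergence into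
the summable variation of the summand. -/
lemma slowlyVarying_dipole (hm : m ≠ 0) (ht : 0 < t) {ε A : ℝ} (hε : 0 < ε) (hε1 : 5 * ε ≤ 1)
    (hρ : ∀ i, SlowlyVarying ε A (ρ i)) (c : Fin 4) :
    SlowlyVarying (5 * ε) (2 / (5 * ε) *
      (512 / (min 1 (m ^ 2) / 4) ^ 2 * bracketSum (1 + ε) ^ 2 * A ^ 3)) (dipole m t ρ c) := by
  have hA := (hρ 0).nonneg
  have hsum := fun k => summable_dipoleTerm hm ht hε.le (by linarith) hρ k
  have hdip : ∀ k, dipole m t ρ c k = ∑' x, dipoleTerm m t ρ k x - ∑' x, dipoleTerm m t ρ 0 x := by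
    intro k
    rw [← tsum_lineKernel c k, ← tsum_lineKernel c 0, ← (summable_lineKernel c k (hsum k)).tsum_sub
      (summable_lineKernel c 0 (hsum 0)), dipole]
    exact tsum_congr fun a => by ring
  refine SlowlyVarying.of_diff (by linarith) hε1 (by positivity) (by rw [hdip, sub_self]) ?_
  intro k
  have hb : (1 : ℝ) < 1 + ε := by linarith
  have hs1 := summable_bracket_mul hb
  let σ : ℤ × ℤ ≃ ℤ × ℤ :=
    { toFun := fun x => (x.1, -x.1 - x.2 - k - 1)
      invFun := fun x => (x.1, -x.1 - x.2 - k - 1)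
      left_inv := fun x => Prod.ext rfl (by simp only; ring)
      right_inv := fun x => Prod.ext rfl (by simp only; ring) }
  have hs2 : Summable fun x : ℤ × ℤ =>
      bracket x.1 ^ (-(1 + ε)) * bracket (-x.1 - x.2 - k - 1) ^ (-(1 + ε)) :=
    (σ.summable_iff (f := fun x : ℤ × ℤ => bracket x.1 ^ (-(1 + ε)) * bracket x.2 ^ (-(1 + ε)))).2 hs1
  have ht2 : ∑' x : ℤ × ℤ, bracket x.1 ^ (-(1 + ε)) * bracket (-x.1 - x.2 - k - 1) ^ (-(1 + ε)) =
      bracketSum (1 + ε) ^ 2 := by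
    rw [← tsum_bracket_mul hb]
    exact σ.tsum_eq fun x : ℤ × ℤ => bracket x.1 ^ (-(1 + ε)) * bracket x.2 ^ (-(1 + ε))
  rw [hdip, hdip, sub_sub_sub_cancel_right, ← (hsum _).tsum_sub (hsum _)]
  have hbd := tsum_of_norm_bounded
    (f := fun x => dipoleTerm m t ρ (k + 1) x - dipoleTerm m t ρ k x) ((hs1.add hs2).mul_left
    (256 / (min 1 (m ^ 2) / 4) ^ 2 * A ^ 3 * bracket k ^ (5 * ε - 1))).hasSum
    fun x => (Real.norm_eq_abs _).trans_le (abs_dipoleTerm_sub_le hm ht.le hε.le hε1 hρ k x)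
  rw [tsum_mul_left, hs1.tsum_add hs2, tsum_bracket_mul hb, ht2] at hbd
  rw [← Real.norm_eq_abs]
  refine hbd.trans (le_of_eq ?_)
  ring

end Dipole

/-! ### Resummation of the melonic lines -/

namespace FeynmanGraph

variable {G : FeynmanGraph}

lemma whiteMom_update (x : G.Momenta) (l : G.Line) (v : Fin 4 → ℤ) (c : Fin 4) (w : G.White) :
    whiteMom ((Function.update x.1 l v, x.2) : G.Momenta) c w =
      if w = G.whiteEnd l then v c else whiteMom x c w := by
  rcases white_cases w with ⟨e, rfl⟩ | ⟨u, rfl⟩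
  · rw [whiteMom_whiteEnd, whiteMom_whiteEnd]
    by_cases h : e = l
    · subst h; simp
    · rw [if_neg fun h' => h (G.whiteEnd.injective h')]
      simp [Function.update_of_ne h]
  · rw [whiteMom_leg, whiteMom_leg, if_neg fun h => u.2 l h.symm]

lemma blackMom_update (x : G.Momenta) (l : G.Line) (v : Fin 4 → ℤ) (c : Fin 4) (b : G.Black) :
    blackMom ((Function.update x.1 l v, x.2) : G.Momenta) c b =
      if b = G.blackEnd l then v c else blackMom x c b := by
  rcases black_cases b with ⟨e, rfl⟩ | ⟨u, rfl⟩
  · rw [blackMom_blackEnd, blackMom_blackEnd]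
    by_cases h : e = l
    · subst h; simp
    · rw [if_neg fun h' => h (G.blackEnd.injective h')]
      simp [Function.update_of_ne h]
  · rw [blackMom_leg, blackMom_leg, if_neg fun h => u.2 l h.symm]

/-- The white node from which the face that stays open enters the line `l`. -/
noncomputable def entrance (S : Finset G.Line) (l : G.Line) : G.White :=
  (G.contractSet S (G.freeColor l)).symm (G.blackEnd l)

/-- Momenta before the contraction of a dipole, from the momenta after it and the momenta of the
three internal faces of the dipole. -/
noncomputable def extend (S : Finset G.Line) (l : G.Line) (x : G.Momenta) (a : Fin 3 → ℤ) :
    G.Momenta :=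
  (Function.update x.1 l ((G.freeColor l).insertNth
    (whiteMom x (G.freeColor l) (entrance S l)) a), x.2)

section Step

variable {S : Finset G.Line} {l : G.Line}

lemma contractSet_entrance : G.contractSet S (G.freeColor l) (entrance S l) = G.blackEnd l :=
  Equiv.apply_symm_apply _ _

lemma entrance_ne (hj : ∀ c, c ∈ G.joined (G.contractSet S) l ↔ c ≠ G.freeColor l) :
    entrance S l ≠ G.whiteEnd l := by
  intro h
  have := contractSet_entrance (S := S) (l := l)
  rw [h, ← mem_joined, hj] at this
  exact this rfl

lemma entrance_notMem (hl : l ∉ S) {e : G.Line} (he : e ∈ S) : entrance S l ≠ G.whiteEnd e := by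
  intro h
  have := contractSet_entrance (S := S) (l := l)
  rw [h, G.contractSet_whiteEnd he] at this
  exact hl (G.blackEnd.injective this ▸ he)

/-- Contraction of a dipole splits off the momenta of its three internal faces. -/
lemma extend_bijective (hl : l ∉ S)
    (hj : ∀ c, c ∈ G.joined (G.contractSet S) l ↔ c ≠ G.freeColor l) :
    (∀ x ∈ G.solutions (insert l S), ∀ a, extend S l x a ∈ G.solutions S) ∧
    ∀ y ∈ G.solutions S, ∃! z : G.Momenta × (Fin 3 → ℤ),
      z.1 ∈ G.solutions (insert l S) ∧ extend S l z.1 z.2 = y := by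
  have hent := contractSet_entrance (S := S) (l := l)
  have hcon : ∀ c, c ≠ G.freeColor l → G.contractSet S c (G.whiteEnd l) = G.blackEnd l :=
    fun c hc => G.mem_joined.1 ((hj c).2 hc)
  set c₀ := G.freeColor l with hc₀
  refine ⟨fun x hx a => ⟨fun e he => ?_, fun c w => ?_⟩, fun y hy => ?_⟩
  · have hel : e ≠ l := fun h => hl (h ▸ he)
    simp only [extend, Function.update_of_ne hel]
    exact hx.1 e (Finset.mem_insert_of_mem he)
  · rw [extend, whiteMom_update, blackMom_update]
    have h2 := hx.2 c w
    rw [contractSet_insert, contractLine_apply] at h2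
    by_cases hw : w = G.whiteEnd l
    · subst hw
      rw [if_pos rfl]
      by_cases hc : c = c₀
      · rw [hc, if_neg fun h => (hj c₀).1 (G.mem_joined.2 h) rfl]
        -- the momentum of the open face is conserved across the contracted line
        have h3 := hx.2 c₀ (entrance S l)
        rw [contractSet_insert, contractLine_apply, hent, Equiv.swap_apply_right] at h3
        rw [Fin.insertNth_apply_same, h3]
      · rw [if_pos (hcon c hc)]
    · rw [if_neg hw]
      have hne : G.contractSet S c w ≠ G.contractSet S c (G.whiteEnd l) :=
        fun h => hw ((G.contractSet S c).injective h)
      by_cases hb : G.contractSet S c w = G.blackEnd l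
      · rw [if_pos hb]
        have hc : c = c₀ := by
          by_contra hc
          exact hne (hb.trans (hcon c hc).symm)
        rw [hc] at hb ⊢
        have : w = entrance S l := by
          rw [entrance, Equiv.eq_symm_apply, ← hc₀, hb]
        rw [Fin.insertNth_apply_same, this]
      · rw [if_neg hb, h2, Equiv.swap_apply_of_ne_of_ne hne hb]
  · set x : G.Momenta := (Function.update y.1 l 0, y.2) with hx
    have hxw : ∀ c w, whiteMom x c w = if w = G.whiteEnd l then 0 else whiteMom y c w :=
      fun c w => whiteMom_update y l 0 c w
    have hxb : ∀ c b, blackMom x c b = if b = G.blackEnd l then 0 else blackMom y c b :=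
      fun c b => blackMom_update y l 0 c b
    have hxm : whiteMom x c₀ (entrance S l) = y.1 l c₀ := by
      rw [hxw, if_neg (entrance_ne hj), hy.2, hent, blackMom_blackEnd]
    refine ⟨(x, fun i => y.1 l (c₀.succAbove i)), ⟨⟨fun e he => ?_, fun c w => ?_⟩, ?_⟩, ?_⟩
    · by_cases h : e = l
      · subst h; simp [hx]
      · simp only [hx, Function.update_of_ne h]
        exact hy.1 e ((Finset.mem_insert.1 he).resolve_left h)
    · rw [hxw, hxb, contractSet_insert, contractLine_apply]
      by_cases hw : w = G.whiteEnd l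
      · subst hw
        simp
      · have hne : G.contractSet S c w ≠ G.contractSet S c (G.whiteEnd l) :=
          fun h => hw ((G.contractSet S c).injective h)
        rw [if_neg hw]
        by_cases hb : G.contractSet S c w = G.blackEnd l
        · rw [hb, Equiv.swap_apply_right, if_neg fun h => hne (hb.trans h.symm), hy.2, hb,
            blackMom_blackEnd, ← hy.2, whiteMom_whiteEnd]
        · rw [Equiv.swap_apply_of_ne_of_ne hne hb, if_neg hb, hy.2]
    · refine Prod.ext ?_ rfl
      simp only [extend]
      rw [← hc₀, hxm]
      have : (c₀.insertNth (y.1 l c₀) fun i => y.1 l (c₀.succAbove i)) = y.1 l :=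
        Fin.insertNth_self_removeNth c₀ (y.1 l)
      rw [this]
      simp [hx]
    · rintro ⟨x', a⟩ ⟨h1, h2⟩
      have hz : x'.1 l = 0 := h1.1 l (Finset.mem_insert_self _ _)
      have hl1 : y.1 l = c₀.insertNth (whiteMom x' c₀ (entrance S l)) a := by
        rw [← h2]; simp [extend, ← hc₀]
      refine Prod.ext (Prod.ext ?_ ?_) ?_
      · simp only [hx, ← h2, extend, Function.update_idem]
        rw [← hz, Function.update_eq_self]
      · simp only [hx, ← h2, extend]
      · funext i
        simp only [hl1, Fin.insertNth_apply_succAbove]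

/-- The equivalence that splits off the momenta of the internal faces of a dipole. -/
noncomputable def extendEquiv (hl : l ∉ S)
    (hj : ∀ c, c ∈ G.joined (G.contractSet S) l ↔ c ≠ G.freeColor l) :
    G.solutions (insert l S) × (Fin 3 → ℤ) ≃ G.solutions S :=
  Equiv.ofBijective (fun z => ⟨extend S l z.1.1 z.2, (extend_bijective hl hj).1 _ z.1.2 _⟩) (by
    constructor
    · rintro ⟨⟨x, hx⟩, a⟩ ⟨⟨x', hx'⟩, a'⟩ h
      have h1 : extend S l x a = extend S l x' a' := congrArg Subtype.val h
      have h2 := ((extend_bijective hl hj).2 (extend S l x a)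
        ((extend_bijective hl hj).1 x hx a)).unique (y₁ := (x, a)) (y₂ := (x', a'))
        ⟨hx, rfl⟩ ⟨hx', h1.symm⟩
      rw [Prod.mk.injEq] at h2
      exact Prod.ext (Subtype.ext h2.1) h2.2
    · rintro ⟨y, hy⟩
      obtain ⟨⟨x, a⟩, ⟨h1, h2⟩, -⟩ := (extend_bijective hl hj).2 y hy
      exact ⟨(⟨x, h1⟩, a), Subtype.ext h2⟩)

end Step

open Classical in
/-- The propagator of a line; for a melonic line, the action of `1 - τ` of the melopole rooted at
the line is included. -/
noncomputable def subtractedKernel (m t : ℝ) (e : G.Line) (N : Fin 4 → ℤ) : ℝ :=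
  if e ∈ G.melonicLines then
    lineKernel m t N - lineKernel m t (Function.update N (G.freeColor e) 0)
  else lineKernel m t N

/-- The summand of the amplitude after the resummation of the lines of `S`, with a weight for each
of the remaining colored lines. -/
noncomputable def weightedTerm (m t : ℝ) (f : (G.ExtLeg × Fin 4 → ℤ) → ℂ) (S : Finset G.Line)
    (ρ : Fin 4 → G.White → ℤ → ℝ) (x : G.Momenta) : ℂ :=
  f x.2 * (((∏ e ∈ Sᶜ, subtractedKernel m t e (x.1 e)) *
    ∏ w ∈ (S.map G.whiteEnd)ᶜ, ∏ c, ρ c w (whiteMom x c w) : ℝ) : ℂ)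

/-- The weights after the resummation of the dipole `l`. -/
noncomputable def newWeight (m t : ℝ) (S : Finset G.Line) (l : G.Line)
    (ρ : Fin 4 → G.White → ℤ → ℝ) (c : Fin 4) (w : G.White) (n : ℤ) : ℝ :=
  ρ c w n * if c = G.freeColor l ∧ w = entrance S l then
    ρ (G.freeColor l) (G.whiteEnd l) n *
      dipole m t (fun i => ρ ((G.freeColor l).succAbove i) (G.whiteEnd l)) (G.freeColor l) n
  else 1

/-- Summation over the internal faces of a dipole turns its propagator and the weights at its white
end into a factor of the weight of the colored line that replaces it. -/
lemma tsum_weightedTerm_extend (m t : ℝ) (f : (G.ExtLeg × Fin 4 → ℤ) → ℂ) {S : Finset G.Line}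
    {l : G.Line} (hl : l ∉ S) (hlT : l ∈ G.melonicLines)
    (hj : ∀ c, c ∈ G.joined (G.contractSet S) l ↔ c ≠ G.freeColor l)
    (ρ : Fin 4 → G.White → ℤ → ℝ) (x : G.Momenta) :
    ∑' a, weightedTerm m t f S ρ (extend S l x a) =
      weightedTerm m t f (insert l S) (newWeight m t S l ρ) x := by
  classical
  set c₀ := G.freeColor l with hc₀
  set k := whiteMom x c₀ (entrance S l) with hk
  have hlines : ∀ a, ∏ e ∈ Sᶜ, subtractedKernel m t e ((extend S l x a).1 e) =
      (lineKernel m t (c₀.insertNth k a) - lineKernel m t (c₀.insertNth 0 a)) *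
        ∏ e ∈ (insert l S)ᶜ, subtractedKernel m t e (x.1 e) := by
    intro a
    rw [Finset.compl_insert, ← Finset.mul_prod_erase Sᶜ _ (Finset.mem_compl.2 hl)]
    congr 1
    · simp only [extend, Function.update_self, subtractedKernel, if_pos hlT]
      rw [← hc₀, ← hk, Fin.update_insertNth]
    · refine Finset.prod_congr rfl fun e he => ?_
      simp only [extend, Function.update_of_ne (Finset.ne_of_mem_erase he)]
  have hwl : G.whiteEnd l ∈ (S.map G.whiteEnd)ᶜ := by
    simpa using hl
  have hweights : ∀ a, ∏ w ∈ (S.map G.whiteEnd)ᶜ, ∏ c, ρ c w (whiteMom (extend S l x a) c w) =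
      (ρ c₀ (G.whiteEnd l) k * ∏ i, ρ (c₀.succAbove i) (G.whiteEnd l) (a i)) *
        ∏ w ∈ ((insert l S).map G.whiteEnd)ᶜ, ∏ c, ρ c w (whiteMom x c w) := by
    intro a
    rw [Finset.map_insert, Finset.compl_insert, ← Finset.mul_prod_erase _ _ hwl]
    congr 1
    · rw [Fin.prod_univ_succAbove _ c₀]
      simp only [extend, whiteMom_update, if_true, ← hc₀, ← hk, Fin.insertNth_apply_same,
        Fin.insertNth_apply_succAbove]
    · refine Finset.prod_congr rfl fun w hw => Finset.prod_congr rfl fun c _ => ?_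
      rw [extend, whiteMom_update, if_neg (Finset.ne_of_mem_erase hw)]
  have hent : entrance S l ∈ ((insert l S).map G.whiteEnd)ᶜ := by
    simp only [Finset.mem_compl, Finset.mem_map, not_exists, not_and]
    intro e he h
    rcases Finset.mem_insert.1 he with rfl | he
    · exact entrance_ne hj h.symm
    · exact entrance_notMem hl he h.symm
  have hnew : ∏ w ∈ ((insert l S).map G.whiteEnd)ᶜ, ∏ c, newWeight m t S l ρ c w (whiteMom x c w) =
      (ρ c₀ (G.whiteEnd l) k *
        dipole m t (fun i => ρ (c₀.succAbove i) (G.whiteEnd l)) c₀ k) *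
        ∏ w ∈ ((insert l S).map G.whiteEnd)ᶜ, ∏ c, ρ c w (whiteMom x c w) := by
    simp only [newWeight, Finset.prod_mul_distrib, ← hc₀]
    rw [mul_comm]
    congr 1
    rw [Finset.prod_eq_single_of_mem _ hent, Finset.prod_eq_single_of_mem c₀ (Finset.mem_univ _)]
    · rw [if_pos ⟨rfl, rfl⟩, ← hk]
    · exact fun c _ hc => if_neg fun h => hc h.1
    · exact fun w _ hw => Finset.prod_eq_one fun c _ => if_neg fun h => hw h.2
  simp only [weightedTerm, hlines, hweights, hnew]
  set P := ∏ e ∈ (insert l S)ᶜ, subtractedKernel m t e (x.1 e)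
  set Q := ∏ w ∈ ((insert l S).map G.whiteEnd)ᶜ, ∏ c, ρ c w (whiteMom x c w)
  have hx2 : ∀ a, (extend S l x a).2 = x.2 := fun a => rfl
  simp only [hx2]
  rw [tsum_mul_left, ← Complex.ofReal_tsum]
  congr 2
  rw [dipole, ← tsum_mul_left, ← tsum_mul_right, ← tsum_mul_left]
  exact tsum_congr fun a => by ring

lemma hasSum_weightedTerm_insert (m t : ℝ) (f : (G.ExtLeg × Fin 4 → ℤ) → ℂ) {S : Finset G.Line}
    {l : G.Line} (hl : l ∉ S) (hlT : l ∈ G.melonicLines)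
    (hj : ∀ c, c ∈ G.joined (G.contractSet S) l ↔ c ≠ G.freeColor l)
    (ρ : Fin 4 → G.White → ℤ → ℝ) {z : ℂ}
    (h : HasSum (fun x : G.solutions S => weightedTerm m t f S ρ x.1) z) :
    HasSum (fun x : G.solutions (insert l S) =>
      weightedTerm m t f (insert l S) (newWeight m t S l ρ) x.1) z := by
  have h1 : HasSum (fun z : G.solutions (insert l S) × (Fin 3 → ℤ) =>
      weightedTerm m t f S ρ (extend S l z.1.1 z.2)) z :=
    (extendEquiv hl hj).hasSum_iff.2 h
  have h2 := h1.prod_fiberwise fun x => (h1.summable.prod_factor x).hasSum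
  have h3 : (fun x : G.solutions (insert l S) =>
      weightedTerm m t f (insert l S) (newWeight m t S l ρ) x.1) =
      fun x => ∑' a, weightedTerm m t f S ρ (extend S l x.1 a) :=
    funext fun x => (tsum_weightedTerm_extend m t f hl hlT hj ρ x.1).symm
  rw [h3]
  exact h2

/-! ### Uniform control of the weights -/

/-- A bound for the weights after the resummation of `n` lines in their bubble. The recursion combines
the constant of `slowlyVarying_dipole` with that of `SlowlyVarying.mul`, which is used twice; each time
the exponent `ε` becomes `ε + (ε + 5 * ε) = 7 * ε`. -/
noncomputable def weightBound (m ε : ℝ) : ℕ → ℝ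
  | 0 => 1
  | n + 1 => max (weightBound m ε n) (3 * (weightBound m ε n * (3 * (weightBound m ε n *
      (2 / (5 * (ε * 7 ^ n)) * (512 / (min 1 (m ^ 2) / 4) ^ 2 *
        bracketSum (1 + ε * 7 ^ n) ^ 2 * weightBound m ε n ^ 3))))))

lemma weightBound_mono (m ε : ℝ) : Monotone (weightBound m ε) :=
  monotone_nat_of_le_succ fun n => by rw [weightBound]; exact le_max_left _ _

lemma one_le_weightBound (m ε : ℝ) (n : ℕ) : 1 ≤ weightBound m ε n :=
  weightBound_mono m ε (Nat.zero_le n)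

lemma touchCount_mono {S S' : Finset G.Line} (h : S ⊆ S') (v : G.White ⊕ G.Black) :
    touchCount S v ≤ touchCount S' v := by
  classical
  exact Finset.card_le_card (Finset.filter_subset_filter _ h)

lemma touchCount_congr (S : Finset G.Line) {v v' : G.White ⊕ G.Black}
    (h : G.bubbleGraph.Reachable v v') : touchCount S v = touchCount S v' := by
  classical
  rw [touchCount, touchCount]
  refine congrArg Finset.card (Finset.filter_congr fun e _ => ?_)
  exact or_congr ⟨h.symm.trans, h.trans⟩ ⟨h.symm.trans, h.trans⟩

lemma pow_rate_mono {ε : ℝ} (hε : 0 ≤ ε) {n n' : ℕ} (h : n ≤ n') : ε * 7 ^ n ≤ ε * 7 ^ n' := by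
  gcongr
  norm_num

/-- All lines of a melonic set can be summed over; the remaining colored lines receive weights that
vary slowly, with a rate controlled by the order of the bubbles. -/
lemma Melonic.exists_weights (hG : G.IsConnected) (hV : ¬ G.IsVacuum) {p : ℕ}
    (hp : G.OrderAtMost p) {m t ε : ℝ} (hm : m ≠ 0) (ht : 0 < t) (hε : 0 < ε)
    (hεp : 5 * (ε * 7 ^ p) ≤ 1) (f : (G.ExtLeg × Fin 4 → ℤ) → ℂ) {z : ℂ}
    (h : HasSum (fun x : G.solutions ∅ => weightedTerm m t f ∅ (fun _ _ _ => 1) x.1) z)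
    {S : Finset G.Line} (hS : G.Melonic S) :
    ∃ ρ : Fin 4 → G.White → ℤ → ℝ,
      (∀ c w, SlowlyVarying (ε * 7 ^ touchCount S (Sum.inl w))
        (weightBound m ε (touchCount S (Sum.inl w))) (ρ c w)) ∧
      HasSum (fun x : G.solutions S => weightedTerm m t f S ρ x.1) z := by
  induction hS with
  | empty => exact ⟨fun _ _ _ => 1, fun c w => slowlyVarying_one (by positivity)
      (one_le_weightBound m ε _), h⟩
  | cons S l hS hl h3 ih =>
    obtain ⟨ρ, h1, h2⟩ := ih
    have hj := hS.mem_joined_iff hG hV hl h3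
    have hlT : l ∈ G.melonicLines :=
      (Melonic.cons S l hS hl h3).subset_melonicLines (Finset.mem_insert_self _ _)
    refine ⟨newWeight m t S l ρ, fun c w => ?_, hasSum_weightedTerm_insert m t f hl hlT hj ρ h2⟩
    by_cases hcw : c = G.freeColor l ∧ w = entrance S l
    · obtain ⟨rfl, rfl⟩ := hcw
      set c₀ := G.freeColor l with hc₀
      have hreach : G.bubbleGraph.Reachable (Sum.inl (entrance S l)) (Sum.inl (G.whiteEnd l)) := by
        obtain ⟨c, hc⟩ : ∃ c, c ∈ G.joined (G.contractSet S) l :=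
          Finset.card_pos.1 (by omega)
        have r1 := hS.reachable.1 c₀ (entrance S l)
        have r2 := hS.reachable.1 c (G.whiteEnd l)
        rw [hc₀, contractSet_entrance] at r1
        rw [G.mem_joined.1 hc] at r2
        exact r1.trans r2.symm
      have e1 : touchCount S (Sum.inl (G.whiteEnd l)) = touchCount S (Sum.inl (entrance S l)) :=
        (touchCount_congr S hreach).symm
      have e2 : touchCount (insert l S) (Sum.inl (entrance S l)) =
          touchCount S (Sum.inl (entrance S l)) + 1 :=
        touchCount_insert hl (Or.inl hreach)
      rw [e2]
      set n := touchCount S (Sum.inl (entrance S l)) with hn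
      have hnp : n ≤ p := touchCount_le hp _ _
      have hε' : 0 < ε * 7 ^ n := by positivity
      have hε1 : 5 * (ε * 7 ^ n) ≤ 1 := by linarith [pow_rate_mono hε.le hnp]
      have hd := slowlyVarying_dipole hm ht hε' hε1
        (ρ := fun i => ρ (c₀.succAbove i) (G.whiteEnd l)) (A := weightBound m ε n)
        (fun i => by have := h1 (c₀.succAbove i) (G.whiteEnd l); rwa [e1] at this) c₀
      have hw := h1 c₀ (G.whiteEnd l)
      rw [e1] at hw
      have hprod := (h1 c₀ (entrance S l)).mul (hw.mul hd hε'.le (by linarith)) hε'.le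
        (by linarith)
      refine SlowlyVarying.mono (ε := ε * 7 ^ n + (ε * 7 ^ n + 5 * (ε * 7 ^ n))) ?_
        (le_of_eq (by ring)) (le_max_right _ _)
        (zero_le_one.trans (one_le_weightBound m ε (n + 1)))
      refine (funext fun k => ?_ : newWeight m t S l ρ c₀ (entrance S l) = _) ▸ hprod
      simp [newWeight, ← hc₀]
    · have hle := touchCount_mono (Finset.subset_insert l S) (Sum.inl w)
      refine (funext fun k => ?_ : newWeight m t S l ρ c w = ρ c w) ▸ (h1 c w).mono
        (pow_rate_mono hε.le hle) (weightBound_mono m ε hle)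
        (zero_le_one.trans (one_le_weightBound m ε _))
      rw [newWeight, if_neg hcw, mul_one]

end FeynmanGraph

/-! ### The sum over the remaining momenta -/

namespace FeynmanGraph

variable {G : FeynmanGraph} {m t : ℝ}

lemma lineKernel_nonneg (N : Fin 4 → ℤ) : 0 ≤ lineKernel m t N := by
  rw [lineKernel]
  split_ifs
  · exact propagator_nonneg _ (Finset.sum_nonneg fun c _ => sq_nonneg _)
  · exact le_rfl

lemma lineKernel_le (hm : m ≠ 0) (ht : 0 ≤ t) (N : Fin 4 → ℤ) :
    lineKernel m t N ≤ 5 / min 1 (m ^ 2) * lineSize N ^ (-2 : ℝ) := by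
  have hm2 : 0 < m ^ 2 := by positivity
  have hκ : 0 < min 1 (m ^ 2) := lt_min one_pos hm2
  have hL := lineSize_pos N
  have hs : 0 ≤ ∑ c, (N c : ℝ) ^ 2 := Finset.sum_nonneg fun c _ => sq_nonneg _
  have h1 : lineSize N ^ 2 ≤ 5 * (1 + ∑ c, (N c : ℝ) ^ 2) := by
    simp only [lineSize, Fin.sum_univ_four]
    rw [← sq_abs (N 0 : ℝ), ← sq_abs (N 1 : ℝ), ← sq_abs (N 2 : ℝ), ← sq_abs (N 3 : ℝ)]
    generalize |(N 0 : ℝ)| = a, |(N 1 : ℝ)| = b, |(N 2 : ℝ)| = c, |(N 3 : ℝ)| = d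
    nlinarith [sq_nonneg (1 - a), sq_nonneg (1 - b), sq_nonneg (1 - c), sq_nonneg (1 - d),
      sq_nonneg (a - b), sq_nonneg (a - c), sq_nonneg (a - d), sq_nonneg (b - c),
      sq_nonneg (b - d), sq_nonneg (c - d)]
  have h2 : min 1 (m ^ 2) * (1 + ∑ c, (N c : ℝ) ^ 2) ≤ m ^ 2 + ∑ c, (N c : ℝ) ^ 2 := by
    have := mul_le_mul_of_nonneg_right (min_le_left 1 (m ^ 2)) hs
    linarith [min_le_right 1 (m ^ 2)]
  have h3 : lineSize N ^ (-2 : ℝ) = (lineSize N ^ 2)⁻¹ := by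
    rw [Real.rpow_neg hL.le]
    congr 1
    exact_mod_cast Real.rpow_natCast (lineSize N) 2
  rw [h3, ← div_eq_mul_inv, div_div]
  have h4 : lineKernel m t N ≤ 1 / (m ^ 2 + ∑ c, (N c : ℝ) ^ 2) := by
    rw [lineKernel]
    split_ifs
    · exact propagator_le hm ht hs
    · positivity
  refine h4.trans ?_
  rw [div_le_div_iff₀ (by positivity) (by positivity), one_mul]
  calc min 1 (m ^ 2) * lineSize N ^ 2 ≤ min 1 (m ^ 2) * (5 * (1 + ∑ c, (N c : ℝ) ^ 2)) := by gcongr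
    _ ≤ _ := by linarith

/-- Momenta that are conserved remain conserved after contraction of further lines. -/
lemma whiteMom_eq_contractSet {S : Finset G.Line} {x : G.Momenta} (hx : x ∈ G.solutions S)
    (U : Finset G.Line) (c : Fin 4) (w : G.White) :
    whiteMom x c w = blackMom x c (G.contractSet (U ∪ S) c w) := by
  induction U using Finset.induction_on generalizing w with
  | empty => rw [Finset.empty_union]; exact hx.2 c w
  | insert l U _ ih =>
    rw [Finset.insert_union, contractSet_insert, contractLine_apply]
    by_cases h1 : w = G.whiteEnd l
    · subst h1
      rw [Equiv.swap_apply_left, whiteMom_whiteEnd, blackMom_blackEnd]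
    · have hne : G.contractSet (U ∪ S) c w ≠ G.contractSet (U ∪ S) c (G.whiteEnd l) :=
        fun h => h1 ((G.contractSet (U ∪ S) c).injective h)
      by_cases h2 : G.contractSet (U ∪ S) c w = G.blackEnd l
      · rw [h2, Equiv.swap_apply_right, ← ih, ih w, h2, blackMom_blackEnd, whiteMom_whiteEnd]
      · rw [Equiv.swap_apply_of_ne_of_ne hne h2, ih]

variable (G) in
/-- White external legs. -/
abbrev WhiteLeg : Type := {w : G.White // ∀ e, G.whiteEnd e ≠ w}

variable (G) in
/-- Black external legs. -/
abbrev BlackLeg : Type := {b : G.Black // ∀ e, G.blackEnd e ≠ b}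

variable (G) in
/-- The open faces of color `c` pair the white with the black external legs. -/
noncomputable def legEquiv (c : Fin 4) : G.WhiteLeg ≃ G.BlackLeg :=
  (G.contractSet Finset.univ c).subtypeEquiv fun w => by
    refine forall_congr' fun e => not_congr ?_
    rw [eq_comm, ← G.contractSet_eq_blackEnd_iff (Finset.mem_univ e) c, eq_comm]

lemma ext_black_eq {S : Finset G.Line} {x : G.Momenta} (hx : x ∈ G.solutions S) (c : Fin 4)
    (v : G.WhiteLeg) : x.2 (Sum.inr (G.legEquiv c v), c) = -x.2 (Sum.inl v, c) := by
  have h := whiteMom_eq_contractSet hx Finset.univ c v.1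
  rw [Finset.union_eq_left.2 (Finset.subset_univ S), whiteMom_leg] at h
  have h2 := blackMom_leg x c (G.legEquiv c v)
  have h3 : (G.legEquiv c v).1 = G.contractSet Finset.univ c v.1 := rfl
  rw [h3] at h2
  rw [h, h2, neg_neg]

lemma prod_ext_eq {S : Finset G.Line} {x : G.Momenta} (hx : x ∈ G.solutions S) (g : ℤ → ℝ)
    (hg : ∀ n, g (-n) = g n) :
    ∏ i, g (x.2 i) = ∏ v : G.WhiteLeg, ∏ c, g (x.2 (Sum.inl v, c)) ^ 2 := by
  calc ∏ i, g (x.2 i) = ∏ c, ∏ l : G.ExtLeg, g (x.2 (l, c)) := Fintype.prod_prod_type_right _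
    _ = ∏ c, ∏ v : G.WhiteLeg, g (x.2 (Sum.inl v, c)) ^ 2 := by
      refine Finset.prod_congr rfl fun c _ => ?_
      rw [Fintype.prod_sum_type, ← (G.legEquiv c).prod_comp, ← Finset.prod_mul_distrib]
      refine Finset.prod_congr rfl fun v _ => ?_
      rw [ext_black_eq hx, hg, sq]
    _ = _ := Finset.prod_comm

lemma prod_white_eq (S : Finset G.Line) (h : G.White → ℝ) :
    ∏ w ∈ (S.map G.whiteEnd)ᶜ, h w =
      (∏ e ∈ Sᶜ, h (G.whiteEnd e)) * ∏ v : G.WhiteLeg, h v.1 := by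
  classical
  have h1 : (S.map G.whiteEnd)ᶜ =
      Sᶜ.map G.whiteEnd ∪ Finset.univ.filter fun w => ∀ e, G.whiteEnd e ≠ w := by
    ext w
    simp only [Finset.mem_compl, Finset.mem_map, Finset.mem_union, Finset.mem_filter,
      Finset.mem_univ, true_and]
    rcases white_cases w with ⟨e, rfl⟩ | ⟨v, rfl⟩
    · have : ¬ ∀ e', G.whiteEnd e' ≠ G.whiteEnd e := fun h => h e rfl
      simp only [G.whiteEnd.injective.eq_iff, exists_eq_right]
      exact ⟨Or.inl, fun h => h.resolve_right fun h => h e rfl⟩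
    · constructor
      · intro _
        exact Or.inr v.2
      · rintro _ ⟨e, -, h⟩
        exact v.2 e h
  rw [h1, Finset.prod_union, Finset.prod_map]
  · congr 1
    exact Finset.prod_subtype _ (by simp) h
  · rw [Finset.disjoint_left]
    intro w hw hw'
    obtain ⟨e, -, rfl⟩ := Finset.mem_map.1 hw
    exact (Finset.mem_filter.1 hw').2 e rfl

/-- A bound for the summand by powers of the momenta. The weights reduce the decay of a propagator
from `2` to `2 - 4 * δ`; the two ends of an open face carry the same momentum, so that the test
function provides the inverse square of each external momentum. -/
lemma summand_le {δ A : ℝ} (hδ : 0 < δ) (hδ1 : 2 * δ ≤ 1) (hA : 1 ≤ A) (hm : m ≠ 0) (ht : 0 ≤ t)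
    {f : (G.ExtLeg × Fin 4 → ℤ) → ℂ} {C : ℝ} (hC : 0 ≤ C)
    (hf : ∀ q, ‖f q‖ ≤ C * ∏ i, (Real.pi / bracket (q i)))
    {ρ : Fin 4 → G.White → ℤ → ℝ} (hρ : ∀ c w n, |ρ c w n| ≤ A * bracket n ^ δ)
    {x : G.Momenta} (hx : x ∈ G.solutions G.melonicLines) :
    ‖weightedTerm m t f G.melonicLines ρ x‖ ≤
      C * ((Real.pi ^ 2 * A) ^ 4) ^ Fintype.card G.WhiteLeg *
        (5 / min 1 (m ^ 2) * A ^ 4) ^ G.melonicLinesᶜ.card *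
        ((∏ e ∈ G.melonicLinesᶜ, lineSize (x.1 e) ^ (-(2 - 4 * δ))) *
          ∏ v : G.WhiteLeg, ∏ c, bracket (x.2 (Sum.inl v, c)) ^ (-(1 + δ))) := by
  have hπ := Real.pi_pos
  have hκ : 0 < min 1 (m ^ 2) := lt_min one_pos (by positivity)
  rw [weightedTerm, norm_mul, Complex.norm_real, Real.norm_eq_abs, abs_mul, prod_white_eq,
    abs_mul, Finset.abs_prod, Finset.abs_prod, Finset.abs_prod]
  simp only [Finset.abs_prod, whiteMom_whiteEnd, whiteMom_leg]
  have hext : ‖f x.2‖ ≤ C * ∏ v : G.WhiteLeg, ∏ c, (Real.pi / bracket (x.2 (Sum.inl v, c))) ^ 2 := by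
    refine (hf x.2).trans (le_of_eq ?_)
    rw [prod_ext_eq hx (fun n => Real.pi / bracket n) fun n => by rw [bracket_neg]]
  have hline : (∏ e ∈ G.melonicLinesᶜ, |subtractedKernel m t e (x.1 e)|) *
      ∏ e ∈ G.melonicLinesᶜ, ∏ c, |ρ c (G.whiteEnd e) (x.1 e c)| ≤
      (5 / min 1 (m ^ 2) * A ^ 4) ^ G.melonicLinesᶜ.card *
        ∏ e ∈ G.melonicLinesᶜ, lineSize (x.1 e) ^ (-(2 - 4 * δ)) := by
    rw [← Finset.prod_mul_distrib, ← Finset.prod_const, ← Finset.prod_mul_distrib]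
    refine Finset.prod_le_prod (fun e _ => by positivity) fun e he => ?_
    rw [subtractedKernel, if_neg (Finset.mem_compl.1 he), abs_of_nonneg (lineKernel_nonneg _)]
    have h1 := lineKernel_le hm ht (x.1 e)
    have hb := lineSize_pos (x.1 e)
    have h2 : ∏ c, |ρ c (G.whiteEnd e) (x.1 e c)| ≤ ∏ _c : Fin 4, (A * lineSize (x.1 e) ^ δ) :=
      Finset.prod_le_prod (fun c _ => abs_nonneg _) fun c _ => (hρ c _ _).trans
        (mul_le_mul_of_nonneg_left (Real.rpow_le_rpow (bracket_pos _).le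
          (bracket_le_lineSize _ c) hδ.le) (by linarith))
    rw [Finset.prod_const, Finset.card_univ, Fintype.card_fin] at h2
    refine (mul_le_mul h1 h2 (Finset.prod_nonneg fun c _ => abs_nonneg _) (by positivity)).trans
      (le_of_eq ?_)
    rw [mul_pow, ← Real.rpow_natCast (lineSize (x.1 e) ^ δ), ← Real.rpow_mul hb.le,
      show -(2 - 4 * δ) = -2 + δ * (4 : ℕ) by push_cast; ring, Real.rpow_add hb]
    ring
  have hleg : (∏ v : G.WhiteLeg, ∏ c, (Real.pi / bracket (x.2 (Sum.inl v, c))) ^ 2) *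
      (∏ v : G.WhiteLeg, ∏ c, |ρ c v.1 (x.2 (Sum.inl v, c))|) ≤
      ((Real.pi ^ 2 * A) ^ 4) ^ Fintype.card G.WhiteLeg *
        ∏ v : G.WhiteLeg, ∏ c, bracket (x.2 (Sum.inl v, c)) ^ (-(1 + δ)) := by
    have e4 : (Real.pi ^ 2 * A) ^ 4 = ∏ _c : Fin 4, (Real.pi ^ 2 * A) := by simp
    have eW : (∏ _c : Fin 4, (Real.pi ^ 2 * A)) ^ Fintype.card G.WhiteLeg =
      ∏ _v : G.WhiteLeg, ∏ _c : Fin 4, (Real.pi ^ 2 * A) := by simp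
    rw [e4, eW]
    simp only [← Finset.prod_mul_distrib]
    refine Finset.prod_le_prod (fun v _ => Finset.prod_nonneg fun c _ => by positivity)
      fun v _ => Finset.prod_le_prod (fun c _ => by positivity) fun c _ => ?_
    set n := x.2 (Sum.inl v, c)
    have hb := bracket_pos n
    have h2 : (Real.pi / bracket n) ^ 2 = Real.pi ^ 2 * bracket n ^ (-2 : ℝ) := by
      rw [div_pow, div_eq_mul_inv, Real.rpow_neg hb.le]
      congr 2
      exact_mod_cast (Real.rpow_natCast (bracket n) 2).symm
    rw [h2]
    calc Real.pi ^ 2 * bracket n ^ (-2 : ℝ) * |ρ c v.1 n|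
        ≤ Real.pi ^ 2 * bracket n ^ (-2 : ℝ) * (A * bracket n ^ δ) :=
          mul_le_mul_of_nonneg_left (hρ _ _ _) (by positivity)
      _ = Real.pi ^ 2 * A * bracket n ^ (-2 + δ) := by rw [Real.rpow_add hb]; ring
      _ ≤ _ := mul_le_mul_of_nonneg_left
          (Real.rpow_le_rpow_of_exponent_le (one_le_bracket n) (by linarith)) (by positivity)
  set a1 := ∏ e ∈ G.melonicLinesᶜ, |subtractedKernel m t e (x.1 e)|
  set a2 := ∏ e ∈ G.melonicLinesᶜ, ∏ c, |ρ c (G.whiteEnd e) (x.1 e c)|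
  set a3 := ∏ v : G.WhiteLeg, ∏ c, |ρ c v.1 (x.2 (Sum.inl v, c))|
  set a4 := ∏ v : G.WhiteLeg, ∏ c, (Real.pi / bracket (x.2 (Sum.inl v, c))) ^ 2
  have n1 : 0 ≤ a1 := Finset.prod_nonneg fun _ _ => abs_nonneg _
  have n2 : 0 ≤ a2 := Finset.prod_nonneg fun _ _ => Finset.prod_nonneg fun _ _ => abs_nonneg _
  have n3 : 0 ≤ a3 := Finset.prod_nonneg fun _ _ => Finset.prod_nonneg fun _ _ => abs_nonneg _
  have n4 : 0 ≤ a4 := Finset.prod_nonneg fun _ _ => Finset.prod_nonneg fun _ _ => sq_nonneg _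
  calc ‖f x.2‖ * (a1 * (a2 * a3)) ≤ (C * a4) * (a1 * (a2 * a3)) := by gcongr
    _ = C * ((a4 * a3) * (a1 * a2)) := by ring
    _ ≤ C * ((((Real.pi ^ 2 * A) ^ 4) ^ Fintype.card G.WhiteLeg *
        ∏ v : G.WhiteLeg, ∏ c, bracket (x.2 (Sum.inl v, c)) ^ (-(1 + δ))) *
        ((5 / min 1 (m ^ 2) * A ^ 4) ^ G.melonicLinesᶜ.card *
        ∏ e ∈ G.melonicLinesᶜ, lineSize (x.1 e) ^ (-(2 - 4 * δ)))) := by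
      refine mul_le_mul_of_nonneg_left (mul_le_mul hleg hline (mul_nonneg n1 n2) ?_) hC
      exact (mul_nonneg n4 n3).trans hleg
    _ = _ := by ring

lemma weightedTerm_eq_zero {f : (G.ExtLeg × Fin 4 → ℤ) → ℂ} {ρ : Fin 4 → G.White → ℤ → ℝ}
    {x : G.Momenta} (hx : x ∈ G.solutions G.melonicLines) (h : x ∉ G.skeletonMomenta) :
    weightedTerm m t f G.melonicLines ρ x = 0 := by
  obtain ⟨e, he⟩ : ∃ e, ∑ c, x.1 e c ≠ 0 := by
    by_contra hcon
    push Not at hcon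
    exact h ⟨hx, hcon⟩
  have heT : e ∈ G.melonicLinesᶜ := by
    rw [Finset.mem_compl]
    intro h'
    rw [hx.1 e h'] at he
    simp at he
  have h0 : subtractedKernel m t e (x.1 e) = 0 := by
    rw [subtractedKernel, if_neg (Finset.mem_compl.1 heT), lineKernel, if_neg he]
  rw [weightedTerm, Finset.prod_eq_zero heT h0]
  simp

/-- A sum over vectors of integers, in a possibly redundant parametrization, is at most the product
of the sums over the coordinates. -/
lemma sum_prod_bracket_le {α J : Type*} [Fintype J] {b : ℝ} (hb : 1 < b) (s : Finset α)
    (Φ : α → J → ℤ) (hinj : Set.InjOn Φ s) :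
    ∑ x ∈ s, ∏ j, bracket (Φ x j) ^ (-b) ≤ bracketSum b ^ Fintype.card J := by
  classical
  set g : ℤ → ℝ := fun n => bracket n ^ (-b) with hg
  have hnn : ∀ n, 0 ≤ g n := fun n => Real.rpow_nonneg (bracket_pos n).le (-b)
  have hle : ∀ u : Finset ℤ, ∑ n ∈ u, g n ≤ bracketSum b :=
    fun u => (summable_bracket hb).sum_le_tsum u fun n _ => hnn n
  have hgoal : ∑ x ∈ s, ∏ j, bracket (Φ x j) ^ (-b) = ∑ x ∈ s, ∏ j, g (Φ x j) := rfl
  rw [hgoal]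
  clear hgoal
  clear_value g
  have h1 : ∑ n ∈ s.image Φ, ∏ j, g (n j) = ∑ x ∈ s, ∏ j, g (Φ x j) := Finset.sum_image hinj
  have hsub : s.image Φ ⊆ Fintype.piFinset fun j => s.image fun x => Φ x j := by
    intro n hn
    obtain ⟨x, hx, rfl⟩ := Finset.mem_image.1 hn
    exact Fintype.mem_piFinset.2 fun j => Finset.mem_image_of_mem _ hx
  have h2 := Finset.prod_univ_sum (fun j => s.image fun x => Φ x j) fun _ n => g n
  have h3 := Finset.sum_le_sum_of_subset_of_nonneg (f := fun n : J → ℤ => ∏ j, g (n j)) hsub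
    fun n _ _ => Finset.prod_nonneg fun j _ => hnn _
  have h4 : ∏ j : J, ∑ n ∈ s.image (fun x => Φ x j), g n ≤ ∏ _j : J, bracketSum b :=
    Finset.prod_le_prod (fun j _ => Finset.sum_nonneg fun n _ => hnn n) fun j _ => hle _
  rw [Finset.prod_const, Finset.card_univ] at h4
  rw [← h1]
  exact h3.trans (h2.symm.trans_le h4)

/-- The momenta in `B` and those of the white external legs parametrize the momenta of the
skeleton, so that the sum over the skeleton is bounded by a product of simple sums. -/
lemma sum_skeleton_le {δ : ℝ} (hδ : 0 < δ) {B : Finset (G.Line × Fin 4)}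
    (hB : Summed δ G.melonicLinesᶜ B) (s : Finset G.Momenta) (hs : ∀ x ∈ s, x ∈ G.skeletonMomenta) :
    ∑ x ∈ s, (∏ e ∈ G.melonicLinesᶜ, lineSize (x.1 e) ^ (-(2 - 4 * δ))) *
      ∏ v : G.WhiteLeg, ∏ c, bracket (x.2 (Sum.inl v, c)) ^ (-(1 + δ)) ≤
      bracketSum (1 + δ) ^ (4 * Fintype.card G.Line + 4 * Fintype.card G.WhiteLeg) := by
  classical
  have hnn := fun n : ℤ => Real.rpow_nonneg (bracket_pos n).le (-(1 + δ))
  let Φ : G.Momenta → B ⊕ (G.WhiteLeg × Fin 4) → ℤ := fun x => Sum.elim (fun s => x.1 s.1.1 s.1.2)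
    fun v => x.2 (Sum.inl v.1, v.2)
  have hinj : Set.InjOn Φ s := by
    intro x hx y hy h
    have hx' := hs x hx
    have hy' := hs y hy
    have hw : ∀ v c, x.2 (Sum.inl v, c) = y.2 (Sum.inl v, c) :=
      fun v c => congrFun h (Sum.inr (v, c))
    have hq : x.2 = y.2 := by
      funext ⟨i, c⟩
      rcases i with v | b
      · exact hw v c
      · obtain ⟨v, rfl⟩ := (G.legEquiv c).surjective b
        rw [ext_black_eq hx'.1, ext_black_eq hy'.1, hw]
    refine Prod.ext (funext fun e => ?_) hq
    by_cases he : e ∈ G.melonicLines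
    · rw [hx'.1.1 e he, hy'.1.1 e he]
    · funext c
      exact hB.det e (Finset.mem_compl.2 he) c x hx' y hy' hq
        fun s hs => congrFun h (Sum.inl ⟨s, hs⟩)
  have hb : ∀ x ∈ s, (∏ e ∈ G.melonicLinesᶜ, lineSize (x.1 e) ^ (-(2 - 4 * δ))) *
      ∏ v : G.WhiteLeg, ∏ c, bracket (x.2 (Sum.inl v, c)) ^ (-(1 + δ)) ≤
      ∏ j, bracket (Φ x j) ^ (-(1 + δ)) := by
    intro x hx
    rw [Fintype.prod_sum_type, Fintype.prod_prod_type]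
    refine mul_le_mul_of_nonneg_right ((hB.le x (hs x hx)).trans (le_of_eq ?_))
      (Finset.prod_nonneg fun _ _ => Finset.prod_nonneg fun _ _ => hnn _)
    exact (Finset.prod_coe_sort B fun s => bracket (x.1 s.1 s.2) ^ (-(1 + δ))).symm
  have hcard : Fintype.card (B ⊕ (G.WhiteLeg × Fin 4)) ≤
      4 * Fintype.card G.Line + 4 * Fintype.card G.WhiteLeg := by
    rw [Fintype.card_sum, Fintype.card_prod, Fintype.card_fin, Fintype.card_coe]
    have := Finset.card_le_univ B
    rw [Fintype.card_prod, Fintype.card_fin] at this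
    omega
  exact (Finset.sum_le_sum hb).trans ((sum_prod_bracket_le (by linarith) s Φ hinj).trans
    (pow_le_pow_right₀ (one_le_bracketSum (by linarith)) hcard))

/-- In a connected graph with a line, every bubble carries the end of a line, so that the number of
nodes is at most proportional to the number of lines. -/
lemma card_white_le (hG : G.IsConnected) {p : ℕ} (hp : G.OrderAtMost p) [Nonempty G.Line] :
    Fintype.card G.White ≤ 2 * p * Fintype.card G.Line := by
  classical
  let ends : G.Line ⊕ G.Line → G.White ⊕ G.Black :=
    Sum.elim (fun e => Sum.inl (G.whiteEnd e)) fun e => Sum.inr (G.blackEnd e)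
  have hcov : ∀ x, ∃ i, G.bubbleGraph.Reachable (ends i) x := by
    obtain ⟨e₀⟩ := ‹Nonempty G.Line›
    intro x
    obtain ⟨walk⟩ := hG.preconnected (Sum.inl (G.whiteEnd e₀)) x
    have key : ∀ a b, G.coloredExtension.Walk a b → (∃ i, G.bubbleGraph.Reachable (ends i) a) →
        ∃ i, G.bubbleGraph.Reachable (ends i) b := by
      intro a b W
      induction W with
      | nil => exact id
      | cons hadj _ ih =>
        rintro ⟨i, hi⟩
        apply ih
        rcases hadj with hadj | hadj
        · exact ⟨i, hi.trans hadj.reachable⟩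
        · rw [SimpleGraph.fromRel_adj] at hadj
          rcases hadj.2 with ⟨e, h1, h2⟩ | ⟨e, h1, h2⟩
          · exact ⟨Sum.inr e, h2 ▸ .refl _⟩
          · exact ⟨Sum.inl e, h1 ▸ .refl _⟩
    exact key _ _ walk ⟨Sum.inl e₀, .refl _⟩
  have h1 : (Set.univ : Set (G.White ⊕ G.Black)) ⊆
      ⋃ i ∈ (Finset.univ : Finset (G.Line ⊕ G.Line)), {y | G.bubbleGraph.Reachable (ends i) y} := by
    intro x _
    obtain ⟨i, hi⟩ := hcov x
    exact Set.mem_biUnion (Finset.mem_univ i) hi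
  have h2 := (Set.ncard_le_ncard h1 (Set.toFinite _)).trans
    ((Finset.set_ncard_biUnion_le _ _).trans (Finset.sum_le_card_nsmul _ _ p fun i _ => hp (ends i)))
  rw [Set.ncard_univ, Nat.card_eq_fintype_card, Fintype.card_sum, Finset.card_univ,
    Fintype.card_sum, smul_eq_mul] at h2
  nlinarith

/-- The exponent `δ` that the weights may take away in the power counting; it is small enough for
`6 * δ * p + 5 * δ ≤ 1`, the condition of `exists_summed`. -/
noncomputable def lossRate (p : ℕ) : ℝ := 1 / (12 * (p + 1))

/-- The bound for the weights of the colored lines after the resummation of all melonic lines. -/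
noncomputable def maxWeight (m : ℝ) (p : ℕ) : ℝ := weightBound m (lossRate p / 7 ^ p) p

/-- The constant of the exponential bound. The three factors stem from the at most `2 * p * L` white
external legs, from the `L` lines, and from the sums over at most `4 * L` internal and `8 * p * L`
external momenta. -/
noncomputable def growthConstant (m : ℝ) (p : ℕ) : ℝ :=
  ((Real.pi ^ 2 * maxWeight m p) ^ 4) ^ (2 * p) * (5 / min 1 (m ^ 2) * maxWeight m p ^ 4) *
    bracketSum (1 + lossRate p) ^ (4 + 8 * p)

lemma one_le_growthConstant_factors (hm : m ≠ 0) (p : ℕ) :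
    1 ≤ (Real.pi ^ 2 * maxWeight m p) ^ 4 ∧ 1 ≤ 5 / min 1 (m ^ 2) * maxWeight m p ^ 4 ∧
      1 ≤ bracketSum (1 + lossRate p) := by
  have hκ : 0 < min 1 (m ^ 2) := lt_min one_pos (by positivity)
  have hA : 1 ≤ maxWeight m p := one_le_weightBound _ _ _
  refine ⟨one_le_pow₀ (one_le_mul_of_one_le_of_one_le (one_le_pow₀ ?_) hA),
    one_le_mul_of_one_le_of_one_le ?_ (one_le_pow₀ hA), one_le_bracketSum ?_⟩
  · linarith [Real.pi_gt_three]
  · rw [le_div_iff₀ hκ]; linarith [min_le_left 1 (m ^ 2)]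
  · have : 0 < lossRate p := by unfold lossRate; positivity
    linarith

lemma growthConstant_pos (hm : m ≠ 0) (p : ℕ) : 0 < growthConstant m p := by
  obtain ⟨h1, h2, h3⟩ := one_le_growthConstant_factors hm p
  unfold growthConstant
  have := zero_lt_one.trans_le h1
  have := zero_lt_one.trans_le h2
  have := zero_lt_one.trans_le h3
  positivity

/-- The bound on the renormalized amplitude, in momentum space. -/
lemma norm_le_of_hasSum (hG : G.IsConnected) (hV : ¬ G.IsVacuum) {p : ℕ} (hp : G.OrderAtMost p)
    [Nonempty G.Line] (hm : m ≠ 0) (ht : 0 < t) {f : (G.ExtLeg × Fin 4 → ℤ) → ℂ} {C : ℝ}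
    (hC : 0 ≤ C) (hf : ∀ q, ‖f q‖ ≤ C * ∏ i, (Real.pi / bracket (q i))) {z : ℂ}
    (h : HasSum (fun x : G.solutions ∅ => weightedTerm m t f ∅ (fun _ _ _ => 1) x.1) z) :
    ‖z‖ ≤ C * growthConstant m p ^ Fintype.card G.Line := by
  classical
  set δ := lossRate p with hδdef
  have hδ : 0 < δ := by rw [hδdef, lossRate]; positivity
  have hδe : δ * (12 * (p + 1)) = 1 := by rw [hδdef, lossRate]; field_simp
  have hδp0 : 0 ≤ δ * p := by positivity
  have hpow : δ / 7 ^ p * 7 ^ p = δ := by field_simp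
  -- the exponent is multiplied by `7` at most `p` times in each bubble, so that it ends up at `δ`
  obtain ⟨ρ, hρ, hz⟩ := melonic_melonicLines.exists_weights hG hV hp hm ht (ε := δ / 7 ^ p)
    (by positivity) (by rw [hpow]; nlinarith) f h
  obtain ⟨B, hB⟩ := exists_summed hG hV hp hδ (by nlinarith)
  set A := maxWeight m p with hA
  have hA1 : 1 ≤ A := one_le_weightBound _ _ _
  have hρ' : ∀ c w n, |ρ c w n| ≤ A * bracket n ^ δ := by
    intro c w n
    have hle := touchCount_le hp G.melonicLines (Sum.inl w)
    have := ((hρ c w).mono (pow_rate_mono (by positivity) hle) (weightBound_mono m _ hle)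
      (zero_le_one.trans hA1)).bound n
    rwa [hpow] at this
  obtain ⟨g1, g2, g3⟩ := one_le_growthConstant_factors hm p
  rw [← hA] at g1 g2
  rw [← hδdef] at g3
  have hcW : Fintype.card G.WhiteLeg ≤ 2 * p * Fintype.card G.Line :=
    (Fintype.card_subtype_le _).trans (card_white_le hG hp)
  have hcT : G.melonicLinesᶜ.card ≤ Fintype.card G.Line := Finset.card_le_univ _
  set a := (Real.pi ^ 2 * A) ^ 4 with ha
  set b := 5 / min 1 (m ^ 2) * A ^ 4 with hb
  set S := bracketSum (1 + δ) with hS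
  have hpart : ∀ s : Finset (G.solutions G.melonicLines),
      ‖∑ x ∈ s, weightedTerm m t f G.melonicLines ρ x.1‖ ≤
        C * a ^ Fintype.card G.WhiteLeg * b ^ G.melonicLinesᶜ.card *
          S ^ (4 * Fintype.card G.Line + 4 * Fintype.card G.WhiteLeg) := by
    intro s
    have hmap : ∑ x ∈ s, weightedTerm m t f G.melonicLines ρ x.1 =
        ∑ x ∈ (s.map (Function.Embedding.subtype _)).filter (· ∈ G.skeletonMomenta),
          weightedTerm m t f G.melonicLines ρ x := by
      rw [Finset.sum_filter_of_ne, Finset.sum_map]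
      · rfl
      · intro x hx hne
        obtain ⟨y, -, rfl⟩ := Finset.mem_map.1 hx
        by_contra hn
        exact hne (weightedTerm_eq_zero y.2 hn)
    rw [hmap]
    refine (norm_sum_le _ _).trans ((Finset.sum_le_sum fun x hx =>
      summand_le hδ (by nlinarith) hA1 hm ht.le hC hf hρ' (Finset.mem_filter.1 hx).2.1).trans ?_)
    rw [← Finset.mul_sum]
    exact mul_le_mul_of_nonneg_left
      (sum_skeleton_le hδ hB _ fun x hx => (Finset.mem_filter.1 hx).2) (by positivity)
  refine (le_of_tendsto hz.norm (Filter.Eventually.of_forall hpart)).trans ?_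
  set L := Fintype.card G.Line
  calc C * a ^ Fintype.card G.WhiteLeg * b ^ G.melonicLinesᶜ.card *
        S ^ (4 * L + 4 * Fintype.card G.WhiteLeg)
      ≤ C * a ^ (2 * p * L) * b ^ L * S ^ ((4 + 8 * p) * L) := by
        have e1 := pow_le_pow_right₀ g1 hcW
        have e2 := pow_le_pow_right₀ g2 hcT
        have e3 : S ^ (4 * L + 4 * Fintype.card G.WhiteLeg) ≤ S ^ ((4 + 8 * p) * L) :=
          pow_le_pow_right₀ g3 (by nlinarith)
        gcongr
    _ = C * growthConstant m p ^ L := by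
        rw [growthConstant, ← hA, ← ha, ← hb, ← hδdef, ← hS, mul_pow, mul_pow, ← pow_mul, ← pow_mul]
        ring

end FeynmanGraph

/-! ### Fourier series of periodic functions -/

section PeriodicFunctions

variable {I : Type*}

lemma exists_coe_eq (x : UnitAddTorus I) : ∃ y : I → ℝ, x = fun i => (y i : UnitAddCircle) :=
  ⟨fun i => Quotient.out (x i), funext fun i => (QuotientAddGroup.out_eq' (x i)).symm⟩

/-- A function of angles as a function on the torus. -/
noncomputable def toTorus (ψ : (I → ℝ) → ℂ) (x : UnitAddTorus I) : ℂ :=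
  ψ fun i => 2 * Real.pi * Quotient.out (x i)

variable [Fintype I]

/-- The Fourier coefficients of a function of angles. -/
noncomputable def angleCoeff (ψ : (I → ℝ) → ℂ) (q : I → ℤ) : ℂ :=
  UnitAddTorus.mFourierCoeff (toTorus ψ) q

variable (I) in
/-- The Haar probability measure of the torus. -/
noncomputable abbrev torusMeasure : Measure (UnitAddTorus I) :=
  Measure.pi fun _ => AddCircle.haarAddCircle

lemma angleCoeff_eq (ψ : (I → ℝ) → ℂ) (q : I → ℤ) :
    angleCoeff ψ q = ∫ x, UnitAddTorus.mFourier (-q) x * toTorus ψ x ∂(torusMeasure I) := rfl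

lemma norm_mFourier_apply (q : I → ℤ) (x : UnitAddTorus I) : ‖UnitAddTorus.mFourier q x‖ = 1 := by
  simp [UnitAddTorus.mFourier, norm_prod, Circle.norm_coe]

lemma norm_angleCoeff_le {ψ : (I → ℝ) → ℂ} {C : ℝ} (h : ∀ x, ‖ψ x‖ ≤ C) (q : I → ℤ) :
    ‖angleCoeff ψ q‖ ≤ C := by
  rw [angleCoeff_eq]
  have := norm_integral_le_of_norm_le_const (μ := torusMeasure I) (C := C)
    (f := fun x => UnitAddTorus.mFourier (-q) x * toTorus ψ x)
    (Filter.Eventually.of_forall fun x => by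
      rw [norm_mul, norm_mFourier_apply, one_mul]; exact h _)
  simpa using this

lemma mFourier_apply_coe (q : I → ℤ) (y : I → ℝ) :
    UnitAddTorus.mFourier q (fun i => (y i : UnitAddCircle)) =
      Complex.exp (∑ i, 2 * Real.pi * q i * y i * Complex.I) := by
  rw [Complex.exp_sum]
  refine Finset.prod_congr rfl fun i _ => ?_
  rw [fourier_coe_apply]
  congr 1
  push_cast
  ring

lemma mFourier_apply_add (q : I → ℤ) (x y : UnitAddTorus I) :
    UnitAddTorus.mFourier q (x + y) = UnitAddTorus.mFourier q x * UnitAddTorus.mFourier q y := by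
  simp only [UnitAddTorus.mFourier, ContinuousMap.coe_mk, ← Finset.prod_mul_distrib]
  refine Finset.prod_congr rfl fun i _ => ?_
  simp [fourier_apply, AddCircle.toCircle_add]

variable [DecidableEq I]

/-- Functions of several angles: functions of period `2π` in each variable. -/
def AnglePeriodic {E : Type*} (ψ : (I → ℝ) → E) : Prop := ∀ x i, ψ (x + Pi.single i (2 * Real.pi)) = ψ x

lemma AnglePeriodic.add_int {E : Type*} {ψ : (I → ℝ) → E} (h : AnglePeriodic ψ) (x : I → ℝ) (z : I → ℤ) :
    ψ (x + fun i => 2 * Real.pi * z i) = ψ x := by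
  let H : AddSubgroup (I → ℝ) :=
    { carrier := {v | ∀ x, ψ (x + v) = ψ x}
      zero_mem' := fun x => by rw [add_zero]
      add_mem' := fun {a b} ha hb x => by rw [← add_assoc, hb, ha]
      neg_mem' := fun {a} ha x => by rw [← ha (x + -a), neg_add_cancel_right] }
  have hmem : (∑ i, z i • (Pi.single i (2 * Real.pi) : I → ℝ)) ∈ H :=
    sum_mem fun i _ => H.zsmul_mem (fun x => h x i) (z i)
  have heq : (∑ i, z i • (Pi.single i (2 * Real.pi) : I → ℝ)) = fun i => 2 * Real.pi * z i := by
    funext j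
    rw [Finset.sum_apply, Finset.sum_eq_single j]
    · simp [mul_comm]
    · intro i _ hij
      simp [hij.symm]
    · simp
  rw [← heq]
  exact hmem x

lemma AnglePeriodic.add_right {J E : Type*} [DecidableEq J] {ψ : (J → ℝ) → E} (h : AnglePeriodic ψ)
    (v : J → ℝ) : AnglePeriodic fun x => ψ (x + v) := fun x i => by
  simp only
  rw [add_right_comm, h]

lemma AnglePeriodic.sub {J : Type*} [DecidableEq J] {ψ ψ' : (J → ℝ) → ℂ}
    (h : AnglePeriodic ψ) (h' : AnglePeriodic ψ') :
    AnglePeriodic fun x => ψ x - ψ' x := fun x i => by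
  simp only
  rw [h, h']

lemma toTorus_coe {ψ : (I → ℝ) → ℂ} (h : AnglePeriodic ψ) (y : I → ℝ) :
    toTorus ψ (fun i => (y i : UnitAddCircle)) = ψ fun i => 2 * Real.pi * y i := by
  have key : ∀ i, ∃ n : ℤ, Quotient.out (y i : UnitAddCircle) = y i + n := by
    intro i
    have h1 : ((Quotient.out (y i : UnitAddCircle) : ℝ) : UnitAddCircle) = y i :=
      QuotientAddGroup.out_eq' _
    have h2 : ((Quotient.out (y i : UnitAddCircle) - y i : ℝ) : UnitAddCircle) = 0 := by
      rw [AddCircle.coe_sub, h1, sub_self]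
    obtain ⟨n, hn⟩ := (AddCircle.coe_eq_zero_iff (1 : ℝ)).1 h2
    refine ⟨n, ?_⟩
    rw [zsmul_eq_mul, mul_one] at hn
    linarith
  choose n hn using key
  rw [toTorus, ← h.add_int (fun i => 2 * Real.pi * y i) n]
  congr 1
  funext i
  rw [hn, Pi.add_apply]
  ring

lemma continuous_toTorus {ψ : (I → ℝ) → ℂ} (h : AnglePeriodic ψ) (hc : Continuous ψ) :
    Continuous (toTorus ψ) := by
  have hq : IsOpenQuotientMap (Pi.map fun (_ : I) (y : ℝ) => (y : UnitAddCircle)) :=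
    IsOpenQuotientMap.piMap fun _ => QuotientAddGroup.isOpenQuotientMap_mk
  rw [← hq.continuous_comp_iff]
  have : (toTorus ψ ∘ Pi.map fun (_ : I) (y : ℝ) => (y : UnitAddCircle)) =
      fun y => ψ fun i => 2 * Real.pi * y i := funext fun y => toTorus_coe h y
  rw [this]
  fun_prop

lemma integrable_mFourier_mul {ψ : (I → ℝ) → ℂ} (h : AnglePeriodic ψ) (hc : Continuous ψ)
    (q : I → ℤ) :
    Integrable (fun x => UnitAddTorus.mFourier (-q) x * toTorus ψ x) (torusMeasure I) := by
  have : Continuous fun x => UnitAddTorus.mFourier (-q) x * toTorus ψ x :=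
    (UnitAddTorus.mFourier (-q)).continuous.mul (continuous_toTorus h hc)
  exact this.integrable_of_hasCompactSupport (HasCompactSupport.of_compactSpace _)

lemma angleCoeff_sub {ψ ψ' : (I → ℝ) → ℂ} (h : AnglePeriodic ψ) (hc : Continuous ψ)
    (h' : AnglePeriodic ψ') (hc' : Continuous ψ') (q : I → ℤ) :
    angleCoeff (fun x => ψ x - ψ' x) q = angleCoeff ψ q - angleCoeff ψ' q := by
  rw [angleCoeff_eq, angleCoeff_eq, angleCoeff_eq,
    ← integral_sub (integrable_mFourier_mul h hc q) (integrable_mFourier_mul h' hc' q)]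
  refine integral_congr_ae (Filter.Eventually.of_forall fun x => ?_)
  simp only [toTorus]
  ring

lemma angleCoeff_add_right {ψ : (I → ℝ) → ℂ} (h : AnglePeriodic ψ) (v : I → ℝ) (q : I → ℤ) :
    angleCoeff (fun x => ψ (x + v)) q =
      Complex.exp (∑ i, q i * v i * Complex.I) * angleCoeff ψ q := by
  have hπ : (2 * Real.pi) ≠ 0 := by positivity
  set u : UnitAddTorus I := fun i => ((v i / (2 * Real.pi) : ℝ) : UnitAddCircle) with hu
  have hshift : ∀ x, toTorus (fun x => ψ (x + v)) x = toTorus ψ (x + u) := by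
    intro x
    obtain ⟨y, rfl⟩ := exists_coe_eq x
    have : (fun i => (y i : UnitAddCircle)) + u =
        fun i => ((y i + v i / (2 * Real.pi) : ℝ) : UnitAddCircle) := by
      funext i
      simp [hu]
    rw [this, toTorus_coe h, toTorus_coe (h.add_right v)]
    congr 1
    funext i
    simp only [Pi.add_apply]
    field_simp
  have hchar : ∀ x, UnitAddTorus.mFourier (-q) x =
      Complex.exp (∑ i, q i * v i * Complex.I) * UnitAddTorus.mFourier (-q) (x + u) := by
    intro x
    rw [mFourier_apply_add, hu, mFourier_apply_coe, mul_left_comm, ← Complex.exp_add,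
      ← Finset.sum_add_distrib]
    rw [Finset.sum_eq_zero, Complex.exp_zero, mul_one]
    intro i _
    have : (2 * Real.pi : ℂ) ≠ 0 := by exact_mod_cast hπ
    simp only [Pi.neg_apply]
    push_cast
    field_simp
    ring
  rw [angleCoeff_eq, angleCoeff_eq, ← integral_const_mul,
    ← integral_add_right_eq_self (fun x => Complex.exp (∑ i, q i * v i * Complex.I) *
      (UnitAddTorus.mFourier (-q) x * toTorus ψ x)) u]
  refine integral_congr_ae (Filter.Eventually.of_forall fun x => ?_)
  simp only
  rw [hshift, hchar x, mul_assoc]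

/-- Pointwise inversion. -/
lemma hasSum_angleCoeff {ψ : (I → ℝ) → ℂ} (h : AnglePeriodic ψ) (hc : Continuous ψ)
    (hs : Summable (angleCoeff ψ)) (θ : I → ℝ) :
    HasSum (fun q => angleCoeff ψ q * Complex.exp (∑ i, q i * θ i * Complex.I)) (ψ θ) := by
  have hπ : (2 * Real.pi) ≠ 0 := by positivity
  have h1 := UnitAddTorus.hasSum_mFourier_series_apply_of_summable
    (f := ⟨toTorus ψ, continuous_toTorus h hc⟩) hs
    (fun i => ((θ i / (2 * Real.pi) : ℝ) : UnitAddCircle))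
  have h2 : toTorus ψ (fun i => ((θ i / (2 * Real.pi) : ℝ) : UnitAddCircle)) = ψ θ := by
    rw [toTorus_coe h]
    congr 1
    funext i
    field_simp
  simp only [ContinuousMap.coe_mk, h2, mFourier_apply_coe, smul_eq_mul] at h1
  have h3 : ∀ (q : I → ℤ), ∑ i, 2 * Real.pi * q i * ((θ i / (2 * Real.pi) : ℝ) : ℂ) * Complex.I =
      ∑ i, q i * θ i * Complex.I := by
    intro q
    refine Finset.sum_congr rfl fun i _ => ?_
    have : (2 * Real.pi : ℂ) ≠ 0 := by exact_mod_cast hπ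
    push_cast
    field_simp
  simp only [h3] at h1
  exact h1

/-! ### Decay of Fourier coefficients -/

/-- The partial derivative of a function in direction `i`. -/
noncomputable def partialDeriv (i : I) (ψ : (I → ℝ) → ℂ) (x : I → ℝ) : ℂ :=
  fderiv ℝ ψ x (Pi.single i 1)

/-- The difference of a function with step `s` in direction `i`. -/
def stepDiff (i : I) (s : ℝ) (ψ : (I → ℝ) → ℂ) (x : I → ℝ) : ℂ := ψ (x + Pi.single i s) - ψ x

/-- Iterated differences in the directions `i 0, i 1, …`. -/
def stepDiffs (s : I → ℝ) : (n : ℕ) → (Fin n → I) → ((I → ℝ) → ℂ) → (I → ℝ) → ℂ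
  | 0, _, ψ => ψ
  | n + 1, i, ψ => stepDiff (i (Fin.last n)) (s (i (Fin.last n))) (stepDiffs s n (Fin.init i) ψ)

lemma ContDiff.stepDiff {ψ : (I → ℝ) → ℂ} (h : ContDiff ℝ ((⊤ : ℕ∞) : WithTop ℕ∞) ψ) (i : I)
    (s : ℝ) : ContDiff ℝ ((⊤ : ℕ∞) : WithTop ℕ∞) (stepDiff i s ψ) :=
  (h.comp (contDiff_id.add contDiff_const)).sub h

lemma ContDiff.partialDeriv {ψ : (I → ℝ) → ℂ} (h : ContDiff ℝ ((⊤ : ℕ∞) : WithTop ℕ∞) ψ) (i : I) :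
    ContDiff ℝ ((⊤ : ℕ∞) : WithTop ℕ∞) (partialDeriv i ψ) :=
  (h.fderiv_right (m := ((⊤ : ℕ∞) : WithTop ℕ∞)) (by norm_cast)).clm_apply contDiff_const

lemma ContDiff.stepDiffs {ψ : (I → ℝ) → ℂ} (h : ContDiff ℝ ((⊤ : ℕ∞) : WithTop ℕ∞) ψ) (s : I → ℝ)
    {n : ℕ} (i : Fin n → I) : ContDiff ℝ ((⊤ : ℕ∞) : WithTop ℕ∞) (stepDiffs s n i ψ) := by
  induction n with
  | zero => exact h
  | succ n ih => exact (ih _).stepDiff _ _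

lemma AnglePeriodic.stepDiffs {J : Type*} [DecidableEq J] {ψ : (J → ℝ) → ℂ}
    (h : AnglePeriodic ψ) (s : J → ℝ) {n : ℕ} (i : Fin n → J) :
    AnglePeriodic (stepDiffs s n i ψ) := by
  induction n with
  | zero => exact h
  | succ n ih => exact ((ih _).add_right _).sub (ih _)

lemma partialDeriv_stepDiff {ψ : (I → ℝ) → ℂ} (h : Differentiable ℝ ψ) (i j : I) (s : ℝ) :
    partialDeriv j (stepDiff i s ψ) = stepDiff i s (partialDeriv j ψ) := by
  funext x
  have h1 : fderiv ℝ (stepDiff i s ψ) x =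
      fderiv ℝ ψ (x + Pi.single i s) - fderiv ℝ ψ x := by
    have e : stepDiff i s ψ = (fun x => ψ (x + Pi.single i s)) - ψ := rfl
    have h2 : DifferentiableAt ℝ (fun x => ψ (x + Pi.single i s)) x :=
      (h _).comp x (differentiableAt_id.add_const _)
    rw [e, fderiv_sub h2 (h x), fderiv_comp_add_right]
  rw [partialDeriv, h1]
  rfl

lemma partialDeriv_stepDiffs {ψ : (I → ℝ) → ℂ} (h : ContDiff ℝ ((⊤ : ℕ∞) : WithTop ℕ∞) ψ)
    (s : I → ℝ) (j : I) {n : ℕ} (i : Fin n → I) :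
    partialDeriv j (stepDiffs s n i ψ) = stepDiffs s n i (partialDeriv j ψ) := by
  induction n with
  | zero => rfl
  | succ n ih =>
    simp only [stepDiffs]
    rw [partialDeriv_stepDiff ((h.stepDiffs s _).differentiable (by simp)), ih]

lemma norm_stepDiff_le {ψ : (I → ℝ) → ℂ} (h : Differentiable ℝ ψ) {i : I} {s C : ℝ}
    (hC : ∀ x, ‖partialDeriv i ψ x‖ ≤ C) (x : I → ℝ) : ‖stepDiff i s ψ x‖ ≤ C * |s| := by
  have hd : ∀ r : ℝ, HasDerivAt (fun r : ℝ => ψ (x + r • Pi.single i s))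
      (s • partialDeriv i ψ (x + r • Pi.single i s)) r := by
    intro r
    have h1 : HasDerivAt (fun r : ℝ => x + r • (Pi.single i s : I → ℝ)) (Pi.single i s) r := by
      simpa using ((hasDerivAt_id r).smul_const (Pi.single i s : I → ℝ)).const_add x
    have h2 := (h (x + r • Pi.single i s)).hasFDerivAt.comp_hasDerivAt r h1
    have e : (Pi.single i s : I → ℝ) = s • Pi.single i 1 := by
      rw [← Pi.single_smul, smul_eq_mul, mul_one]
    have e2 : fderiv ℝ ψ (x + r • Pi.single i s) (Pi.single i s) =
        s • partialDeriv i ψ (x + r • Pi.single i s) := by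
      rw [partialDeriv, ← map_smul, ← e]
    rw [← e2]
    exact h2
  have h3 := norm_image_sub_le_of_norm_deriv_le_segment_01'
    (f := fun r : ℝ => ψ (x + r • Pi.single i s)) (C := C * |s|)
    (fun r _ => (hd r).hasDerivWithinAt) fun r _ => by
      rw [norm_smul, Real.norm_eq_abs, mul_comm]
      exact mul_le_mul_of_nonneg_right (hC _) (abs_nonneg s)
  simpa [stepDiff] using h3

lemma iteratedFDeriv_partialDeriv {ψ : (I → ℝ) → ℂ} (h : ContDiff ℝ ((⊤ : ℕ∞) : WithTop ℕ∞) ψ)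
    {n : ℕ} (i : Fin (n + 1) → I) (x : I → ℝ) :
    iteratedFDeriv ℝ n (partialDeriv (i (Fin.last n)) ψ) x
        (fun k => Pi.single (Fin.init i k) 1) =
      iteratedFDeriv ℝ (n + 1) ψ x fun k => Pi.single (i k) 1 := by
  have e : partialDeriv (i (Fin.last n)) ψ =
      ContinuousLinearMap.apply ℝ ℂ (Pi.single (i (Fin.last n)) 1 : I → ℝ) ∘ fderiv ℝ ψ := rfl
  have hd : ContDiff ℝ ((⊤ : ℕ∞) : WithTop ℕ∞) (fderiv ℝ ψ) := h.fderiv_right (by norm_cast)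
  rw [iteratedFDeriv_succ_apply_right, e,
    ContinuousLinearMap.iteratedFDeriv_comp_left _ hd.contDiffAt (by exact_mod_cast le_top)]
  rfl

/-- Iterated differences are controlled by the mixed partial derivative in the same directions. -/
lemma norm_stepDiffs_le (s : I → ℝ) {n : ℕ} {ψ : (I → ℝ) → ℂ}
    (h : ContDiff ℝ ((⊤ : ℕ∞) : WithTop ℕ∞) ψ) (i : Fin n → I) {C : ℝ}
    (hC : ∀ x, ‖iteratedFDeriv ℝ n ψ x fun k => Pi.single (i k) 1‖ ≤ C) (x : I → ℝ) :
    ‖stepDiffs s n i ψ x‖ ≤ C * ∏ k, |s (i k)| := by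
  induction n generalizing ψ C x with
  | zero => simpa [stepDiffs] using hC x
  | succ n ih =>
    rw [Fin.prod_univ_castSucc, ← mul_assoc]
    refine norm_stepDiff_le ((h.stepDiffs s _).differentiable (by simp)) (fun y => ?_) x
    rw [partialDeriv_stepDiffs h]
    refine ih (h.partialDeriv _) (Fin.init i) (fun z => ?_) y
    rw [iteratedFDeriv_partialDeriv h]
    exact hC z

lemma angleCoeff_stepDiffs {ψ : (I → ℝ) → ℂ} (h : AnglePeriodic ψ) (hc : ContDiff ℝ ((⊤ : ℕ∞) : WithTop ℕ∞) ψ)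
    (s : I → ℝ) {n : ℕ} (i : Fin n → I) (q : I → ℤ) :
    angleCoeff (stepDiffs s n i ψ) q =
      (∏ k, (Complex.exp (q (i k) * s (i k) * Complex.I) - 1)) * angleCoeff ψ q := by
  induction n with
  | zero => simp [stepDiffs]
  | succ n ih =>
    have h1 := h.stepDiffs s (Fin.init i)
    have h2 := (hc.stepDiffs s (Fin.init i)).continuous
    have e : stepDiffs s (n + 1) i ψ = fun x => stepDiffs s n (Fin.init i) ψ
        (x + Pi.single (i (Fin.last n)) (s (i (Fin.last n)))) - stepDiffs s n (Fin.init i) ψ x := rfl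
    rw [e, angleCoeff_sub (h1.add_right _) (by fun_prop) h1 h2, angleCoeff_add_right h1, ih,
      Fin.prod_univ_castSucc]
    have e2 : ∑ j, (q j : ℂ) * ((Pi.single (i (Fin.last n)) (s (i (Fin.last n))) : I → ℝ) j : ℂ) *
        Complex.I = q (i (Fin.last n)) * s (i (Fin.last n)) * Complex.I := by
      rw [Finset.sum_eq_single (i (Fin.last n))]
      · simp
      · intro j _ hj
        simp [hj]
      · simp
    rw [e2]
    have e3 : ∀ k, Fin.init i k = i k.castSucc := fun k => rfl
    simp only [e3]
    ring

/-- A bound on a mixed derivative gives decay of the Fourier coefficients in the corresponding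
momenta: take differences with half a period as step. -/
lemma norm_angleCoeff_le_prod {ψ : (I → ℝ) → ℂ} (h : AnglePeriodic ψ)
    (hc : ContDiff ℝ ((⊤ : ℕ∞) : WithTop ℕ∞) ψ) {X : Type*} [Fintype X] (g : X → I) {C : ℝ}
    (hC : ∀ x, ‖iteratedFDeriv ℝ (Fintype.card X) ψ x
      fun k => Pi.single (g ((Fintype.equivFin X).symm k)) 1‖ ≤ C)
    {q : I → ℤ} (hq : ∀ y, q (g y) ≠ 0) :
    ‖angleCoeff ψ q‖ ≤ C * ∏ y, (Real.pi / bracket (q (g y))) := by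
  set n := Fintype.card X
  set i : Fin n → I := fun k => g ((Fintype.equivFin X).symm k) with hi
  set s : I → ℝ := fun j => Real.pi / q j with hs
  have hC0 : 0 ≤ C := (norm_nonneg _).trans (hC 0)
  have h1 := norm_angleCoeff_le (norm_stepDiffs_le s hc i hC) q
  rw [angleCoeff_stepDiffs h hc, norm_mul, norm_prod] at h1
  have hexp : ∀ k, ‖Complex.exp (q (i k) * s (i k) * Complex.I) - 1‖ = 2 := by
    intro k
    have hne : (q (i k) : ℂ) ≠ 0 := by exact_mod_cast hq _
    have : (q (i k) : ℂ) * s (i k) * Complex.I = Real.pi * Complex.I := by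
      simp only [hs]; push_cast; field_simp
    rw [this, Complex.exp_pi_mul_I]
    norm_num
  simp only [hexp, Finset.prod_const, Finset.card_univ, Fintype.card_fin] at h1
  have h2 : ∏ k, |s (i k)| ≤ 2 ^ n * ∏ y, (Real.pi / bracket (q (g y))) := by
    rw [← (Fintype.equivFin X).symm.prod_comp fun y => Real.pi / bracket (q (g y))]
    have e : (2 : ℝ) ^ n = ∏ _k : Fin n, (2 : ℝ) := by simp
    rw [e, ← Finset.prod_mul_distrib]
    refine Finset.prod_le_prod (fun k _ => abs_nonneg _) fun k _ => ?_
    have hπ := Real.pi_pos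
    have h1q : (1 : ℝ) ≤ |(q (i k) : ℝ)| := by
      have := Int.one_le_abs (hq ((Fintype.equivFin X).symm k))
      exact_mod_cast this
    simp only [hs, abs_div, abs_of_pos hπ, bracket]
    rw [← mul_div_assoc, div_le_div_iff₀ (by linarith) (by positivity)]
    simp only [hi] at h1q ⊢
    nlinarith
  have h3 : 2 ^ n * ‖angleCoeff ψ q‖ ≤ 2 ^ n * (C * ∏ y, (Real.pi / bracket (q (g y)))) := by
    refine h1.trans ((mul_le_mul_of_nonneg_left h2 hC0).trans (le_of_eq (by ring)))
  exact le_of_mul_le_mul_left h3 (by positivity)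

end PeriodicFunctions

/-! ### Sums over products -/

section SumsOfProducts

variable {J ι : Type*} [Fintype J]

lemma summable_prod_pi {g : J → ι → ℝ} (h0 : ∀ j n, 0 ≤ g j n) (hs : ∀ j, Summable (g j)) :
    Summable fun n : J → ι => ∏ j, g j (n j) := by
  classical
  refine summable_of_sum_le (c := ∏ j, ∑' n, g j n)
    (fun n => Finset.prod_nonneg fun j _ => h0 j _) fun u => ?_
  have hsub : u ⊆ Fintype.piFinset fun j => u.image fun n => n j := fun n hn =>
    Fintype.mem_piFinset.2 fun j => Finset.mem_image_of_mem (fun n : J → ι => n j) hn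
  have h1 := Finset.sum_le_sum_of_subset_of_nonneg (f := fun n : J → ι => ∏ j, g j (n j)) hsub
    fun n _ _ => Finset.prod_nonneg fun j _ => h0 j _
  have h2 := Finset.prod_univ_sum (fun j => u.image fun n => n j) g
  rw [← h2] at h1
  exact h1.trans (Finset.prod_le_prod (fun j _ => Finset.sum_nonneg fun n _ => h0 j n)
    fun j _ => (hs j).sum_le_tsum _ fun n _ => h0 j n)

/-- A product of absolutely convergent series is the series of the products. -/
lemma hasSum_prod_pi {g : J → ι → ℂ} {z : J → ℂ} (h : ∀ j, HasSum (g j) (z j))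
    (hn : ∀ j, Summable fun n => ‖g j n‖) :
    HasSum (fun n : J → ι => ∏ j, g j (n j)) (∏ j, z j) := by
  classical
  have hs : Summable fun n : J → ι => ∏ j, g j (n j) := by
    refine Summable.of_norm ?_
    simp only [norm_prod]
    exact summable_prod_pi (g := fun j n => ‖g j n‖) (fun j n => norm_nonneg _) hn
  -- the partial sums over boxes factorize
  have hbox : Filter.Tendsto (fun u : Finset ι => Fintype.piFinset fun _ : J => u)
      Filter.atTop Filter.atTop := by
    refine Filter.tendsto_atTop_atTop.2 fun w =>
      ⟨w.biUnion fun n => Finset.univ.image n, fun u hu n hn => ?_⟩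
    exact Fintype.mem_piFinset.2 fun j => hu (Finset.mem_biUnion.2
      ⟨n, hn, Finset.mem_image_of_mem n (Finset.mem_univ j)⟩)
  have h1 := hs.hasSum.comp hbox
  have h2 : Filter.Tendsto (fun u : Finset ι => ∏ j, ∑ n ∈ u, g j n) Filter.atTop
      (nhds (∏ j, z j)) := tendsto_finsetProd _ fun j _ => h j
  have h3 : ((fun s : Finset (J → ι) => ∑ n ∈ s, ∏ j, g j (n j)) ∘
      fun u : Finset ι => Fintype.piFinset fun _ : J => u) = fun u => ∏ j, ∑ n ∈ u, g j n :=
    funext fun u => (Finset.prod_univ_sum (fun _ => u) g).symm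
  rw [h3] at h1
  rw [← tendsto_nhds_unique h1 h2]
  exact hs.hasSum

end SumsOfProducts

/-! ### Fourier coefficients of test functions -/

section TestFunctions

variable {I : Type*} [Fintype I] [DecidableEq I]

lemma AnglePeriodic.exists_bound {E : Type*} [NormedAddCommGroup E] {ψ : (I → ℝ) → E}
    (h : AnglePeriodic ψ) (hc : Continuous ψ) : ∃ C, ∀ x, ‖ψ x‖ ≤ C := by
  have hπ := Real.pi_pos
  obtain ⟨C, hC⟩ := (isCompact_Icc (a := (0 : I → ℝ)) (b := fun _ => 2 * Real.pi)).exists_bound_of_continuousOn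
    hc.continuousOn
  refine ⟨C, fun x => ?_⟩
  rw [← h.add_int x fun i => -⌊x i / (2 * Real.pi)⌋]
  refine hC _ ⟨fun i => ?_, fun i => ?_⟩
  · have := Int.floor_le (x i / (2 * Real.pi))
    rw [le_div_iff₀ (by positivity)] at this
    simp only [Pi.add_apply, Pi.zero_apply]
    push_cast
    linarith
  · have := (Int.lt_floor_add_one (x i / (2 * Real.pi))).le
    rw [div_le_iff₀ (by positivity)] at this
    simp only [Pi.add_apply]
    push_cast
    linarith

lemma AnglePeriodic.iteratedFDeriv {ψ : (I → ℝ) → ℂ} (h : AnglePeriodic ψ) (n : ℕ) :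
    AnglePeriodic (iteratedFDeriv ℝ n ψ) := fun x i => by
  rw [← iteratedFDeriv_comp_add_right, funext fun x => h x i]

lemma exists_bound_iteratedFDeriv {ψ : (I → ℝ) → ℂ} (h : AnglePeriodic ψ)
    (hc : ContDiff ℝ ((⊤ : ℕ∞) : WithTop ℕ∞) ψ) (N : ℕ) :
    ∃ C, 0 ≤ C ∧ ∀ n ≤ N, ∀ (i : Fin n → I) x,
      ‖iteratedFDeriv ℝ n ψ x fun k => Pi.single (i k) 1‖ ≤ C := by
  have h1 : ∀ n : ℕ, ∃ C, ∀ x, ‖iteratedFDeriv ℝ n ψ x‖ ≤ C := fun n =>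
    (h.iteratedFDeriv n).exists_bound (hc.continuous_iteratedFDeriv (by exact_mod_cast le_top))
  choose C hC using h1
  have hC0 : ∀ n, 0 ≤ C n := fun n => (norm_nonneg _).trans (hC n 0)
  refine ⟨∑ n ∈ Finset.range (N + 1), C n, Finset.sum_nonneg fun n _ => hC0 n,
    fun n hn i x => ?_⟩
  refine ((iteratedFDeriv ℝ n ψ x).le_opNorm _).trans ?_
  have e : ∏ k, ‖(Pi.single (i k) 1 : I → ℝ)‖ = 1 :=
    Finset.prod_eq_one fun k _ => by rw [Pi.norm_single, norm_one]
  rw [e, mul_one]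
  exact (hC n x).trans (Finset.single_le_sum (f := C) (fun n _ => hC0 n)
    (Finset.mem_range.2 (by omega)))

/-- The factor of a vanishing momentum is a power of `π`, hence at least `1`. -/
lemma prod_support_le {J : Type*} [Fintype J] (q : J → ℤ) (k : ℕ) :
    ∏ y : {i // q i ≠ 0} × Fin k, (Real.pi / bracket (q y.1.1)) ≤
      ∏ i, (Real.pi / bracket (q i)) ^ k := by
  have hπ := Real.pi_gt_three
  rw [Fintype.prod_prod_type]
  simp only [Finset.prod_const, Finset.card_univ, Fintype.card_fin]
  rw [← Finset.prod_filter_mul_prod_filter_not Finset.univ fun i => q i ≠ 0,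
    Finset.prod_subtype (p := fun i => q i ≠ 0) (Finset.univ.filter fun i => q i ≠ 0) (by simp)]
  refine le_mul_of_one_le_right (Finset.prod_nonneg fun y _ => ?_) ?_
  · have := bracket_pos (q y.1)
    positivity
  · have : ∀ i ∈ Finset.univ.filter (fun i => ¬ q i ≠ 0), (Real.pi / bracket (q i)) ^ k =
        Real.pi ^ k := by
      intro i hi
      have : q i = 0 := by simpa using hi
      simp [this, bracket]
    rw [Finset.prod_congr rfl this, Finset.prod_const]
    exact one_le_pow₀ (one_le_pow₀ (by linarith))

/-- Two derivatives in each variable make the Fourier series absolutely convergent. -/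
lemma summable_angleCoeff {ψ : (I → ℝ) → ℂ} (h : AnglePeriodic ψ)
    (hc : ContDiff ℝ ((⊤ : ℕ∞) : WithTop ℕ∞) ψ) : Summable fun q => ‖angleCoeff ψ q‖ := by
  obtain ⟨C, hC0, hC⟩ := exists_bound_iteratedFDeriv h hc (Fintype.card (I × Fin 2))
  have hs := summable_prod_pi (J := I) (g := fun _ n => (Real.pi / bracket n) ^ 2)
    (fun _ _ => sq_nonneg _) fun _ => by
      have := (summable_bracket (b := 2) (by norm_num)).mul_left (Real.pi ^ 2)
      refine this.congr fun n => ?_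
      have hb := bracket_pos n
      rw [div_pow, div_eq_mul_inv, Real.rpow_neg hb.le]
      congr 2
      exact_mod_cast Real.rpow_natCast (bracket n) 2
  refine Summable.of_nonneg_of_le (fun q => norm_nonneg _) (fun q => ?_) (hs.mul_left C)
  have hcard : Fintype.card ({i // q i ≠ 0} × Fin 2) ≤ Fintype.card (I × Fin 2) := by
    rw [Fintype.card_prod, Fintype.card_prod]
    exact Nat.mul_le_mul_right _ (Fintype.card_subtype_le _)
  exact (norm_angleCoeff_le_prod h hc (fun y : {i // q i ≠ 0} × Fin 2 => y.1.1)
    (fun x => hC _ hcard (fun k => ((Fintype.equivFin _).symm k).1.1) x) fun y => y.1.2).trans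
    (mul_le_mul_of_nonneg_left (prod_support_le q 2) hC0)

end TestFunctions

namespace FeynmanGraph

variable {G : FeynmanGraph} {φ : (G.ExtLeg × Fin 4 → ℝ) → ℂ} {C : ℝ}

lemma IsTestFunction.norm_le (h : G.IsTestFunction φ C) (x : G.ExtLeg × Fin 4 → ℝ) : ‖φ x‖ ≤ C := by
  have := h.bound 0 ⟨Fin.elim0, fun i => i.elim0⟩ x
  simpa using this

lemma IsTestFunction.nonneg (h : G.IsTestFunction φ C) : 0 ≤ C :=
  (norm_nonneg _).trans (h.norm_le 0)

lemma IsTestFunction.anglePeriodic (h : G.IsTestFunction φ C) : AnglePeriodic φ := fun x i => by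
  convert h.periodic x i

/-- One bounded derivative in each variable makes the Fourier coefficients of a test function decay
like the inverse of each momentum. -/
lemma IsTestFunction.norm_angleCoeff_le (h : G.IsTestFunction φ C) (q : G.ExtLeg × Fin 4 → ℤ) :
    ‖angleCoeff φ q‖ ≤ C * ∏ i, (Real.pi / bracket (q i)) := by
  have hle := prod_support_le q 1
  simp only [pow_one] at hle
  refine (norm_angleCoeff_le_prod h.anglePeriodic h.smooth
    (fun y : {i // q i ≠ 0} × Fin 1 => y.1.1) (fun x => ?_) fun y => y.1.2).trans
    (mul_le_mul_of_nonneg_left hle h.nonneg)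
  have := h.bound _ ⟨fun k => ((Fintype.equivFin ({i // q i ≠ 0} × Fin 1)).symm k).1.1,
    fun a b hab => (Fintype.equivFin _).symm.injective
      (Prod.ext (Subtype.ext hab) (Subsingleton.elim _ _))⟩ x
  convert this
  rfl

end FeynmanGraph

/-! ### The heat kernel as a Fourier series -/

lemma summable_exp_neg_mul_sq {α : ℝ} (hα : 0 < α) :
    Summable fun n : ℤ => Real.exp (-(α * (n : ℝ) ^ 2)) := by
  have h1 : Summable fun n : ℤ => (1 + α⁻¹) * (2 * bracket n ^ (-2 : ℝ)) * 2 :=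
    (((summable_bracket (b := 2) (by norm_num)).mul_left 2).mul_left _).mul_right 2
  refine h1.of_nonneg_of_le (fun n => (Real.exp_pos _).le) fun n => ?_
  have hb := bracket_pos n
  have e : bracket n ^ (-2 : ℝ) = (bracket n ^ 2)⁻¹ := by
    rw [Real.rpow_neg hb.le]
    congr 1
    exact_mod_cast Real.rpow_natCast (bracket n) 2
  have h2 : bracket n ^ 2 ≤ 2 * (1 + (n : ℝ) ^ 2) := by
    rw [bracket, ← sq_abs (n : ℝ)]
    nlinarith [sq_nonneg (1 - |(n : ℝ)|)]
  have h3 := mul_exp_neg_le (α * (n : ℝ) ^ 2)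
  have h4 : Real.exp (-(α * (n : ℝ) ^ 2)) ≤ 1 :=
    Real.exp_le_one_iff.2 (by have := mul_nonneg hα.le (sq_nonneg (n : ℝ)); linarith)
  have h5 : (1 + (n : ℝ) ^ 2) * Real.exp (-(α * (n : ℝ) ^ 2)) ≤ 1 + α⁻¹ := by
    have : (n : ℝ) ^ 2 * Real.exp (-(α * (n : ℝ) ^ 2)) ≤ α⁻¹ := by
      rw [← one_div, le_div_iff₀ hα]; linarith
    linarith
  rw [e]
  have h6 : Real.exp (-(α * (n : ℝ) ^ 2)) * bracket n ^ 2 ≤ 2 * (1 + α⁻¹) := by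
    calc _ ≤ Real.exp (-(α * (n : ℝ) ^ 2)) * (2 * (1 + (n : ℝ) ^ 2)) := by gcongr
      _ ≤ _ := by linarith
  have h7 : Real.exp (-(α * (n : ℝ) ^ 2)) ≤ 2 * (1 + α⁻¹) * (bracket n ^ 2)⁻¹ := by
    rw [← div_eq_mul_inv, le_div_iff₀ (by positivity)]
    exact h6
  have h8 : 0 ≤ 2 * (1 + α⁻¹) * (bracket n ^ 2)⁻¹ := by positivity
  linarith

/-- Poisson summation for the heat kernel. -/
lemma hasSum_heatKernel {α : ℝ} (hα : 0 < α) (u : ℝ) :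
    HasSum (fun n : ℤ => (Real.exp (-(α * (n : ℝ) ^ 2)) : ℂ) * Complex.exp (n * u * Complex.I))
      (heatKernel α u : ℂ) := by
  have hπ := Real.pi_pos
  have hs : Summable fun n : ℤ => (Real.exp (-(α * (n : ℝ) ^ 2)) : ℂ) *
      Complex.exp (n * u * Complex.I) := by
    refine Summable.of_norm ((summable_exp_neg_mul_sq hα).congr fun n => ?_)
    have : ((n : ℂ) * u * Complex.I) = ((n * u : ℝ) : ℂ) * Complex.I := by push_cast; ring
    rw [norm_mul, this, Complex.norm_exp_ofReal_mul_I, mul_one, Complex.norm_real,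
      Real.norm_of_nonneg (Real.exp_pos _).le]
  have ha : 0 < ((α / Real.pi : ℝ) : ℂ).re := by
    rw [Complex.ofReal_re]; positivity
  have h1 := Complex.tsum_exp_neg_quadratic ha (u * Complex.I / (2 * Real.pi))
  have hαc : (α : ℂ) ≠ 0 := by exact_mod_cast hα.ne'
  have hπc : (Real.pi : ℂ) ≠ 0 := by exact_mod_cast hπ.ne'
  have h2 : ∑' n : ℤ, (Real.exp (-(α * (n : ℝ) ^ 2)) : ℂ) * Complex.exp (n * u * Complex.I) =
      heatKernel α u := by
    have e1 : ∀ n : ℤ, (Real.exp (-(α * (n : ℝ) ^ 2)) : ℂ) * Complex.exp (n * u * Complex.I) =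
        Complex.exp (-Real.pi * ((α / Real.pi : ℝ) : ℂ) * n ^ 2 +
          2 * Real.pi * (u * Complex.I / (2 * Real.pi)) * n) := by
      intro n
      rw [Complex.ofReal_exp, ← Complex.exp_add]
      congr 1
      push_cast
      field_simp
    rw [tsum_congr e1, h1, heatKernel]
    push_cast
    have e2 : (1 : ℂ) / ((α / Real.pi : ℂ)) ^ (1 / 2 : ℂ) = ((Real.sqrt (Real.pi / α) : ℝ) : ℂ) := by
      rw [Real.sqrt_eq_rpow, ← inv_div α Real.pi, Real.inv_rpow (by positivity), Complex.ofReal_inv,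
        Complex.ofReal_cpow (by positivity)]
      push_cast
      rw [one_div]
    rw [e2]
    congr 1
    refine tsum_congr fun n => ?_
    congr 1
    have e3 : (n : ℂ) + Complex.I * (u * Complex.I / (2 * Real.pi)) =
        (2 * Real.pi * n - u) / (2 * Real.pi) := by
      have : Complex.I * (u * Complex.I / (2 * Real.pi)) =
          (Complex.I * Complex.I) * u / (2 * Real.pi) := by ring
      rw [this, Complex.I_mul_I]
      field_simp
      ring
    rw [e3]
    field_simp
    ring
  rw [← h2]
  exact hs.hasSum

/-! ### Integration of the amplitude -/

section Integration

/-- Term by term integration of a series that converges absolutely after integration. -/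
lemma integrable_and_hasSum_integral {α ι E : Type*} [MeasurableSpace α] {μ : Measure α}
    [NormedAddCommGroup E] [NormedSpace ℝ E] [Countable ι] {F : ι → α → E} {f : α → E}
    (hF : ∀ i, Integrable (F i) μ) (hs : Summable fun i => ∫ a, ‖F i a‖ ∂μ)
    (h : ∀ᵐ a ∂μ, HasSum (fun i => F i a) (f a)) :
    Integrable f μ ∧ HasSum (fun i => ∫ a, F i a ∂μ) (∫ a, f a ∂μ) := by
  refine ⟨⟨?_, ?_⟩, ?_⟩
  · refine aestronglyMeasurable_of_tendsto_ae (f := fun (s : Finset ι) a => ∑ i ∈ s, F i a)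
      Filter.atTop (fun s => ?_) h
    exact (integrable_finsetSum s fun i _ => hF i).aestronglyMeasurable
  · have h1 : ∀ i, ∫⁻ a, ‖F i a‖ₑ ∂μ = ENNReal.ofReal (∫ a, ‖F i a‖ ∂μ) := fun i =>
      (ofReal_integral_norm_eq_lintegral_enorm (hF i)).symm
    have h2 : ∫⁻ a, ∑' i, ‖F i a‖ₑ ∂μ < ⊤ := by
      rw [lintegral_tsum fun i => (hF i).aestronglyMeasurable.enorm, tsum_congr h1,
        ← ENNReal.ofReal_tsum_of_nonneg (fun i => integral_nonneg fun a => norm_nonneg _) hs]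
      exact ENNReal.ofReal_lt_top
    refine lt_of_le_of_lt (lintegral_mono_ae ?_) h2
    filter_upwards [h] with a ha
    rw [← ha.tsum_eq]
    exact enorm_tsum_le_tsum_enorm
  · have h1 := hasSum_integral_of_summable_integral_norm hF hs
    rwa [integral_congr_ae (h.mono fun a ha => ha.tsum_eq)] at h1

lemma hasSum_mul_of_norm {ι κ : Type*} {f : ι → ℂ} {g : κ → ℂ} {s t : ℂ} (hf : HasSum f s)
    (hg : HasSum g t) (hfn : Summable fun i => ‖f i‖) (hgn : Summable fun k => ‖g k‖) :
    HasSum (fun x : ι × κ => f x.1 * g x.2) (s * t) :=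
  hf.mul hg (summable_mul_of_summable_norm hfn hgn)

instance : IsProbabilityMeasure angleMeasure := by
  have hπ := Real.pi_pos
  refine ⟨?_⟩
  rw [angleMeasure, Measure.smul_apply, Measure.restrict_apply_univ, Real.volume_Ioc, sub_zero,
    smul_eq_mul]
  exact ENNReal.inv_mul_cancel (by simpa using hπ) ENNReal.ofReal_ne_top

lemma integral_angle_exp (n : ℤ) :
    ∫ θ, Complex.exp (n * θ * Complex.I) ∂angleMeasure = if n = 0 then 1 else 0 := by
  have hπ := Real.pi_pos
  split_ifs with h
  · simp [h]
  · rw [angleMeasure, integral_smul_measure, ← intervalIntegral.integral_of_le (by positivity)]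
    have hc : (n : ℂ) * Complex.I ≠ 0 := mul_ne_zero (by exact_mod_cast h) Complex.I_ne_zero
    have h1 := integral_exp_mul_complex (a := 0) (b := 2 * Real.pi) hc
    have h2 : ∀ θ : ℝ, Complex.exp (n * θ * Complex.I) = Complex.exp (n * Complex.I * θ) := by
      intro θ; congr 1; ring
    simp only [h2, h1]
    have h3 : Complex.exp (n * Complex.I * ((2 * Real.pi : ℝ) : ℂ)) = 1 := by
      rw [← Complex.exp_int_mul_two_pi_mul_I n]
      congr 1; push_cast; ring
    rw [h3]
    simp

lemma integrable_angle_exp (n : ℤ) :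
    Integrable (fun θ : ℝ => Complex.exp (n * θ * Complex.I)) angleMeasure := by
  refine Integrable.of_bound (C := 1) (by fun_prop) (Filter.Eventually.of_forall fun θ => ?_)
  have : ((n : ℂ) * θ * Complex.I) = ((n * θ : ℝ) : ℂ) * Complex.I := by push_cast; ring
  rw [this, Complex.norm_exp_ofReal_mul_I]

lemma integrable_exp_neg_mul {s : ℝ} (hs : 0 < s) (t : ℝ) :
    Integrable (fun α : ℝ => Real.exp (-(α * s))) (volume.restrict (Set.Ici t)) := by
  have h := integrableOn_exp_mul_Ioi (neg_lt_zero.2 hs) t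
  rw [← integrableOn_Ici_iff_integrableOn_Ioi] at h
  exact h.congr (Filter.Eventually.of_forall fun α => by ring_nf)

lemma integral_exp_neg_mul {m t s : ℝ} (hs : 0 < m ^ 2 + s) :
    ∫ α in Set.Ici t, Real.exp (-(α * (m ^ 2 + s))) = propagator m t s := by
  have h := integral_exp_mul_Ioi (neg_lt_zero.2 hs) t
  rw [← integral_Ici_eq_integral_Ioi] at h
  have e : ∀ α : ℝ, Real.exp (-(α * (m ^ 2 + s))) = Real.exp (-(m ^ 2 + s) * α) := by
    intro α; ring_nf
  simp only [e, h, propagator]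
  rw [neg_div_neg_eq]

end Integration

namespace FeynmanGraph

variable {G : FeynmanGraph}

lemma integral_product {𝕜 : Type*} [RCLike 𝕜] (M : ℝ) (ρ : ℕ) (k : 𝕜) {A B : G.Line → ℝ → 𝕜}
    {D : Fin 4 × G.White → ℝ → 𝕜}
    (hA : ∀ e, Integrable (A e) (volume.restrict (Set.Ici ((M ^ (2 * ρ))⁻¹))))
    (hB : ∀ e, Integrable (B e) angleMeasure) (hD : ∀ y, Integrable (D y) angleMeasure) :
    Integrable (fun x : (G.Line → ℝ) × (G.Line → ℝ) × (Fin 4 × G.White → ℝ) =>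
      k * ((∏ e, A e (x.1 e)) * ((∏ e, B e (x.2.1 e)) * ∏ y, D y (x.2.2 y))))
      (G.cutoffMeasure M ρ) ∧
    ∫ x, k * ((∏ e, A e (x.1 e)) * ((∏ e, B e (x.2.1 e)) * ∏ y, D y (x.2.2 y)))
      ∂(G.cutoffMeasure M ρ) =
      k * ((∏ e, ∫ α in Set.Ici ((M ^ (2 * ρ))⁻¹), A e α) *
        ((∏ e, ∫ h, B e h ∂angleMeasure) * ∏ y, ∫ θ, D y θ ∂angleMeasure)) := by
  constructor
  · exact ((Integrable.fintype_prod hA).mul_prod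
      ((Integrable.fintype_prod hB).mul_prod (Integrable.fintype_prod hD))).const_mul k
  · rw [integral_const_mul, cutoffMeasure,
      integral_prod_mul (fun x : G.Line → ℝ => ∏ e, A e (x e))
        (fun z : (G.Line → ℝ) × (Fin 4 × G.White → ℝ) => (∏ e, B e (z.1 e)) * ∏ y, D y (z.2 y)),
      integral_prod_mul (fun x : G.Line → ℝ => ∏ e, B e (x e))
        (fun z : Fin 4 × G.White → ℝ => ∏ y, D y (z y)),
      integral_fintype_prod_eq_prod, integral_fintype_prod_eq_prod, integral_fintype_prod_eq_prod]

/-- The failure of momentum conservation on the colored lines, when the momenta that leave the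
white nodes are carried along `σ`. -/
noncomputable def defect (σ : Fin 4 → G.White → G.White) (x : G.Momenta) (y : Fin 4 × G.White) : ℤ :=
  ∑ w', (if σ y.1 w' = y.2 then whiteMom x y.1 w' else 0) -
    blackMom x y.1 (G.coloredLine y.1 y.2)

variable (G) in
/-- White nodes carry a line or an external leg. -/
noncomputable def whiteEquiv : G.Line ⊕ G.WhiteLeg ≃ G.White :=
  Equiv.ofBijective (Sum.elim G.whiteEnd Subtype.val) (by
    constructor
    · rintro (e | v) (e' | v') h
      · exact congrArg Sum.inl (G.whiteEnd.injective h)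
      · exact absurd h (v'.2 e)
      · exact absurd h.symm (v.2 e')
      · exact congrArg Sum.inr (Subtype.ext h)
    · intro w
      rcases white_cases w with ⟨e, rfl⟩ | ⟨v, rfl⟩
      · exact ⟨Sum.inl e, rfl⟩
      · exact ⟨Sum.inr v, rfl⟩)

variable (G) in
/-- Black nodes carry a line or an external leg. -/
noncomputable def blackEquiv : G.Line ⊕ G.BlackLeg ≃ G.Black :=
  Equiv.ofBijective (Sum.elim G.blackEnd Subtype.val) (by
    constructor
    · rintro (e | v) (e' | v') h
      · exact congrArg Sum.inl (G.blackEnd.injective h)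
      · exact absurd h (v'.2 e)
      · exact absurd h.symm (v.2 e')
      · exact congrArg Sum.inr (Subtype.ext h)
    · intro b
      rcases black_cases b with ⟨e, rfl⟩ | ⟨v, rfl⟩
      · exact ⟨Sum.inl e, rfl⟩
      · exact ⟨Sum.inr v, rfl⟩)

lemma sum_white (f : G.White → ℝ) :
    ∑ w, f w = ∑ e, f (G.whiteEnd e) + ∑ v : G.WhiteLeg, f v.1 := by
  rw [← G.whiteEquiv.sum_comp, Fintype.sum_sum_type]
  rfl

lemma sum_black (f : G.Black → ℝ) :
    ∑ b, f b = ∑ e, f (G.blackEnd e) + ∑ v : G.BlackLeg, f v.1 := by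
  rw [← G.blackEquiv.sum_comp, Fintype.sum_sum_type]
  rfl

/-- The angles at the external legs when the white ones are transported along `σ`. -/
def transportedAngles (σ : Fin 4 → G.White → G.White) (θ : Fin 4 × G.White → ℝ) :
    G.ExtLeg × Fin 4 → ℝ
  | (Sum.inl w, c) => θ (c, σ c w.1)
  | (Sum.inr b, c) => θ (c, (G.coloredLine c).symm b.1)

/-- The phases of the heat kernels and of the test function, collected by holonomies and angles. -/
lemma sum_defect (σ : Fin 4 → G.White → G.White) (x : G.Momenta) (h : G.Line → ℝ)
    (θ : Fin 4 × G.White → ℝ) :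
    ∑ e, ∑ c, (x.1 e c : ℝ) * (θ (c, σ c (G.whiteEnd e)) + h e -
        θ (c, (G.coloredLine c).symm (G.blackEnd e))) +
      ∑ i, (x.2 i : ℝ) * transportedAngles σ θ i =
    ∑ e, ((∑ c, x.1 e c : ℤ) : ℝ) * h e + ∑ y, (defect σ x y : ℝ) * θ y := by
  have h1 : ∀ c, ∑ w, (defect σ x (c, w) : ℝ) * θ (c, w) =
      ∑ w, (whiteMom x c w : ℝ) * θ (c, σ c w) -
        ∑ b, (blackMom x c b : ℝ) * θ (c, (G.coloredLine c).symm b) := by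
    intro c
    rw [← (G.coloredLine c).sum_comp fun b =>
      (blackMom x c b : ℝ) * θ (c, (G.coloredLine c).symm b)]
    simp only [defect, Int.cast_sub, sub_mul, Finset.sum_sub_distrib, Equiv.symm_apply_apply]
    congr 1
    push_cast
    simp only [Finset.sum_mul]
    rw [Finset.sum_comm]
    refine Finset.sum_congr rfl fun w' _ => ?_
    rw [Finset.sum_eq_single (σ c w')]
    · rw [if_pos rfl]
    · intro w _ hw
      rw [if_neg hw.symm, zero_mul]
    · simp
  have h2 : ∀ c, ∑ w, (whiteMom x c w : ℝ) * θ (c, σ c w) =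
      ∑ e, (x.1 e c : ℝ) * θ (c, σ c (G.whiteEnd e)) +
        ∑ v : G.WhiteLeg, (x.2 (Sum.inl v, c) : ℝ) * θ (c, σ c v.1) := by
    intro c
    rw [sum_white]
    simp only [whiteMom_whiteEnd, whiteMom_leg]
  have h3 : ∀ c, ∑ b, (blackMom x c b : ℝ) * θ (c, (G.coloredLine c).symm b) =
      ∑ e, (x.1 e c : ℝ) * θ (c, (G.coloredLine c).symm (G.blackEnd e)) -
        ∑ v : G.BlackLeg, (x.2 (Sum.inr v, c) : ℝ) * θ (c, (G.coloredLine c).symm v.1) := by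
    intro c
    rw [sum_black]
    simp only [blackMom_blackEnd, blackMom_leg]
    push_cast
    simp only [neg_mul, Finset.sum_neg_distrib]
    ring
  have h4 : ∑ i, (x.2 i : ℝ) * transportedAngles σ θ i =
      ∑ c, (∑ v : G.WhiteLeg, (x.2 (Sum.inl v, c) : ℝ) * θ (c, σ c v.1) +
        ∑ v : G.BlackLeg, (x.2 (Sum.inr v, c) : ℝ) * θ (c, (G.coloredLine c).symm v.1)) := by
    rw [Fintype.sum_prod_type_right]
    refine Finset.sum_congr rfl fun c _ => ?_
    rw [Fintype.sum_sum_type]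
    rfl
  rw [h4, Fintype.sum_prod_type]
  simp only [h1, h2, h3, Int.cast_sum, Finset.sum_mul]
  rw [Finset.sum_comm (f := fun e c => (x.1 e c : ℝ) * (θ (c, σ c (G.whiteEnd e)) + h e -
        θ (c, (G.coloredLine c).symm (G.blackEnd e)))),
    Finset.sum_comm (f := fun e c => (x.1 e c : ℝ) * h e), ← Finset.sum_add_distrib,
    ← Finset.sum_add_distrib]
  refine Finset.sum_congr rfl fun c _ => ?_
  simp only [mul_add, mul_sub, Finset.sum_add_distrib, Finset.sum_sub_distrib]
  ring

/-- The Fourier mode of the integrand, as a product of functions of the Schwinger parameters, of the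
holonomies and of the angles. -/
noncomputable def mode (m : ℝ) (σ : Fin 4 → G.White → G.White) (φ : (G.ExtLeg × Fin 4 → ℝ) → ℂ)
    (x : G.Momenta) (z : (G.Line → ℝ) × (G.Line → ℝ) × (Fin 4 × G.White → ℝ)) : ℂ :=
  angleCoeff φ x.2 *
    ((∏ e, (Real.exp (-(z.1 e * (m ^ 2 + ∑ c, (x.1 e c : ℝ) ^ 2))) : ℂ)) *
    ((∏ e, Complex.exp ((∑ c, x.1 e c : ℤ) * z.2.1 e * Complex.I)) *
      ∏ y, Complex.exp (defect σ x y * z.2.2 y * Complex.I)))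

lemma norm_exp_int_mul (n : ℤ) (θ : ℝ) : ‖Complex.exp (n * θ * Complex.I)‖ = 1 := by
  have : ((n : ℂ) * θ * Complex.I) = ((n * θ : ℝ) : ℂ) * Complex.I := by push_cast; ring
  rw [this, Complex.norm_exp_ofReal_mul_I]

lemma norm_mode (m : ℝ) (σ : Fin 4 → G.White → G.White) (φ : (G.ExtLeg × Fin 4 → ℝ) → ℂ)
    (x : G.Momenta) (z : (G.Line → ℝ) × (G.Line → ℝ) × (Fin 4 × G.White → ℝ)) :
    ‖mode m σ φ x z‖ = ‖angleCoeff φ x.2‖ *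
      ((∏ e, Real.exp (-(z.1 e * (m ^ 2 + ∑ c, (x.1 e c : ℝ) ^ 2)))) *
        ((∏ _e : G.Line, (1 : ℝ)) * ∏ _y : Fin 4 × G.White, (1 : ℝ))) := by
  rw [mode, norm_mul, norm_mul, norm_mul, norm_prod, norm_prod, norm_prod]
  simp only [norm_exp_int_mul, Complex.norm_real, Real.norm_of_nonneg (Real.exp_pos _).le]

lemma integrable_mode {m : ℝ} (hm : m ≠ 0) (σ : Fin 4 → G.White → G.White)
    (φ : (G.ExtLeg × Fin 4 → ℝ) → ℂ) (M : ℝ) (ρ : ℕ) (x : G.Momenta) :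
    Integrable (mode m σ φ x) (G.cutoffMeasure M ρ) :=
  (integral_product M ρ (angleCoeff φ x.2)
    (A := fun e α => ((Real.exp (-(α * (m ^ 2 + ∑ c, (x.1 e c : ℝ) ^ 2))) : ℝ) : ℂ))
    (B := fun e h => Complex.exp ((∑ c, x.1 e c : ℤ) * h * Complex.I))
    (D := fun y θ => Complex.exp (defect σ x y * θ * Complex.I))
    (fun _ => (integrable_exp_neg_mul (by positivity) _).ofReal)
    (fun _ => integrable_angle_exp _) fun _ => integrable_angle_exp _).1

lemma integral_norm_mode {m : ℝ} (hm : m ≠ 0) (σ : Fin 4 → G.White → G.White)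
    (φ : (G.ExtLeg × Fin 4 → ℝ) → ℂ) (M : ℝ) (ρ : ℕ) (x : G.Momenta) :
    ∫ z, ‖mode m σ φ x z‖ ∂(G.cutoffMeasure M ρ) =
      ‖angleCoeff φ x.2‖ * ∏ e, propagator m (M ^ (2 * ρ))⁻¹ (∑ c, (x.1 e c : ℝ) ^ 2) := by
  simp only [norm_mode]
  rw [(integral_product M ρ ‖angleCoeff φ x.2‖
    (A := fun e α => Real.exp (-(α * (m ^ 2 + ∑ c, (x.1 e c : ℝ) ^ 2))))
    (B := fun _ _ => 1) (D := fun _ _ => 1)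
    (fun e => integrable_exp_neg_mul (by positivity) _) (fun e => integrable_const _)
    fun y => integrable_const _).2]
  simp only [integral_const, probReal_univ, smul_eq_mul, mul_one, Finset.prod_const_one]
  congr 1
  exact Finset.prod_congr rfl fun e _ => integral_exp_neg_mul (by positivity)

/-- The integrals over the holonomies and over the angles impose the conservation of momentum at the
lines and on the colored lines. -/
lemma integral_mode {m : ℝ} (hm : m ≠ 0) (σ : Fin 4 → G.White → G.White)
    (φ : (G.ExtLeg × Fin 4 → ℝ) → ℂ) (M : ℝ) (ρ : ℕ) (x : G.Momenta) :
    ∫ z, mode m σ φ x z ∂(G.cutoffMeasure M ρ) =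
      angleCoeff φ x.2 * (((∏ e, lineKernel m (M ^ (2 * ρ))⁻¹ (x.1 e) : ℝ) : ℂ) *
        if ∀ y, defect σ x y = 0 then 1 else 0) := by
  simp only [mode]
  rw [(integral_product M ρ (angleCoeff φ x.2)
    (A := fun e α => ((Real.exp (-(α * (m ^ 2 + ∑ c, (x.1 e c : ℝ) ^ 2))) : ℝ) : ℂ))
    (B := fun e h => Complex.exp ((∑ c, x.1 e c : ℤ) * h * Complex.I))
    (D := fun y θ => Complex.exp (defect σ x y * θ * Complex.I))
    (fun e => (integrable_exp_neg_mul (by positivity) _).ofReal)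
    (fun e => integrable_angle_exp _) fun y => integrable_angle_exp _).2]
  simp only [integral_angle_exp]
  rw [← mul_assoc (∏ e, _) (∏ e, _), ← Finset.prod_mul_distrib]
  congr 2
  · rw [Complex.ofReal_prod]
    refine Finset.prod_congr rfl fun e _ => ?_
    rw [integral_complex_ofReal, integral_exp_neg_mul (by positivity), lineKernel]
    split_ifs <;> simp
  · split_ifs with h
    · exact Finset.prod_eq_one fun y _ => if_pos (h y)
    · push Not at h
      obtain ⟨y, hy⟩ := h
      exact Finset.prod_eq_zero (Finset.mem_univ y) (if_neg hy)

/-- With a cutoff, the propagator has Gaussian decay in each momentum, which makes the sum over all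
momenta converge absolutely. -/
lemma propagator_le_gaussian {m t : ℝ} (hm : m ≠ 0) (N : Fin 4 → ℤ) :
    propagator m t (∑ c, (N c : ℝ) ^ 2) ≤
      Real.exp (-(t * m ^ 2)) / m ^ 2 * ∏ c, Real.exp (-(t * (N c : ℝ) ^ 2)) := by
  have hs : 0 ≤ ∑ c, (N c : ℝ) ^ 2 := Finset.sum_nonneg fun c _ => sq_nonneg _
  have hm2 : 0 < m ^ 2 := by positivity
  rw [propagator, ← Real.exp_sum, div_mul_eq_mul_div, ← Real.exp_add]
  have e : -(t * (m ^ 2 + ∑ c, (N c : ℝ) ^ 2)) =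
      -(t * m ^ 2) + ∑ c, -(t * (N c : ℝ) ^ 2) := by
    rw [Finset.sum_neg_distrib, ← Finset.mul_sum]; ring
  rw [e]
  gcongr
  linarith

lemma summable_integral_norm_mode {m : ℝ} (hm : m ≠ 0) (σ : Fin 4 → G.White → G.White)
    {φ : (G.ExtLeg × Fin 4 → ℝ) → ℂ} {C : ℝ} (hφ : G.IsTestFunction φ C) {M : ℝ} (hM : 1 < M)
    (ρ : ℕ) : Summable fun x => ∫ z, ‖mode m σ φ x z‖ ∂(G.cutoffMeasure M ρ) := by
  have ht : 0 < (M ^ (2 * ρ))⁻¹ := by positivity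
  set t := (M ^ (2 * ρ))⁻¹ with htdef
  have hP : ∀ N : Fin 4 → ℤ, 0 ≤ propagator m t (∑ c, (N c : ℝ) ^ 2) := fun N =>
    propagator_nonneg _ (Finset.sum_nonneg fun c _ => sq_nonneg _)
  have h1 : Summable fun N : Fin 4 → ℤ => propagator m t (∑ c, (N c : ℝ) ^ 2) :=
    Summable.of_nonneg_of_le hP (fun N => propagator_le_gaussian hm N)
      ((summable_prod_pi (fun _ n => (Real.exp_pos _).le)
        fun _ => summable_exp_neg_mul_sq ht).mul_left _)
  have h2 : Summable fun N : G.Line → Fin 4 → ℤ =>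
      ∏ e, propagator m t (∑ c, (N e c : ℝ) ^ 2) :=
    summable_prod_pi (g := fun (_ : G.Line) (N : Fin 4 → ℤ) => propagator m t (∑ c, (N c : ℝ) ^ 2))
      (fun _ N => hP N) fun _ => h1
  have h3 := summable_angleCoeff hφ.anglePeriodic hφ.smooth
  refine (h2.mul_of_nonneg h3 (fun N => Finset.prod_nonneg fun e _ => hP _)
    fun q => norm_nonneg _).congr fun x => ?_
  rw [integral_norm_mode hm, mul_comm]

/-- The Fourier mode of the four heat kernels of a line. -/
noncomputable def lineMode (m α : ℝ) (u : Fin 4 → ℝ) (N : Fin 4 → ℤ) : ℂ :=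
  (Real.exp (-(α * (m ^ 2 + ∑ c, (N c : ℝ) ^ 2))) : ℂ) *
    Complex.exp (((∑ c, (N c : ℝ) * u c : ℝ) : ℂ) * Complex.I)

lemma lineMode_eq (m α : ℝ) (u : Fin 4 → ℝ) (N : Fin 4 → ℤ) :
    lineMode m α u N = (Real.exp (-m ^ 2 * α) : ℂ) *
      ∏ c, ((Real.exp (-(α * (N c : ℝ) ^ 2)) : ℂ) * Complex.exp (N c * u c * Complex.I)) := by
  rw [Finset.prod_mul_distrib, ← mul_assoc, lineMode]
  congr 1
  · rw [← Complex.ofReal_prod, ← Real.exp_sum, ← Complex.ofReal_mul, ← Real.exp_add,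
      Finset.sum_neg_distrib, ← Finset.mul_sum]
    congr 2
    ring
  · rw [← Complex.exp_sum, Complex.ofReal_sum, Finset.sum_mul]
    congr 1
    refine Finset.sum_congr rfl fun c _ => ?_
    push_cast
    rfl

lemma norm_lineMode (m α : ℝ) (u : Fin 4 → ℝ) (N : Fin 4 → ℤ) :
    ‖lineMode m α u N‖ = Real.exp (-m ^ 2 * α) * ∏ c, Real.exp (-(α * (N c : ℝ) ^ 2)) := by
  rw [lineMode_eq, norm_mul, norm_prod, Complex.norm_real, Real.norm_of_nonneg (Real.exp_pos _).le]
  congr 1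
  refine Finset.prod_congr rfl fun c _ => ?_
  rw [norm_mul, norm_exp_int_mul, mul_one, Complex.norm_real,
    Real.norm_of_nonneg (Real.exp_pos _).le]

lemma summable_norm_lineMode (m : ℝ) {α : ℝ} (hα : 0 < α) (u : Fin 4 → ℝ) :
    Summable fun N => ‖lineMode m α u N‖ := by
  simp only [norm_lineMode]
  exact (summable_prod_pi (g := fun (_ : Fin 4) (n : ℤ) => Real.exp (-(α * (n : ℝ) ^ 2)))
    (fun _ n => (Real.exp_pos _).le) fun _ => summable_exp_neg_mul_sq hα).mul_left _

lemma hasSum_lineMode (m : ℝ) {α : ℝ} (hα : 0 < α) (u : Fin 4 → ℝ) :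
    HasSum (lineMode m α u)
      ((Real.exp (-m ^ 2 * α) * ∏ c, heatKernel α (u c) : ℝ) : ℂ) := by
  have h := (hasSum_prod_pi (g := fun c (n : ℤ) => (Real.exp (-(α * (n : ℝ) ^ 2)) : ℂ) *
    Complex.exp (n * u c * Complex.I)) (fun c => hasSum_heatKernel hα (u c)) fun c => by
      refine (summable_exp_neg_mul_sq hα).congr fun n => ?_
      rw [norm_mul, norm_exp_int_mul, mul_one, Complex.norm_real,
        Real.norm_of_nonneg (Real.exp_pos _).le]).mul_left (Real.exp (-m ^ 2 * α) : ℂ)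
  rw [Complex.ofReal_mul, Complex.ofReal_prod]
  exact (funext fun N => lineMode_eq m α u N) ▸ h

/-- The angles that are the arguments of the heat kernels. -/
def lineAngles (σ : Fin 4 → G.White → G.White) (h : G.Line → ℝ) (θ : Fin 4 × G.White → ℝ)
    (e : G.Line) (c : Fin 4) : ℝ :=
  θ (c, σ c (G.whiteEnd e)) + h e - θ (c, (G.coloredLine c).symm (G.blackEnd e))

lemma mode_eq (m : ℝ) (σ : Fin 4 → G.White → G.White) (φ : (G.ExtLeg × Fin 4 → ℝ) → ℂ)
    (α h : G.Line → ℝ) (θ : Fin 4 × G.White → ℝ) (x : G.Momenta) :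
    mode m σ φ x (α, h, θ) = (∏ e, lineMode m (α e) (lineAngles σ h θ e) (x.1 e)) *
      (angleCoeff φ x.2 *
        Complex.exp (∑ i, x.2 i * transportedAngles σ θ i * Complex.I)) := by
  have e1 : (∏ e, Complex.exp ((∑ c, x.1 e c : ℤ) * h e * Complex.I)) *
      ∏ y, Complex.exp (defect σ x y * θ y * Complex.I) =
      Complex.exp (((∑ e, ((∑ c, x.1 e c : ℤ) : ℝ) * h e +
        ∑ y, (defect σ x y : ℝ) * θ y : ℝ) : ℂ) * Complex.I) := by
    rw [← Complex.exp_sum, ← Complex.exp_sum, ← Complex.exp_add, ← Finset.sum_mul,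
      ← Finset.sum_mul, ← add_mul, Complex.ofReal_add, Complex.ofReal_sum, Complex.ofReal_sum]
    simp only [Complex.ofReal_mul, Complex.ofReal_intCast]
  have e2 : (∑ i, (x.2 i : ℂ) * (transportedAngles σ θ i : ℂ) * Complex.I) =
      ((∑ i, x.2 i * transportedAngles σ θ i : ℝ) : ℂ) * Complex.I := by
    rw [← Finset.sum_mul, Complex.ofReal_sum]
    simp only [Complex.ofReal_mul, Complex.ofReal_intCast]
  have e3 : ∏ e, lineMode m (α e) (lineAngles σ h θ e) (x.1 e) =
      (∏ e, (Real.exp (-(α e * (m ^ 2 + ∑ c, (x.1 e c : ℝ) ^ 2))) : ℂ)) *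
        Complex.exp (((∑ e, ∑ c, (x.1 e c : ℝ) * lineAngles σ h θ e c : ℝ) : ℂ) * Complex.I) := by
    simp only [lineMode]
    rw [Finset.prod_mul_distrib, ← Complex.exp_sum, ← Finset.sum_mul, Complex.ofReal_sum]
  have hphase := sum_defect σ x h θ
  rw [mode, e1, e2, e3, ← hphase, Complex.ofReal_add, add_mul, Complex.exp_add]
  simp only [lineAngles]
  ring

lemma summable_norm_angleCoeff_mul_exp {φ : (G.ExtLeg × Fin 4 → ℝ) → ℂ} {C : ℝ}
    (hφ : G.IsTestFunction φ C) (ξ : G.ExtLeg × Fin 4 → ℝ) :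
    Summable fun q : G.ExtLeg × Fin 4 → ℤ =>
      ‖angleCoeff φ q * Complex.exp (∑ i, q i * ξ i * Complex.I)‖ := by
  refine (summable_angleCoeff hφ.anglePeriodic hφ.smooth).congr fun q => ?_
  have : (∑ i, (q i : ℂ) * (ξ i : ℂ) * Complex.I) =
      ((∑ i, q i * ξ i : ℝ) : ℂ) * Complex.I := by
    rw [← Finset.sum_mul, Complex.ofReal_sum]
    simp only [Complex.ofReal_mul, Complex.ofReal_intCast]
  rw [norm_mul, this, Complex.norm_exp_ofReal_mul_I, mul_one]

lemma summable_norm_prod_lineMode (m : ℝ) {α : G.Line → ℝ} (hα : ∀ e, 0 < α e)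
    (u : G.Line → Fin 4 → ℝ) :
    Summable fun N : G.Line → Fin 4 → ℤ => ‖∏ e, lineMode m (α e) (u e) (N e)‖ := by
  refine (summable_prod_pi (g := fun e N => ‖lineMode m (α e) (u e) N‖)
    (fun _ _ => norm_nonneg _) fun e => summable_norm_lineMode m (hα e) (u e)).congr fun N => ?_
  rw [norm_prod]

/-- The Fourier expansion of the integrand. -/
lemma hasSum_mode (m : ℝ) (σ : Fin 4 → G.White → G.White)
    {φ : (G.ExtLeg × Fin 4 → ℝ) → ℂ} {C : ℝ} (hφ : G.IsTestFunction φ C)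
    {α h : G.Line → ℝ} (hα : ∀ e, 0 < α e) (θ : Fin 4 × G.White → ℝ) :
    HasSum (fun x => mode m σ φ x (α, h, θ))
      (((∏ e : G.Line, Real.exp (-m ^ 2 * α e) * ∏ c : Fin 4,
        heatKernel (α e) (lineAngles σ h θ e c) : ℝ) : ℂ) * φ (transportedAngles σ θ)) := by
  rw [funext (mode_eq m σ φ α h θ), Complex.ofReal_prod]
  generalize transportedAngles σ θ = ξ
  generalize lineAngles σ h θ = u
  have h1 : HasSum (fun N : G.Line → Fin 4 → ℤ => ∏ e, lineMode m (α e) (u e) (N e)) _ :=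
    hasSum_prod_pi (fun e => hasSum_lineMode m (hα e) (u e))
      fun e => summable_norm_lineMode m (hα e) (u e)
  have h2 := hasSum_angleCoeff hφ.anglePeriodic hφ.smooth.continuous
    (summable_angleCoeff hφ.anglePeriodic hφ.smooth).of_norm ξ
  have h3 := hasSum_mul_of_norm h1 h2 (summable_norm_prod_lineMode m hα u)
    (summable_norm_angleCoeff_mul_exp hφ ξ)
  delta Momenta
  exact h3

end FeynmanGraph

/-! ### The renormalized amplitude in momentum space -/

namespace FeynmanGraph

variable {G : FeynmanGraph}

lemma ae_schwinger_pos {M : ℝ} (hM : 1 < M) (ρ : ℕ) :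
    ∀ᵐ z ∂(G.cutoffMeasure M ρ), ∀ e, 0 < z.1 e := by
  have ht : 0 < (M ^ (2 * ρ))⁻¹ := inv_pos.2 (pow_pos (by linarith) _)
  refine Measure.quasiMeasurePreserving_fst.ae
    (p := fun α : G.Line → ℝ => ∀ e, 0 < α e) ?_
  refine Filter.eventually_all.2 fun e => ?_
  refine Measure.tendsto_eval_ae_ae (μ := fun _ : G.Line =>
    (volume.restrict (Set.Ici ((M ^ (2 * ρ))⁻¹)) : Measure ℝ)) (i := e) ?_
  filter_upwards [ae_restrict_mem measurableSet_Ici] with α hα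
  exact ht.trans_le hα

/-- In the integrand of a meloforest, the external faces of the melopoles are traversed by skipping
their roots in their free colors. -/
lemma integrand_image_melopole (hG : G.IsConnected) (hV : ¬ G.IsVacuum) {R : Finset G.Line}
    (hR : R ⊆ G.melonicLines) (m : ℝ) (φ : (G.ExtLeg × Fin 4 → ℝ) → ℂ)
    (z : (G.Line → ℝ) × (G.Line → ℝ) × (Fin 4 × G.White → ℝ)) :
    G.integrand m (R.image G.melopole) φ z =
      ((∏ e : G.Line, Real.exp (-m ^ 2 * z.1 e) * ∏ c : Fin 4, heatKernel (z.1 e)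
        (lineAngles (fun c => G.source (G.withFreeColor R c) c) z.2.1 z.2.2 e c) : ℝ) : ℂ) *
        φ (transportedAngles (fun c => G.source (G.withFreeColor R c) c) z.2.2) := by
  have h1 : G.legAngles (R.image G.melopole) z.2.2 =
      transportedAngles (fun c => G.source (G.withFreeColor R c) c) z.2.2 := by
    funext y
    rcases y with ⟨w | b, c⟩
    · simp only [legAngles, transportedAngles, source_leg hG hV hR c w.2]
    · rfl
  simp only [integrand, h1, lineAngles, source_line hG hV hR]

lemma defect_eq_zero_iff {R : Finset G.Line} {x : G.Momenta} :
    (∀ y, defect (fun c => G.source (G.withFreeColor R c) c) x y = 0) ↔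
      x ∈ G.skipSolutions R := by
  simp only [defect, sub_eq_zero, Prod.forall, skipSolutions, Set.mem_ofPred_eq]

/-- The amplitude of a meloforest in momentum space: the lines which are the roots of the melopoles
lose the momentum of their free color. -/
lemma integrable_integrand_and_hasSum (hG : G.IsConnected) (hV : ¬ G.IsVacuum)
    {R : Finset G.Line} (hR : R ⊆ G.melonicLines) {m : ℝ} (hm : m ≠ 0)
    {φ : (G.ExtLeg × Fin 4 → ℝ) → ℂ} {C : ℝ} (hφ : G.IsTestFunction φ C) {M : ℝ} (hM : 1 < M)
    (ρ : ℕ) :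
    Integrable (G.integrand m (R.image G.melopole) φ) (G.cutoffMeasure M ρ) ∧
    HasSum (fun x : G.solutions ∅ => angleCoeff φ x.1.2 *
        ((∏ e, lineKernel m (M ^ (2 * ρ))⁻¹ (mask R x.1.1 e) : ℝ) : ℂ))
      (∫ z, G.integrand m (R.image G.melopole) φ z ∂(G.cutoffMeasure M ρ)) := by
  set σ : Fin 4 → G.White → G.White := fun c => G.source (G.withFreeColor R c) c
  have h1 := integrable_and_hasSum_integral (f := G.integrand m (R.image G.melopole) φ)
    (fun x => integrable_mode hm σ φ M ρ x) (summable_integral_norm_mode hm σ hφ hM ρ) (by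
      filter_upwards [ae_schwinger_pos hM ρ] with z hz
      rw [integrand_image_melopole hG hV hR]
      exact hasSum_mode m σ hφ hz z.2.2)
  refine ⟨h1.1, ?_⟩
  have h2 := h1.2
  -- only the modes that are conserved with skips contribute
  have h3 : (fun x => ∫ z, mode m σ φ x z ∂(G.cutoffMeasure M ρ)) =
      (G.skipSolutions R).indicator fun x => angleCoeff φ x.2 *
        ((∏ e, lineKernel m (M ^ (2 * ρ))⁻¹ (x.1 e) : ℝ) : ℂ) := by
    funext x
    have hdef : (∀ y, defect σ x y = 0) ↔ x ∈ G.skipSolutions R := defect_eq_zero_iff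
    rw [integral_mode hm]
    by_cases hx : x ∈ G.skipSolutions R
    · rw [if_pos (hdef.2 hx), Set.indicator_of_mem hx, mul_one]
    · rw [if_neg (mt hdef.1 hx), Set.indicator_of_notMem hx, mul_zero, mul_zero]
  rw [h3, ← hasSum_subtype_iff_indicator] at h2
  exact ((bijOn_mask hG hV hR).equiv _).hasSum_iff.2 h2

/-- The sum over the meloforests turns the kernels of the dipoles into subtracted kernels. -/
lemma prod_subtractedKernel (m t : ℝ) (N : G.Line → Fin 4 → ℤ) :
    ∏ e, subtractedKernel m t e (N e) = ∑ R ∈ G.melonicLines.powerset,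
      (-1) ^ R.card * ∏ e, lineKernel m t (mask R N e) := by
  have h1 : ∀ e, subtractedKernel m t e (N e) =
      (if e ∈ G.melonicLines then -lineKernel m t (Function.update (N e) (G.freeColor e) 0)
        else 0) + lineKernel m t (N e) := by
    intro e
    rw [subtractedKernel]
    split_ifs <;> ring
  simp only [h1]
  rw [Finset.prod_add]
  refine (Finset.sum_subset (Finset.powerset_mono.2 (Finset.subset_univ _)) fun R _ hR => ?_).symm.trans
    (Finset.sum_congr rfl fun R hR => ?_)
  · rw [Finset.mem_powerset, Finset.not_subset] at hR
    obtain ⟨e, he, he'⟩ := hR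
    rw [Finset.prod_eq_zero he (if_neg he'), zero_mul]
  · rw [Finset.mem_powerset] at hR
    rw [← Finset.prod_sdiff (Finset.subset_univ R), mul_comm (∏ e ∈ Finset.univ \ R, _),
      ← mul_assoc]
    congr 1
    · rw [← Finset.prod_const, ← Finset.prod_mul_distrib]
      refine Finset.prod_congr rfl fun e he => ?_
      rw [if_pos (hR he), neg_one_mul]
      congr 2
      funext c
      simp only [mask, he, true_and, Function.update_apply, eq_comm]
    · refine Finset.prod_congr rfl fun e he => ?_
      have he' : e ∉ R := (Finset.mem_sdiff.1 he).2
      congr 1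
      funext c
      simp only [mask, he', false_and, if_false]

/-- The renormalized amplitude in momentum space. -/
lemma hasSum_renormalizedAmplitude (hG : G.IsConnected) (hV : ¬ G.IsVacuum) {m : ℝ} (hm : m ≠ 0)
    {φ : (G.ExtLeg × Fin 4 → ℝ) → ℂ} {C : ℝ} (hφ : G.IsTestFunction φ C) {M : ℝ} (hM : 1 < M)
    (ρ : ℕ) :
    HasSum (fun x : G.solutions ∅ =>
      weightedTerm m (M ^ (2 * ρ))⁻¹ (angleCoeff φ) ∅ (fun _ _ _ => 1) x.1)
      (G.renormalizedAmplitude M m ρ φ) := by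
  rw [renormalizedAmplitude, sum_meloforests hG hV]
  have hexp : (fun x : G.solutions ∅ =>
      weightedTerm m (M ^ (2 * ρ))⁻¹ (angleCoeff φ) ∅ (fun _ _ _ => 1) x.1) =
      fun x => ∑ R ∈ G.melonicLines.powerset, (-1) ^ (R.image G.melopole).card *
        (angleCoeff φ x.1.2 * ((∏ e, lineKernel m (M ^ (2 * ρ))⁻¹ (mask R x.1.1 e) : ℝ) : ℂ)) := by
    funext x
    simp only [weightedTerm, Finset.compl_empty, Finset.prod_const_one, mul_one,
      prod_subtractedKernel]
    rw [Complex.ofReal_sum, Finset.mul_sum]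
    refine Finset.sum_congr rfl fun R hR => ?_
    rw [card_image_melopole hG hV (Finset.mem_powerset.1 hR)]
    push_cast
    ring
  rw [hexp]
  exact hasSum_sum fun R hR =>
    (integrable_integrand_and_hasSum hG hV (Finset.mem_powerset.1 hR) hm hφ hM ρ).2.mul_left _

/-- A graph without lines is a bubble, whose amplitude is the mean of the test function. -/
lemma norm_renormalizedAmplitude_le_of_isEmpty (hG : G.IsConnected) (hV : ¬ G.IsVacuum)
    [IsEmpty G.Line] {φ : (G.ExtLeg × Fin 4 → ℝ) → ℂ} {C : ℝ} (hφ : G.IsTestFunction φ C)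
    (M m : ℝ) (ρ : ℕ) : ‖G.renormalizedAmplitude M m ρ φ‖ ≤ C := by
  have h0 : G.melonicLines = ∅ := Finset.eq_empty_of_isEmpty _
  have : IsProbabilityMeasure (G.cutoffMeasure M ρ) := by
    have : IsProbabilityMeasure (Measure.pi fun _ : G.Line =>
        (volume.restrict (Set.Ici ((M ^ (2 * ρ))⁻¹)) : Measure ℝ)) := by
      constructor
      rw [Measure.pi_of_empty]
      simp
    rw [cutoffMeasure]
    infer_instance
  rw [renormalizedAmplitude, sum_meloforests hG hV, h0]
  simp only [Finset.powerset_empty, Finset.sum_singleton, Finset.image_empty, Finset.card_empty,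
    pow_zero, one_mul]
  refine (norm_integral_le_of_norm_le_const (Filter.Eventually.of_forall fun z => ?_)).trans_eq
    (by rw [probReal_univ, mul_one])
  simp only [integrand, Finset.univ_eq_empty, Finset.prod_empty, Complex.ofReal_one, one_mul]
  exact hφ.norm_le _

end FeynmanGraph

theorem mainTheorem2 (M m : ℝ) (hM : 1 < M) (hm : m ≠ 0) (p : ℕ) :
    ∃ K : ℝ, 0 < K ∧
      ∀ G : FeynmanGraph, G.IsConnected → ¬ G.IsVacuum → G.OrderAtMost p →
        ∀ (ρ : ℕ) (φ : (G.ExtLeg × Fin 4 → ℝ) → ℂ) (C : ℝ), G.IsTestFunction φ C →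
          (∀ F ∈ G.meloforests, Integrable (G.integrand m F φ) (G.cutoffMeasure M ρ)) ∧
          ‖G.renormalizedAmplitude M m ρ φ‖ ≤ C * K ^ Fintype.card G.Line := by
  refine ⟨FeynmanGraph.growthConstant m p, FeynmanGraph.growthConstant_pos hm p, fun G hG hV hp ρ φ C hφ => ⟨?_, ?_⟩⟩
  · intro F hF
    rw [FeynmanGraph.meloforests_eq hG hV, Finset.mem_image] at hF
    obtain ⟨R, hR, rfl⟩ := hF
    exact (FeynmanGraph.integrable_integrand_and_hasSum hG hV (Finset.mem_powerset.1 hR) hm hφ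
      hM ρ).1
  · rcases isEmpty_or_nonempty G.Line with h | h
    · rw [Fintype.card_eq_zero, pow_zero, mul_one]
      exact FeynmanGraph.norm_renormalizedAmplitude_le_of_isEmpty hG hV hφ M m ρ
    · exact FeynmanGraph.norm_le_of_hasSum hG hV hp hm (inv_pos.2 (pow_pos (by linarith) _))
        hφ.nonneg hφ.norm_angleCoeff_le
        (FeynmanGraph.hasSum_renormalizedAmplitude hG hV hm hφ hM ρ)
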